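/- Let $d\ge 2$, let $\Omega\subset\mathbb{R}^d$ be open, $p\in(d,\infty)$, $\varrho:\Omega\to\mathbb{R}$, $\mu:=\varrho\,dx$, and $A=(a_{ij}):\Omega\to\mathbb{R}^{d\times d}$. Assume: (i) $\sqrt{\varrho}\in H^{1,2}_{\rm loc}(\Omega)$ and $\varrho>0$ $dx$-a.e.; (ii) $\frac{\nabla\varrho}{\varrho}\in L^p_{\rm loc}(\Omega,\mu)$, with $\nabla\varrho$ the weak gradient; (iii) $A$ is symmetric $dx$-a.e., $a_{ij}\in H^{1,\infty}_{\rm loc}(\Omega)$ for all $i,j$, and $A$ is locally strictly elliptic: for each compact $K\subset\Omega$ there is $\kappa_K>0$ such that $\sum_{i,j}a_{ij}(x)\xi_i\xi_j\ge\kappa_K|\xi|^2$ for all $\xi\in\mathbb{R}^d$ and $dx$-a.e. $x\in K$. Then the following hold. (a) $\varrho$ has a unique continuous $\mu$-version on $\Omega$, denoted $\widetilde\varrho$. (b) The form $\mathcal{E}(f,g)=\int_\Omega (A\nabla f,\nabla g)\,d\mu$, $f,g\in C_c^\infty(\Omega)$, is well defined and closable on $L^2(\Omega,\mu)$. Its closure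 $(\mathcal{E},D(\mathcal{E}))$ is a symmetric, strongly local, regular Dirichlet form on $L^2(\Omega,\mu)$ (regularity including that $\mu$ is finite on compact subsets of $\Omega$ and has full support in $\Omega$). (c) There are a strongly continuous contraction semigroup $(T^2_t)_{t\ge0}$ on $L^2(\Omega,\mu)$ associated with $(\mathcal{E},D(\mathcal{E}))$, i.e. whose generator $L_2$ satisfies ($u\in D(L_2)$ and $L_2u=w$) if and only if ($u\in D(\mathcal{E})$ and $\mathcal{E}(u,v)=-(w,v)_{L^2(\Omega,\mu)}$ for all $v\in D(\mathcal{E})$), and a strongly continuous contraction semigroup $(T^p_t)_{t\ge0}$ on $L^p(\Omega,\mu)$ with $T^p_tf=T^2_tf$ for all $t\ge 0$ and $f\in L^1(\Omega,\mu)\cap L^\infty(\Omega,\mu)$. For any such semigroups, with generators $L_2$ and $L_p$, every $f\in C_c^\infty(\Omega)$ lies in $D(L_2)\cap D(L_p)$ and $$L_pf=L_2f=Lf:=\sum_{i,j=1}^d\Big(\partial_i(a_{ij}\,\partial_jf)+\partial_i(\ln\varrho)\,a_{ij}\,\partial_jf\Big),\qquad \partial_i(\ln\varrho):=\frac{\partial_i\varrho}{\varrho}.$$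 Moreover, $\mu$-a.e., $$Lf=\sum_{i,j=1}^d a_{ij}\,\partial_i\partial_jf+\sum_{i=1}^d b_i\,\partial_if,\qquad b_i:=\sum_{j=1}^d\big(\partial_ja_{ij}+\partial_j(\ln\varrho)\,a_{ij}\big),$$ where the derivatives of $a_{ij}$, $a_{ij}\partial_jf$ and $\varrho$ are weak derivatives. (d) $\mathrm{cap}_{\mathcal{E}}(\{\widetilde\varrho=0\})=0$. Here, for open $U\subset\Omega$, $\mathrm{cap}_{\mathcal{E}}(U)=\inf\{\mathcal{E}(u,u)+\|u\|_{L^2(\Omega,\mu)}^2 : u\in D(\mathcal{E}),\ u\ge1\ \mu\text{-a.e. on }U\}$ (with $\inf\emptyset=\infty$), and $\mathrm{cap}_{\mathcal{E}}(B)=\inf\{\mathrm{cap}_{\mathcal{E}}(U): U \text{ open},\ B\subset U\subset\Omega\}$ for $B\subset\Omega$. -/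

import Mathlib

open MeasureTheory Filter Topology TopologicalSpace Set
open scoped ENNReal NNReal

noncomputable section

/-! ### Local Lebesgue spaces, weak derivatives, local Sobolev spaces -/

section WeakDerivatives

variable {d : ℕ}

/-- The classical `i`-th partial derivative. -/
def partialDeriv (i : Fin d) (f : EuclideanSpace ℝ (Fin d) → ℝ) (x : EuclideanSpace ℝ (Fin d)) :
    ℝ :=
  fderiv ℝ f x (EuclideanSpace.single i 1)

/-- `f ∈ L^q_loc(Ω, m)`: `f` is `q`-integrable over every compact subset of `Ω`. -/
def MemLpLoc (Ω : Opens (EuclideanSpace ℝ (Fin d))) (m : Measure (EuclideanSpace ℝ (Fin d)))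
    (q : ℝ≥0∞) (f : EuclideanSpace ℝ (Fin d) → ℝ) : Prop :=
  ∀ K : Set (EuclideanSpace ℝ (Fin d)), IsCompact K → K ⊆ Ω → MemLp f q (m.restrict K)

/-- `g` is a weak `i`-th partial derivative of `f` on the open set `Ω`. -/
def IsWeakPartial (Ω : Opens (EuclideanSpace ℝ (Fin d))) (i : Fin d)
    (f g : EuclideanSpace ℝ (Fin d) → ℝ) : Prop :=
  LocallyIntegrableOn f Ω volume ∧ LocallyIntegrableOn g Ω volume ∧
    ∀ φ : TestFunction Ω ℝ ⊤,
      ∫ x in (Ω : Set (EuclideanSpace ℝ (Fin d))), f x * partialDeriv i φ x =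
        -∫ x in (Ω : Set (EuclideanSpace ℝ (Fin d))), g x * φ x

open Classical in
/-- The weak partial derivative `∂_i f` on `Ω`, as one chosen representative of its class of
functions modulo Lebesgue null sets of `Ω` (zero if no weak derivative exists). -/
def weakPartial (Ω : Opens (EuclideanSpace ℝ (Fin d))) (i : Fin d)
    (f : EuclideanSpace ℝ (Fin d) → ℝ) : EuclideanSpace ℝ (Fin d) → ℝ :=
  if h : ∃ g, IsWeakPartial Ω i f g then Classical.choose h else 0

/-- `f ∈ H^{1,q}_loc(Ω)`. -/
def MemSobolevLoc (Ω : Opens (EuclideanSpace ℝ (Fin d))) (q : ℝ≥0∞)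
    (f : EuclideanSpace ℝ (Fin d) → ℝ) : Prop :=
  MemLpLoc Ω volume q f ∧
    ∀ i : Fin d, ∃ g, IsWeakPartial Ω i f g ∧ MemLpLoc Ω volume q g

end WeakDerivatives

/-! ### Symmetric forms on `L²` and Dirichlet forms -/

/-- A real bilinear form defined on a linear subspace of `L²(m)`. -/
structure L2Form {X : Type*} [MeasurableSpace X] (m : Measure X) where
  /-- the domain of the form -/
  domain : Submodule ℝ (Lp ℝ 2 m)
  /-- the form -/
  form : domain →ₗ[ℝ] domain →ₗ[ℝ] ℝ

namespace L2Form

section General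

variable {X : Type*} [MeasurableSpace X] {m : Measure X}

/-- `E_1(u, u) = E(u, u) + ‖u‖²`. -/
def energyOne (E : L2Form m) (u : E.domain) : ℝ :=
  E.form u u + ‖(u : Lp ℝ 2 m)‖ ^ 2

/-- Closability: `E`-Cauchy sequences that tend to `0` in `L²` have energy tending to `0`. -/
def IsClosable (E : L2Form m) : Prop :=
  ∀ u : ℕ → E.domain,
    Tendsto (fun k : ℕ × ℕ => E.form (u k.1 - u k.2) (u k.1 - u k.2)) atTop (𝓝 0) →
    Tendsto (fun n => ‖(u n : Lp ℝ 2 m)‖) atTop (𝓝 0) →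
    Tendsto (fun n => E.form (u n) (u n)) atTop (𝓝 0)

/-- Closedness: the domain is complete for the norm `E_1^{1/2}`. -/
def IsClosedForm (E : L2Form m) : Prop :=
  ∀ u : ℕ → E.domain,
    Tendsto (fun k : ℕ × ℕ => E.energyOne (u k.1 - u k.2)) atTop (𝓝 0) →
    ∃ v : E.domain, Tendsto (fun n => E.energyOne (u n - v)) atTop (𝓝 0)

/-- `E` is the closure of `E₀`: a closed extension in whose domain the domain of `E₀` is dense
for the norm `E_1^{1/2}`. -/
def IsClosureOf (E E₀ : L2Form m) : Prop :=
  (∀ u : E₀.domain, (u : Lp ℝ 2 m) ∈ E.domain) ∧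
  (∀ (u v : E₀.domain) (u' v' : E.domain), (u' : Lp ℝ 2 m) = u → (v' : Lp ℝ 2 m) = v →
    E.form u' v' = E₀.form u v) ∧
  E.IsClosedForm ∧
  ∀ (u : E.domain) (ε : ℝ), 0 < ε →
    ∃ v : E.domain, (v : Lp ℝ 2 m) ∈ E₀.domain ∧ E.energyOne (u - v) < ε

/-- A symmetric Dirichlet form on `L²(m)`: densely defined, symmetric, nonnegative, closed, and
Markovian, i.e. the unit contraction `u⁺ ∧ 1` operates on it. -/
structure IsSymmDirichletForm (E : L2Form m) : Prop where
  dense_domain : Dense (E.domain : Set (Lp ℝ 2 m))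
  symmetric : ∀ u v : E.domain, E.form u v = E.form v u
  nonneg : ∀ u : E.domain, 0 ≤ E.form u u
  closed : E.IsClosedForm
  markovian : ∀ u : E.domain, ∃ v : E.domain,
    ((v : Lp ℝ 2 m) : X → ℝ) =ᵐ[m] (fun x => min (max (((u : Lp ℝ 2 m) : X → ℝ) x) 0) 1) ∧
      E.form v v ≤ E.form u u

end General

section Topological

/- Here the state space is an open subset `Ω` of a topological space `X`, and `m` is thought of as
a measure on `Ω`, i.e. a measure on `X` which does not charge the complement of `Ω`. -/
variable {X : Type*} [TopologicalSpace X] [MeasurableSpace X] {m : Measure X}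

/-- The support in `Ω` of a class of functions: the complement in `Ω` of the largest open set on
which it vanishes almost everywhere. -/
def essSupport (m : Measure X) (Ω : Opens X) (u : X → ℝ) : Set X :=
  {x | x ∈ Ω ∧ ∀ U : Set X, IsOpen U → x ∈ U → ¬ u =ᵐ[m.restrict U] 0}

/-- Strong locality: `E(u, v) = 0` if `u`, `v` have compact support and `v` is constant on a
neighbourhood of the support of `u`. -/
def IsStronglyLocal (E : L2Form m) (Ω : Opens X) : Prop :=
  ∀ u v : E.domain,
    IsCompact (essSupport m Ω (u : Lp ℝ 2 m)) →
    IsCompact (essSupport m Ω (v : Lp ℝ 2 m)) →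
    (∃ (U : Set X) (c : ℝ), IsOpen U ∧ essSupport m Ω (u : Lp ℝ 2 m) ⊆ U ∧
      ((v : Lp ℝ 2 m) : X → ℝ) =ᵐ[m.restrict U] fun _ => c) →
    E.form u v = 0

/-- `f ∈ C_c(Ω)`, extended by zero. -/
def IsCc (Ω : Opens X) (f : X → ℝ) : Prop :=
  Continuous f ∧ HasCompactSupport f ∧ tsupport f ⊆ Ω

/-- Regularity: `m` is finite on compact sets and has full support in `Ω`, and
`D(E) ∩ C_c(Ω)` is dense in `D(E)` for the norm `E_1^{1/2}` and in `C_c(Ω)` for the uniform norm. -/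
structure IsRegular (E : L2Form m) (Ω : Opens X) : Prop where
  finite_on_compacts : ∀ K : Set X, IsCompact K → K ⊆ Ω → m K < ∞
  full_support : ∀ U : Set X, IsOpen U → U ⊆ Ω → U.Nonempty → 0 < m U
  dense_form : ∀ (u : E.domain) (ε : ℝ), 0 < ε → ∃ (f : X → ℝ) (v : E.domain),
    IsCc Ω f ∧ ((v : Lp ℝ 2 m) : X → ℝ) =ᵐ[m] f ∧ E.energyOne (u - v) < ε
  dense_uniform : ∀ (g : X → ℝ) (ε : ℝ), IsCc Ω g → 0 < ε → ∃ (f : X → ℝ) (v : E.domain),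
    IsCc Ω f ∧ ((v : Lp ℝ 2 m) : X → ℝ) =ᵐ[m] f ∧ ∀ x, |f x - g x| < ε

/-- Capacity of an open set `U`: the infimum of `E_1(u, u)` over all `u ∈ D(E)` with `u ≥ 1`
almost everywhere on `U`. -/
def openCapacity (E : L2Form m) (U : Set X) : ℝ≥0∞ :=
  ⨅ (u : E.domain) (_ : ∀ᵐ x ∂(m.restrict U), 1 ≤ ((u : Lp ℝ 2 m) : X → ℝ) x),
    ENNReal.ofReal (E.energyOne u)

/-- Capacity of an arbitrary subset of `Ω`. -/
def capacity (E : L2Form m) (Ω : Opens X) (B : Set X) : ℝ≥0∞ :=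
  ⨅ (U : Set X) (_ : IsOpen U ∧ B ⊆ U ∧ U ⊆ Ω), E.openCapacity U

end Topological

end L2Form

/-! ### Semigroups and generators -/

section Semigroups

/-- Strongly continuous contraction semigroups on a Banach space. -/
structure IsSCContractionSemigroup {V : Type*} [NormedAddCommGroup V] [NormedSpace ℝ V]
    (T : ℝ≥0 → V →L[ℝ] V) : Prop where
  zero : T 0 = ContinuousLinearMap.id ℝ V
  add : ∀ s t, T (s + t) = (T s).comp (T t)
  contraction : ∀ t, ‖T t‖ ≤ 1
  strong_continuity : ∀ u, Tendsto (fun t => T t u) (𝓝 0) (𝓝 u)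

/-- `u` lies in the domain of the generator `L` of `T`, and `L u = w`. -/
def IsGeneratorAt {V : Type*} [NormedAddCommGroup V] [NormedSpace ℝ V]
    (T : ℝ≥0 → V →L[ℝ] V) (u w : V) : Prop :=
  Tendsto (fun t : ℝ≥0 => (t : ℝ)⁻¹ • (T t u - u)) (𝓝[>] 0) (𝓝 w)

variable {X : Type*} [MeasurableSpace X] {m : Measure X}

/-- `T` is the strongly continuous contraction semigroup on `L²(m)` associated with `E`: its
generator `L` satisfies `u ∈ D(L)`, `L u = w` if and only if
`u ∈ D(E)` and `E(u, v) = -(w, v)` for all `v ∈ D(E)`. -/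
def IsL2Semigroup (E : L2Form m) (T : ℝ≥0 → Lp ℝ 2 m →L[ℝ] Lp ℝ 2 m) : Prop :=
  IsSCContractionSemigroup T ∧
  ∀ u w : Lp ℝ 2 m, IsGeneratorAt T u w ↔
    ∃ u' : E.domain, (u' : Lp ℝ 2 m) = u ∧
      ∀ v : E.domain, E.form u' v = -inner ℝ w (v : Lp ℝ 2 m)

/-- `S` is the strongly continuous contraction semigroup on `L^p(m)` associated with the semigroup
`T` on `L²(m)`: both coincide on `L¹(m) ∩ L^∞(m)`. -/
def IsLpSemigroup {p : ℝ≥0∞} [Fact (1 ≤ p)] (T : ℝ≥0 → Lp ℝ 2 m →L[ℝ] Lp ℝ 2 m)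
    (S : ℝ≥0 → Lp ℝ p m →L[ℝ] Lp ℝ p m) : Prop :=
  IsSCContractionSemigroup S ∧
  ∀ (t : ℝ≥0) (u : Lp ℝ 2 m) (v : Lp ℝ p m), MemLp u 1 m → MemLp u ∞ m →
    (u : X → ℝ) =ᵐ[m] v → (T t u : X → ℝ) =ᵐ[m] S t v

/-- The functions `f`, `g` represent classes in `L^r(m)`, the class of `f` lies in the domain of
the generator `L` of `T`, and `L f = g`. -/
def HasGeneratorValue {r : ℝ≥0∞} [Fact (1 ≤ r)] (T : ℝ≥0 → Lp ℝ r m →L[ℝ] Lp ℝ r m)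
    (f g : X → ℝ) : Prop :=
  ∃ u w : Lp ℝ r m, (u : X → ℝ) =ᵐ[m] f ∧ (w : X → ℝ) =ᵐ[m] g ∧ IsGeneratorAt T u w

end Semigroups

/-! ### The elliptic gradient form -/

section EllipticForm

variable {d : ℕ}

/-- The measure `μ = ϱ dx` on `Ω`. -/
def densityMeasure (Ω : Opens (EuclideanSpace ℝ (Fin d))) (ϱ : EuclideanSpace ℝ (Fin d) → ℝ) :
    Measure (EuclideanSpace ℝ (Fin d)) :=
  (volume.restrict (Ω : Set (EuclideanSpace ℝ (Fin d)))).withDensity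
    fun x => ENNReal.ofReal (ϱ x)

/-- The conditions on the density `ϱ` and the matrix `A`. -/
structure EllipticConditions (Ω : Opens (EuclideanSpace ℝ (Fin d)))
    (A : EuclideanSpace ℝ (Fin d) → Matrix (Fin d) (Fin d) ℝ)
    (ϱ : EuclideanSpace ℝ (Fin d) → ℝ) (p : ℝ≥0∞) : Prop where
  sqrt_density : MemSobolevLoc Ω 2 fun x => √(ϱ x)
  density_pos : ∀ᵐ x ∂(volume.restrict (Ω : Set (EuclideanSpace ℝ (Fin d)))), 0 < ϱ x
  log_gradient : ∀ i : Fin d, ∃ g, IsWeakPartial Ω i ϱ g ∧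
    MemLpLoc Ω (densityMeasure Ω ϱ) p fun x => g x / ϱ x
  symmetric : ∀ᵐ x ∂(volume.restrict (Ω : Set (EuclideanSpace ℝ (Fin d)))), (A x).IsSymm
  elliptic : ∀ K : Set (EuclideanSpace ℝ (Fin d)), IsCompact K → K ⊆ Ω →
    ∃ κ : ℝ, 0 < κ ∧ ∀ᵐ x ∂(volume.restrict K), ∀ ξ : Fin d → ℝ,
      κ * ∑ i, ξ i ^ 2 ≤ ∑ i, ∑ j, A x i j * ξ i * ξ j
  coeff : ∀ i j : Fin d, MemSobolevLoc Ω ∞ fun x => A x i j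

/-- The integrand `(A ∇f, ∇g)`. -/
def gradientDensity (A : EuclideanSpace ℝ (Fin d) → Matrix (Fin d) (Fin d) ℝ)
    (f g : EuclideanSpace ℝ (Fin d) → ℝ) (x : EuclideanSpace ℝ (Fin d)) : ℝ :=
  ∑ i, ∑ j, A x i j * partialDeriv i f x * partialDeriv j g x

/-- `E₀` is the form `E₀(f, g) = ∫ (A ∇f, ∇g) dμ` with domain (the classes of functions in)
`C_c^∞(Ω)`; all integrals converge. -/
structure IsGradientPreForm (Ω : Opens (EuclideanSpace ℝ (Fin d)))
    (A : EuclideanSpace ℝ (Fin d) → Matrix (Fin d) (Fin d) ℝ)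
    {μ : Measure (EuclideanSpace ℝ (Fin d))} (E₀ : L2Form μ) : Prop where
  domain_mem : ∀ f : TestFunction Ω ℝ ⊤, ∃ u : E₀.domain, ((u : Lp ℝ 2 μ) : _ → ℝ) =ᵐ[μ] f
  mem_domain : ∀ u : E₀.domain, ∃ f : TestFunction Ω ℝ ⊤, ((u : Lp ℝ 2 μ) : _ → ℝ) =ᵐ[μ] f
  form_eq : ∀ (f g : TestFunction Ω ℝ ⊤) (u v : E₀.domain),
    ((u : Lp ℝ 2 μ) : _ → ℝ) =ᵐ[μ] f → ((v : Lp ℝ 2 μ) : _ → ℝ) =ᵐ[μ] g →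
    Integrable (gradientDensity A f g) μ ∧ E₀.form u v = ∫ x, gradientDensity A f g x ∂μ

/-- The logarithmic derivative `∂_i (ln ϱ) = ∂_i ϱ / ϱ`. -/
def logPartial (Ω : Opens (EuclideanSpace ℝ (Fin d))) (ϱ : EuclideanSpace ℝ (Fin d) → ℝ)
    (i : Fin d) (x : EuclideanSpace ℝ (Fin d)) : ℝ :=
  weakPartial Ω i ϱ x / ϱ x

/-- `L f = ∑_{i,j} ∂_i (a_{ij} ∂_j f) + ∂_i (ln ϱ) a_{ij} ∂_j f`. -/
def divergenceGenerator (Ω : Opens (EuclideanSpace ℝ (Fin d)))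
    (A : EuclideanSpace ℝ (Fin d) → Matrix (Fin d) (Fin d) ℝ)
    (ϱ : EuclideanSpace ℝ (Fin d) → ℝ) (f : EuclideanSpace ℝ (Fin d) → ℝ)
    (x : EuclideanSpace ℝ (Fin d)) : ℝ :=
  ∑ i, ∑ j, (weakPartial Ω i (fun y => A y i j * partialDeriv j f y) x +
    logPartial Ω ϱ i x * A x i j * partialDeriv j f x)

/-- `b_i = ∑_j ∂_j a_{ij} + ∂_j (ln ϱ) a_{ij}`. -/
def driftCoeff (Ω : Opens (EuclideanSpace ℝ (Fin d)))
    (A : EuclideanSpace ℝ (Fin d) → Matrix (Fin d) (Fin d) ℝ)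
    (ϱ : EuclideanSpace ℝ (Fin d) → ℝ) (i : Fin d) (x : EuclideanSpace ℝ (Fin d)) : ℝ :=
  ∑ j, (weakPartial Ω j (fun y => A y i j) x + logPartial Ω ϱ j x * A x i j)

/-- `∑_{i,j} a_{ij} ∂_i ∂_j f + ∑_i b_i ∂_i f`. -/
def driftGenerator (Ω : Opens (EuclideanSpace ℝ (Fin d)))
    (A : EuclideanSpace ℝ (Fin d) → Matrix (Fin d) (Fin d) ℝ)
    (ϱ : EuclideanSpace ℝ (Fin d) → ℝ) (f : EuclideanSpace ℝ (Fin d) → ℝ)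
    (x : EuclideanSpace ℝ (Fin d)) : ℝ :=
  ∑ i, ∑ j, A x i j * partialDeriv i (partialDeriv j f) x +
    ∑ i, driftCoeff Ω A ϱ i x * partialDeriv i f x

end EllipticForm

end

/-! Everything rests on one integration by parts. The coefficients `a_ij` and their weak derivatives
are locally bounded, and `∇ϱ/ϱ` is locally in `L^p(μ)`. Hence `∫ (A∇f, ∇g) dμ = -∫ (Lf) g dμ` for
test functions, with `Lf ∈ L^q(μ)` for all `1 ≤ q ≤ p` (`integral_gradientDensity`,
`memLp_divergenceGenerator`). Since `p > d ≥ 2`, `Lf` lies in `L²(μ)`, and a nonnegative symmetric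
form represented by an operator with values in `L²` is closable (`closable_of_generator`).

Closability says exactly that the completion `V` of the test functions for `E_1^{1/2}` still embeds
injectively in `L²(μ)` by a map `ι` (`exists_form_completion`), and the closure is the form `⟪x,
y⟫_V - ⟪ιx, ιy⟫` on the image of `ι`. The Markov property follows by composing test functions with
smooth approximations of the unit contraction whose derivatives are at most one in absolute value.
The limit stays in `V` without gain of energy because balls of `V` are closed in `L²`
(`exists_norm_le_of_tendsto`). For strong locality, `u` is approximated by test functions `g`
supported where `v` is constant, and then `(Lg, v) = 0`.

The operator `ι ι*` is `(1 - L)⁻¹`, from which Yosida approximations build the semigroup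
(`exists_semigroup_of_resolvent`). A resolvent minimises the energy plus a multiple of the squared
distance to its argument, so it preserves `0 ≤ f ≤ 1`, and so does the semigroup. A symmetric
sub-Markovian operator contracts `L^p`: Jensen's inequality `|Tu|^q ≤ T|u|^q` reduces this to `L¹`,
where it is dual to `T 1 ≤ 1`. The semigroup therefore extends to `L^p`. Its generator on test
functions is found by writing difference quotients as limits of averages of `T_s Lf`, which can be
read in `L²` and in `L^p` alike (`IsLpSemigroup.hasGeneratorValue`).

For the continuous version, `∇(ϱ^{1/p}) = p⁻¹ ϱ^{1/p} ∇ϱ/ϱ` formally, so its `p`-th power is locally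
integrable. Because `p > d`, Morrey's inequality makes `ϱ^{1/p}` Hölder continuous near each point,
up to a null set. The argument is carried out on mollifications of `ϱ`, whose derivatives Hölder's
inequality controls.

For the capacity, `log ϱ` has locally finite energy, bounded by a multiple of `∫ |∇ϱ/ϱ|² dμ`, but is
infinite where `ϱ` vanishes. Localised logarithms of mollified densities thus have bounded energy
and are arbitrarily large near the zero set. Dividing by their size gives test functions of small
norm that are at least one there (`exists_local_small`), and a countable cover with a convergent sum
finishes the argument. -/

/-! ### Convergence of contractions, checked on a dense set. -/

section DenseSubset

variable {H : Type*} [NormedAddCommGroup H] [NormedSpace ℝ H]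

theorem forall_cauchySeq_of_dense {T : ℕ → H →L[ℝ] H} (hT : ∀ n, ‖T n‖ ≤ 1) {D : Set H}
    (hD : Dense D) (h : ∀ v ∈ D, CauchySeq fun n => T n v) (u : H) : CauchySeq fun n => T n u := by
  rw [Metric.cauchySeq_iff']
  intro ε hε
  obtain ⟨v, hv, huv⟩ := Metric.dense_iff.1 hD u (ε / 3) (by positivity)
  obtain ⟨N, hN⟩ := Metric.cauchySeq_iff'.1 (h v huv) (ε / 3) (by positivity)
  refine ⟨N, fun n hn => ?_⟩
  have h1 : ∀ n, dist (T n u) (T n v) ≤ dist v u := fun n => by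
    rw [dist_comm v, dist_eq_norm, dist_eq_norm, ← map_sub]
    simpa using (T n).le_of_opNorm_le (hT n) (u - v)
  have h2 := h1 n
  have h3 := h1 N
  rw [dist_comm] at h3
  have h4 := hN n hn
  rw [Metric.mem_ball] at hv
  linarith [dist_triangle4 (T n u) (T n v) (T N v) (T N u)]

theorem forall_tendsto_of_dense {ι : Type*} {l : Filter ι} {T : ι → H →L[ℝ] H}
    (hT : ∀ n, ‖T n‖ ≤ 1) {D : Set H} (hD : Dense D)
    (h : ∀ v ∈ D, Tendsto (fun n => T n v) l (𝓝 v)) (u : H) :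
    Tendsto (fun n => T n u) l (𝓝 u) := by
  rw [Metric.tendsto_nhds]
  intro ε hε
  obtain ⟨v, hv, huv⟩ := Metric.dense_iff.1 hD u (ε / 3) (by positivity)
  filter_upwards [Metric.tendsto_nhds.1 (h v huv) (ε / 3) (by positivity)] with n hn
  have h2 : dist (T n u) (T n v) ≤ dist v u := by
    rw [dist_comm v, dist_eq_norm, dist_eq_norm, ← map_sub]
    simpa using (T n).le_of_opNorm_le (hT n) (u - v)
  rw [Metric.mem_ball] at hv
  linarith [dist_triangle4 (T n u) (T n v) v u]

end DenseSubset

/-! ### Exponentials, Yosida approximation and the Hille–Yosida theorem. -/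

section HilleYosida

variable {H : Type*} [NormedAddCommGroup H] [InnerProductSpace ℝ H]

/-- A convex combination with infinitely many weights stays in a closed convex set. -/
theorem Convex.hasSum_mem {F : Type*} [NormedAddCommGroup F] [NormedSpace ℝ F] {C : Set F}
    (hC : Convex ℝ C) (hcl : IsClosed C) {w : ℕ → ℝ} {x : ℕ → F} {y : F} (hw : ∀ n, 0 ≤ w n)
    (hw0 : 0 < w 0) (hw1 : HasSum w 1) (hx : ∀ n, x n ∈ C) (hy : HasSum (fun n => w n • x n) y) :
    y ∈ C := by
  have h1 := hw1.tendsto_sum_nat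
  have h2 := hy.tendsto_sum_nat
  have h3 : Tendsto (fun n => (∑ i ∈ Finset.range n, w i)⁻¹ • ∑ i ∈ Finset.range n, w i • x i)
      atTop (𝓝 ((1 : ℝ)⁻¹ • y)) := (h1.inv₀ one_ne_zero).smul h2
  rw [inv_one, one_smul] at h3
  refine hcl.mem_of_tendsto h3 ((eventually_ge_atTop 1).mono fun n hn => ?_)
  have hpos : 0 < ∑ i ∈ Finset.range n, w i :=
    Finset.sum_pos' (fun i _ => hw i) ⟨0, Finset.mem_range.2 (by omega), hw0⟩
  exact hC.centerMass_mem (fun i _ => hw i) hpos (fun i _ => hx i)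

variable [CompleteSpace H]

/-- Here `e^{s(J-1)} f = Σ e^{-s} sⁿ/n! Jⁿ f` is a convex combination, with Poisson weights, of the
points `Jⁿ f` of `C`. -/
theorem exp_smul_sub_one_mem_of_convex (J : H →L[ℝ] H) {C : Set H} (hC : Convex ℝ C)
    (hcl : IsClosed C) (hJ : ∀ f ∈ C, J f ∈ C) {s : ℝ} (hs : 0 ≤ s) {f : H} (hf : f ∈ C) :
    NormedSpace.exp (s • (J - 1)) f ∈ C := by
  rcases eq_or_lt_of_le hs with rfl | hs
  · simpa [NormedSpace.exp_zero] using hf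
  have e1 : NormedSpace.exp (s • (J - 1)) = Real.exp (-s) • NormedSpace.exp (s • J) := by
    have e0 : s • (J - 1) = (-s) • (1 : H →L[ℝ] H) + s • J := by rw [smul_sub]; module
    let _ : NormedAlgebra ℚ (H →L[ℝ] H) := .restrictScalars ℚ ℝ _
    rw [e0, NormedSpace.exp_add_of_commute ((Commute.one_left _).smul_left _)]
    rw [← Algebra.algebraMap_eq_smul_one, ← NormedSpace.algebraMap_exp_comm,
      ← Real.exp_eq_exp_ℝ, Algebra.algebraMap_eq_smul_one, smul_mul_assoc, one_mul]
  have h2 := NormedSpace.exp_series_hasSum_exp' (𝕂 := ℝ) (s • J)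
  have h3 : HasSum (fun n : ℕ => (Real.exp (-s) * ((n.factorial : ℝ)⁻¹ * s ^ n)) • (J ^ n) f)
      (NormedSpace.exp (s • (J - 1)) f) := by
    have h4 := (h2.mapL (ContinuousLinearMap.apply ℝ H f)).const_smul (Real.exp (-s))
    rw [e1]
    convert h4 using 1
    · funext n
      simp [smul_pow, smul_smul]
    · rfl
  have h5 : HasSum (fun n : ℕ => Real.exp (-s) * ((n.factorial : ℝ)⁻¹ * s ^ n)) 1 := by
    have := (NormedSpace.exp_series_hasSum_exp' (𝕂 := ℝ) s).mul_left (Real.exp (-s))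
    rw [← Real.exp_eq_exp_ℝ, ← Real.exp_add, neg_add_cancel, Real.exp_zero] at this
    simpa using this
  refine hC.hasSum_mem hcl (fun n => by positivity) (by simpa using Real.exp_pos _) h5 (fun n => ?_) h3
  induction n with
  | zero => simpa using hf
  | succ n ih => rw [pow_succ']; exact hJ _ ih

/-- Mean value inequality for `s ↦ e^{sA} u - s w`, whose derivative is `e^{sA} A u - w`. -/
theorem norm_exp_smul_apply_sub_le (A : H →L[ℝ] H) (u w : H) {t C : ℝ} (ht : 0 ≤ t)
    (h : ∀ s, 0 ≤ s → s ≤ t → ‖NormedSpace.exp (s • A) (A u) - w‖ ≤ C) :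
    ‖NormedSpace.exp (t • A) u - u - t • w‖ ≤ C * t := by
  have hd : ∀ s : ℝ, HasDerivAt (fun s : ℝ => NormedSpace.exp (s • A) u - s • w)
      (NormedSpace.exp (s • A) (A u) - w) s := fun s => by
    have h1 := (hasDerivAt_exp_smul_const (𝕂 := ℝ) A s).clm_apply (hasDerivAt_const s u)
    have h2 := (hasDerivAt_id s).smul_const w
    exact (h1.sub h2).congr_deriv (by simp)
  have := norm_image_sub_le_of_norm_deriv_le_segment' (a := 0) (b := t)
    (fun s _ => (hd s).hasDerivWithinAt) (fun s hs => h s hs.1 hs.2.le) t ⟨ht, le_rfl⟩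
  simpa [NormedSpace.exp_zero, sub_right_comm] using this

/-- The path `s ↦ e^{sA} e^{(t-s)B} u` joins the two vectors, and by commutation its derivative is
`e^{sA} e^{(t-s)B} (Au - Bu)`. -/
theorem norm_exp_smul_sub_exp_smul_le {A B : H →L[ℝ] H} (hAB : Commute A B)
    (hA : ∀ s : ℝ, 0 ≤ s → ‖NormedSpace.exp (s • A)‖ ≤ 1)
    (hB : ∀ s : ℝ, 0 ≤ s → ‖NormedSpace.exp (s • B)‖ ≤ 1) {t : ℝ} (ht : 0 ≤ t) (u : H) :
    ‖NormedSpace.exp (t • A) u - NormedSpace.exp (t • B) u‖ ≤ ‖A u - B u‖ * t := by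
  have hd : ∀ s : ℝ, HasDerivAt
      (fun s : ℝ => (NormedSpace.exp (s • A) * NormedSpace.exp ((t - s) • B)) u)
      ((NormedSpace.exp (s • A) * NormedSpace.exp ((t - s) • B)) (A u - B u)) s := fun s => by
    have h1 := hasDerivAt_exp_smul_const (𝕂 := ℝ) A s
    have h2 := (hasDerivAt_exp_smul_const (𝕂 := ℝ) B (t - s)).scomp s
      ((hasDerivAt_id s).const_sub t)
    have h3 := (h1.mul h2).clm_apply (hasDerivAt_const s u)
    have hc : Commute A (NormedSpace.exp ((t - s) • B)) :=
      (hAB.smul_right (t - s)).exp_right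
    refine h3.congr_deriv ?_
    have := congrArg (fun T : H →L[ℝ] H => NormedSpace.exp (s • A) (T u)) hc.eq
    simp only [mul_apply_eq_comp] at this
    simp [this, ← sub_eq_add_neg]
  have := norm_image_sub_le_of_norm_deriv_le_segment' (a := 0) (b := t) (C := ‖A u - B u‖)
    (fun s _ => (hd s).hasDerivWithinAt) (fun s hs => ?_) t ⟨ht, le_rfl⟩
  · simpa [NormedSpace.exp_zero] using this
  · calc _ ≤ ‖NormedSpace.exp (s • A)‖ * (‖NormedSpace.exp ((t - s) • B)‖ * ‖A u - B u‖) :=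
        (ContinuousLinearMap.le_opNorm _ _).trans
          (mul_le_mul_of_nonneg_left (ContinuousLinearMap.le_opNorm _ _) (norm_nonneg _))
      _ ≤ 1 * (1 * ‖A u - B u‖) := by
        gcongr
        · exact hA s hs.1
        · exact hB _ (sub_nonneg.2 hs.2.le)
      _ = _ := by ring


/-- The resolvent `(n+1)(n+1-L)⁻¹`, expressed through `G = (1-L)⁻¹`. -/
noncomputable def yosidaResolvent (G : H →L[ℝ] H) (n : ℕ) : H →L[ℝ] H :=
  ((n : ℝ) + 1) • (G * Ring.inverse (1 + (n : ℝ) • G))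

/-- The Yosida approximation `(n+1)((n+1)(n+1-L)⁻¹-1)` of `L`, where `G = (1-L)⁻¹`. -/
noncomputable def yosidaApprox (G : H →L[ℝ] H) (n : ℕ) : H →L[ℝ] H :=
  ((n : ℝ) + 1) • (yosidaResolvent G n - 1)

variable {G : H →L[ℝ] H}

/-- Lax–Milgram. For `G = (1 - L)⁻¹` the condition `‖Gx‖² ≤ ⟪Gx, x⟫` expresses `L ≤ 0`, and it makes
`1 + nG` coercive with constant one. -/
theorem isUnit_one_add_smul (hle : ∀ x, ‖G x‖ ^ 2 ≤ inner ℝ (G x) x) (n : ℕ) :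
    IsUnit (1 + (n : ℝ) • G) := by
  refine ContinuousLinearMap.isUnit_of_forall_le_norm_inner_map _ (c := 1) one_pos fun x => ?_
  have h0 : 0 ≤ inner ℝ (G x) x := (sq_nonneg _).trans (hle x)
  have : inner ℝ ((1 + (n : ℝ) • G) x) x = ‖x‖ ^ 2 + n * inner ℝ (G x) x := by
    simp [inner_add_left, inner_smul_left]
  rw [this, Real.norm_of_nonneg (by positivity)]
  have : 0 ≤ (n : ℝ) * inner ℝ (G x) x := by positivity
  simpa using this

/-- With `G = (1 - L)⁻¹` and `λ = n + 1`, the right side reads `u - Lu = u + λ(f - u)`, that is `(λ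
- L)u = λf`. This form of the resolvent equation never mentions the unbounded `L`. -/
theorem yosidaResolvent_spec (hle : ∀ x, ‖G x‖ ^ 2 ≤ inner ℝ (G x) x) (n : ℕ) (f u : H) :
    yosidaResolvent G n f = u ↔ u = G (u + ((n : ℝ) + 1) • (f - u)) := by
  have hU := isUnit_one_add_smul hle n
  have hc : Commute (1 + (n : ℝ) • G) G :=
    ((Commute.one_left G).add_left ((Commute.refl G).smul_left _))
  have hK : ∀ f, (1 + (n : ℝ) • G) (yosidaResolvent G n f) = ((n : ℝ) + 1) • G f := fun f => by
    have : (1 + (n : ℝ) • G) * yosidaResolvent G n = ((n : ℝ) + 1) • G := by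
      rw [yosidaResolvent, mul_smul_comm, ← mul_assoc, hc.eq, mul_assoc,
        Ring.mul_inverse_cancel _ hU, mul_one]
    simpa using congrArg (fun T : H →L[ℝ] H => T f) this
  have hinj : Function.Injective (1 + (n : ℝ) • G : H →L[ℝ] H) :=
    (ContinuousLinearMap.isUnit_iff_bijective.1 hU).1
  have key : ∀ u, u = G (u + ((n : ℝ) + 1) • (f - u)) ↔
      (1 + (n : ℝ) • G) u = ((n : ℝ) + 1) • G f := fun u => by
    have : G (u + ((n : ℝ) + 1) • (f - u)) = ((n : ℝ) + 1) • G f - (n : ℝ) • G u := by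
      simp only [map_add, map_smul, map_sub]; module
    rw [this, eq_sub_iff_add_eq]
    simp
  rw [key, ← hK f]
  exact ⟨fun h => by rw [h], fun h => (hinj h).symm⟩

/-- Dissipativity applied to the resolvent equation gives `‖u‖² ≤ ⟪u, f⟫`. -/
theorem norm_yosidaResolvent_apply_le (hle : ∀ x, ‖G x‖ ^ 2 ≤ inner ℝ (G x) x) (n : ℕ) (f : H) :
    ‖yosidaResolvent G n f‖ ≤ ‖f‖ := by
  set u := yosidaResolvent G n f
  have hu := (yosidaResolvent_spec hle n f u).1 rfl
  have h1 := hle (u + ((n : ℝ) + 1) • (f - u))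
  rw [← hu, inner_add_right, inner_smul_right, inner_sub_right, real_inner_self_eq_norm_sq] at h1
  have h2 : ‖u‖ ^ 2 ≤ inner ℝ u f := by
    have : (0 : ℝ) < (n : ℝ) + 1 := by positivity
    nlinarith
  have h3 := h2.trans (real_inner_le_norm u f)
  by_contra! h
  nlinarith [norm_nonneg f, norm_nonneg u]

theorem commute_ringInverse_one_add_smul (hle : ∀ x, ‖G x‖ ^ 2 ≤ inner ℝ (G x) x) (n : ℕ) :
    Commute G (Ring.inverse (1 + (n : ℝ) • G)) := by
  obtain ⟨K, hK⟩ := isUnit_one_add_smul hle n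
  have : Commute G (K : H →L[ℝ] H) := by
    rw [hK]; exact (Commute.one_right G).add_right ((Commute.refl G).smul_right _)
  rw [← hK, Ring.inverse_unit]
  exact this.units_inv_right

theorem commute_yosidaResolvent (hle : ∀ x, ‖G x‖ ^ 2 ≤ inner ℝ (G x) x) (n m : ℕ) :
    Commute (yosidaResolvent G n) (yosidaResolvent G m) := by
  have hc : ∀ n : ℕ, Commute G (1 + (n : ℝ) • G) := fun n =>
    ((Commute.one_right G).add_right ((Commute.refl G).smul_right _))
  have hi := commute_ringInverse_one_add_smul hle
  have hm : Commute (1 + (n : ℝ) • G) (1 + (m : ℝ) • G) :=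
    (Commute.one_left _).add_left ((hc m).smul_left _)
  refine (Commute.smul_left (Commute.smul_right ?_ _) _)
  exact ((Commute.refl G).mul_right (hi m)).mul_left
    ((hi n).symm.mul_right hm.ringInverse_ringInverse)

theorem commute_yosidaApprox (hle : ∀ x, ‖G x‖ ^ 2 ≤ inner ℝ (G x) x) (n m : ℕ) :
    Commute (yosidaApprox G n) (yosidaApprox G m) :=
  (((commute_yosidaResolvent hle n m).sub_left (Commute.one_left _)).sub_right
    ((Commute.one_right _))).smul_left _ |>.smul_right _

theorem isSelfAdjoint_yosidaApprox (hsymm : ∀ x y, inner ℝ (G x) y = inner ℝ x (G y))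
    (hle : ∀ x, ‖G x‖ ^ 2 ≤ inner ℝ (G x) x) (n : ℕ) : IsSelfAdjoint (yosidaApprox G n) := by
  have hG : IsSelfAdjoint G := ((ContinuousLinearMap.eq_adjoint_iff _ _).2 hsymm).symm
  have hK : IsSelfAdjoint (1 + (n : ℝ) • G) :=
    (IsSelfAdjoint.one _).add ((IsSelfAdjoint.all (n : ℝ)).smul hG)
  have hJ : IsSelfAdjoint (G * Ring.inverse (1 + (n : ℝ) • G)) :=
    (IsSelfAdjoint.commute_iff hG hK.ringInverse).1 (commute_ringInverse_one_add_smul hle n)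
  exact (IsSelfAdjoint.all _).smul (((IsSelfAdjoint.all _).smul hJ).sub (IsSelfAdjoint.one _))

/-- The hypothesis encodes `Lu = w`. The approximation of `L` at a point of its domain is the
resolvent applied to `Lu`, which is why it converges. -/
theorem yosidaApprox_apply (hle : ∀ x, ‖G x‖ ^ 2 ≤ inner ℝ (G x) x) (n : ℕ) {u w : H}
    (h : u = G (u - w)) : yosidaApprox G n u = yosidaResolvent G n w := by
  set z := yosidaResolvent G n w with hz
  have hz' := (yosidaResolvent_spec hle n w z).1 rfl
  have hn : (n : ℝ) + 1 ≠ 0 := by positivity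
  have hx : yosidaResolvent G n u = u + ((n : ℝ) + 1)⁻¹ • z := by
    rw [yosidaResolvent_spec hle]
    have e : u + ((n : ℝ) + 1)⁻¹ • z + ((n : ℝ) + 1) • (u - (u + ((n : ℝ) + 1)⁻¹ • z)) =
        (u - w) + ((n : ℝ) + 1)⁻¹ • (z + ((n : ℝ) + 1) • (w - z)) := by
      match_scalars <;> field_simp <;> ring
    rw [e, map_add, map_smul, ← h, ← hz']
  simp [yosidaApprox, hx, smul_smul, hn]

/-- A vector `x` orthogonal to the range is orthogonal to `G(Gx)`, so `‖Gx‖² = 0` by symmetry. -/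
theorem dense_range_of_symm_injective (hsymm : ∀ x y, inner ℝ (G x) y = inner ℝ x (G y))
    (hinj : Function.Injective G) : Dense (range G) := by
  have : Dense ((LinearMap.range (G : H →ₗ[ℝ] H) : Submodule ℝ H) : Set H) := by
    rw [Submodule.dense_iff_topologicalClosure_eq_top, Submodule.topologicalClosure_eq_top_iff,
      Submodule.eq_bot_iff]
    intro x hx
    apply hinj
    rw [map_zero]
    have := (Submodule.mem_orthogonal' _ x).1 hx (G (G x)) ⟨G x, rfl⟩
    rw [← hsymm] at this
    exact inner_self_eq_zero.1 this
  simpa [LinearMap.coe_range] using this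

/-- On the range of `G` the error is `(n+1)⁻¹` times the resolvent of `Lu`, hence of order `1/n`;
contractivity and density do the rest. -/
theorem tendsto_yosidaResolvent (hsymm : ∀ x y, inner ℝ (G x) y = inner ℝ x (G y))
    (hle : ∀ x, ‖G x‖ ^ 2 ≤ inner ℝ (G x) x) (hinj : Function.Injective G) (u : H) :
    Tendsto (fun n => yosidaResolvent G n u) atTop (𝓝 u) := by
  refine forall_tendsto_of_dense (fun n => ContinuousLinearMap.opNorm_le_bound _ zero_le_one
    fun f => by simpa using norm_yosidaResolvent_apply_le hle n f)
    (dense_range_of_symm_injective hsymm hinj) ?_ u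
  rintro _ ⟨f, rfl⟩
  rw [tendsto_iff_norm_sub_tendsto_zero]
  have h0 : Tendsto (fun n : ℕ => ‖G f - f‖ * (1 / ((n : ℝ) + 1))) atTop (𝓝 0) := by
    simpa using tendsto_one_div_add_atTop_nhds_zero_nat.const_mul ‖G f - f‖
  refine squeeze_zero (fun _ => norm_nonneg _) (fun n => ?_) h0
  have h1 := yosidaApprox_apply hle n (u := G f) (w := G f - f) (by simp)
  have h2 := norm_yosidaResolvent_apply_le hle n (G f - f)
  have hn : (0 : ℝ) < (n : ℝ) + 1 := by positivity
  rw [← h1, yosidaApprox, smul_apply, norm_smul,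
    Real.norm_of_nonneg hn.le] at h2
  rw [mul_one_div, le_div_iff₀ hn, mul_comm]
  exact h2

theorem exp_smul_yosidaApprox_mem {n : ℕ} {C : Set H} (hC : Convex ℝ C)
    (hcl : IsClosed C) (hJ : ∀ f ∈ C, yosidaResolvent G n f ∈ C) {s : ℝ} (hs : 0 ≤ s) {f : H}
    (hf : f ∈ C) : NormedSpace.exp (s • yosidaApprox G n) f ∈ C := by
  rw [yosidaApprox, smul_smul]
  exact exp_smul_sub_one_mem_of_convex _ hC hcl hJ (by positivity) hf

/-- Contractivity is the invariance of closed balls about zero, a case of the invariance of closed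
convex sets. -/
theorem norm_exp_smul_yosidaApprox_le (hle : ∀ x, ‖G x‖ ^ 2 ≤ inner ℝ (G x) x) (n : ℕ) {s : ℝ}
    (hs : 0 ≤ s) : ‖NormedSpace.exp (s • yosidaApprox G n)‖ ≤ 1 := by
  refine ContinuousLinearMap.opNorm_le_bound _ zero_le_one fun f => ?_
  have := exp_smul_yosidaApprox_mem (G := G) (n := n) (convex_closedBall (0 : H) ‖f‖)
    Metric.isClosed_closedBall (fun g hg => ?_) hs (f := f) (by simp)
  · simpa using this
  · rw [mem_closedBall_zero_iff] at hg ⊢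
    exact (norm_yosidaResolvent_apply_le hle n g).trans hg

/-- **Hille–Yosida theorem** for a self-adjoint generator `L ≤ 0`, given by `G = (1 - L)⁻¹`. The
semigroup preserves every closed convex set which is preserved by the resolvents of `L`. -/
theorem exists_semigroup_of_resolvent (hsymm : ∀ x y, inner ℝ (G x) y = inner ℝ x (G y))
    (hle : ∀ x, ‖G x‖ ^ 2 ≤ inner ℝ (G x) x) (hinj : Function.Injective G) :
    ∃ T : ℝ≥0 → H →L[ℝ] H, IsSCContractionSemigroup T ∧
      (∀ u w, IsGeneratorAt T u w ↔ u = G (u - w)) ∧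
      (∀ t x y, inner ℝ (T t x) y = inner ℝ x (T t y)) ∧
      ∀ C : Set H, Convex ℝ C → IsClosed C →
        (∀ (n : ℕ), ∀ f ∈ C, ∀ u, u = G (u + ((n : ℝ) + 1) • (f - u)) → u ∈ C) →
        ∀ t, ∀ f ∈ C, T t f ∈ C := by
  have hdense := dense_range_of_symm_injective hsymm hinj
  have hJ := tendsto_yosidaResolvent hsymm hle hinj
  have hE := norm_exp_smul_yosidaApprox_le hle
  have hgen : ∀ f, G f = G (G f - (G f - f)) := fun f => by simp
  have hcauchy : ∀ (t : ℝ≥0) u,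
      CauchySeq fun n => NormedSpace.exp ((t : ℝ) • yosidaApprox G n) u := fun t u => by
    refine forall_cauchySeq_of_dense (fun n => hE n t.2) hdense ?_ u
    -- On the domain, the exponentials for `n` and `N` differ by at most `t` times the difference of
    -- the resolvents applied to `L(Gf) = Gf - f`, and these resolvents converge.
    rintro _ ⟨f, rfl⟩
    have hc := (hJ (G f - f)).cauchySeq
    rw [Metric.cauchySeq_iff'] at hc ⊢
    intro ε hε
    obtain ⟨N, hN⟩ := hc (ε / (t + 1)) (by positivity)
    refine ⟨N, fun n hn => ?_⟩
    have h1 := norm_exp_smul_sub_exp_smul_le (commute_yosidaApprox hle n N) (fun s => hE n)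
      (fun s => hE N) t.2 (G f)
    rw [yosidaApprox_apply hle n (hgen f), yosidaApprox_apply hle N (hgen f)] at h1
    have h2 := hN n hn
    rw [dist_eq_norm] at h2 ⊢
    calc _ ≤ _ := h1
      _ ≤ ε / (t + 1) * t := mul_le_mul_of_nonneg_right h2.le t.2
      _ < ε := by rw [div_mul_eq_mul_div, div_lt_iff₀ (by positivity)]; nlinarith [t.2]
  have hex : ∀ t : ℝ≥0, ∃ S : H →L[ℝ] H, ∀ u,
      Tendsto (fun n => NormedSpace.exp ((t : ℝ) • yosidaApprox G n) u) atTop (𝓝 (S u)) := by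
    intro t
    choose f hf using fun u => cauchySeq_tendsto_of_complete (hcauchy t u)
    exact ⟨continuousLinearMapOfTendsto _ (tendsto_pi_nhds.2 hf), hf⟩
  choose T hT using hex
  have hcontr : ∀ t, ‖T t‖ ≤ 1 := fun t => by
    refine ContinuousLinearMap.opNorm_le_bound _ zero_le_one fun f => ?_
    exact le_of_tendsto (hT t f).norm
      (Eventually.of_forall fun n => ContinuousLinearMap.le_of_opNorm_le _ (hE n t.2) f)
  have hbound : ∀ (t : ℝ≥0) (f : H) (s : ℝ) (n : ℕ), 0 ≤ s → s ≤ t →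
      ‖NormedSpace.exp (s • yosidaApprox G n) (G f) - G f‖ ≤ ‖G f - f‖ * t := by
    intro t f s n hs hst
    have h1 := norm_exp_smul_apply_sub_le (yosidaApprox G n) (G f) 0 (C := ‖G f - f‖) hs ?_
    · rw [smul_zero, sub_zero] at h1
      exact h1.trans (by gcongr)
    · intro r hr _
      rw [sub_zero, yosidaApprox_apply hle n (hgen f)]
      refine (ContinuousLinearMap.le_of_opNorm_le _ (hE n hr) _).trans ?_
      rw [one_mul]
      exact norm_yosidaResolvent_apply_le hle n _
  have hgenT : ∀ u w, u = G (u - w) → IsGeneratorAt T u w := by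
    intro u w huw
    -- The vector `w = Lu` need not lie in the domain, so it is compared with some `Gf` that does:
    -- orbits of `Gf` move at speed at most `‖Gf - f‖`, uniformly in `n`.
    have key : ∀ (f : H) (t : ℝ≥0), ‖T t u - u - (t : ℝ) • w‖ ≤
        (2 * ‖w - G f‖ + ‖G f - f‖ * t) * t := by
      intro f t
      have hlim : Tendsto (fun n => (‖yosidaResolvent G n w - w‖ +
          (2 * ‖w - G f‖ + ‖G f - f‖ * t)) * t) atTop
          (𝓝 ((‖w - w‖ + (2 * ‖w - G f‖ + ‖G f - f‖ * t)) * t)) :=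
        ((((hJ w).sub_const w).norm).add_const _).mul_const _
      rw [sub_self, norm_zero, zero_add] at hlim
      refine le_of_tendsto_of_tendsto (((hT t u).sub_const u).sub_const _).norm hlim
        (Eventually.of_forall fun n => ?_)
      refine norm_exp_smul_apply_sub_le _ u w t.2 fun s hs hst => ?_
      rw [yosidaApprox_apply hle n huw]
      set S := NormedSpace.exp (s • yosidaApprox G n)
      have hS : ∀ x, ‖S x‖ ≤ ‖x‖ := fun x => by
        simpa using ContinuousLinearMap.le_of_opNorm_le _ (hE n hs) x
      have e : S (yosidaResolvent G n w) - w =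
          S (yosidaResolvent G n w - w) + (S (w - G f) + ((S (G f) - G f) + (G f - w))) := by
        simp only [map_sub]; abel
      rw [e]
      refine (norm_add_le _ _).trans (add_le_add (hS _) ?_)
      have h1 := norm_add₃_le (a := S (w - G f)) (b := S (G f) - G f) (c := G f - w)
      rw [norm_sub_rev (G f) w] at h1
      have h2 := hS (w - G f)
      have h3 := hbound t f s n hs hst
      rw [add_assoc] at h1
      linarith
    rw [IsGeneratorAt, tendsto_iff_norm_sub_tendsto_zero, Metric.tendsto_nhds]
    intro ε hε
    obtain ⟨_, hv, ⟨f, rfl⟩⟩ := Metric.dense_iff.1 hdense w (ε / 4) (by positivity)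
    rw [Metric.mem_ball, dist_comm, dist_eq_norm] at hv
    have hδ : 0 < ε / 4 / (‖G f - f‖ + 1) := by positivity
    have : ∀ᶠ t : ℝ≥0 in 𝓝[>] 0, t < Real.toNNReal (ε / 4 / (‖G f - f‖ + 1)) :=
      mem_nhdsWithin_of_mem_nhds (Iio_mem_nhds (Real.toNNReal_pos.2 hδ))
    filter_upwards [this, self_mem_nhdsWithin] with t ht ht0
    have ht0' : (0 : ℝ) < t := ht0
    have ht' : (t : ℝ) < ε / 4 / (‖G f - f‖ + 1) := by
      rw [Real.lt_toNNReal_iff_coe_lt] at ht; exact ht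
    rw [lt_div_iff₀ (by positivity)] at ht'
    have e : (t : ℝ)⁻¹ • (T t u - u) - w = (t : ℝ)⁻¹ • (T t u - u - (t : ℝ) • w) := by
      rw [smul_sub _ (T t u - u), smul_smul, inv_mul_cancel₀ ht0'.ne', one_smul]
    rw [dist_zero_right, norm_norm, e, norm_smul, norm_inv, Real.norm_of_nonneg ht0'.le,
      inv_mul_lt_iff₀ ht0', mul_comm]
    refine (key f t).trans_lt ?_
    gcongr
    nlinarith [norm_nonneg (G f - f)]
  refine ⟨T, ⟨?_, ?_, hcontr, ?_⟩, fun u w => ⟨fun h => ?_, hgenT u w⟩, ?_, ?_⟩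
  · ext u
    refine tendsto_nhds_unique (hT 0 u) ?_
    simp [NormedSpace.exp_zero]
  · intro s t
    ext u
    refine tendsto_nhds_unique (hT (s + t) u) ?_
    have h1 : Tendsto (fun n => NormedSpace.exp ((s : ℝ) • yosidaApprox G n)
        (NormedSpace.exp ((t : ℝ) • yosidaApprox G n) u - T t u)) atTop (𝓝 0) := by
      have h0 : Tendsto (fun n => ‖NormedSpace.exp ((t : ℝ) • yosidaApprox G n) u - T t u‖)
          atTop (𝓝 0) := by
        have := ((hT t u).sub_const (T t u)).norm
        rwa [sub_self, norm_zero] at this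
      refine squeeze_zero_norm (fun n => ?_) h0
      exact (ContinuousLinearMap.le_of_opNorm_le _ (hE n s.2) _).trans_eq (one_mul _)
    have h2 := h1.add (hT s (T t u))
    rw [zero_add] at h2
    refine h2.congr fun n => ?_
    let _ : NormedAlgebra ℚ (H →L[ℝ] H) := .restrictScalars ℚ ℝ _
    rw [map_sub, sub_add_cancel, NNReal.coe_add, add_smul, NormedSpace.exp_add_of_commute
      (((Commute.refl _).smul_left _).smul_right _)]
    rfl
  · refine forall_tendsto_of_dense hcontr hdense ?_
    rintro _ ⟨f, rfl⟩
    rw [tendsto_iff_norm_sub_tendsto_zero]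
    have h0 : Tendsto (fun t : ℝ≥0 => ‖G f - f‖ * (t : ℝ)) (𝓝 0) (𝓝 0) := by
      have : Continuous fun t : ℝ≥0 => ‖G f - f‖ * (t : ℝ) := by fun_prop
      simpa using this.tendsto 0
    refine squeeze_zero (fun _ => norm_nonneg _) (fun t => ?_) h0
    exact le_of_tendsto ((hT t (G f)).sub_const _).norm
      (Eventually.of_forall fun n => hbound t f t n t.2 le_rfl)
  -- The generator has no proper dissipative extension: `v` is in the domain with `Lv = v - (u -
  -- w)`, so the generator maps `u - v` to itself, while contractivity forces `⟪L(u - v), u - v⟫ ≤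
  -- 0`.
  · set v := G (u - w) with hv
    have h1 := hgenT v (v - (u - w)) (by simp [hv])
    have h2 : Tendsto (fun t : ℝ≥0 => (t : ℝ)⁻¹ • (T t (u - v) - (u - v))) (𝓝[>] 0)
        (𝓝 (u - v)) := by
      have := Tendsto.sub h h1
      have e : w - (v - (u - w)) = u - v := by abel
      rw [e] at this
      refine this.congr fun t => ?_
      rw [← smul_sub, map_sub]; congr 1; abel
    have h3 := h2.inner (𝕜 := ℝ) (tendsto_const_nhds (x := u - v))
    have h4 : inner ℝ (u - v) (u - v) ≤ 0 := by
      refine le_of_tendsto h3 (Eventually.of_forall fun t => ?_)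
      rw [inner_smul_left, inner_sub_left, real_inner_self_eq_norm_sq]
      refine mul_nonpos_of_nonneg_of_nonpos (by simp) (sub_nonpos.2 ?_)
      refine (real_inner_le_norm _ _).trans ?_
      rw [sq]
      gcongr
      simpa using ContinuousLinearMap.le_of_opNorm_le _ (hcontr t) (u - v)
    exact sub_eq_zero.1 (real_inner_self_nonpos.1 h4)
  · intro t x y
    refine tendsto_nhds_unique ((hT t x).inner (𝕜 := ℝ) tendsto_const_nhds)
      ((tendsto_const_nhds.inner (𝕜 := ℝ) (hT t y)).congr fun n => ?_)
    have h := (((IsSelfAdjoint.all (t : ℝ)).smul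
      (isSelfAdjoint_yosidaApprox hsymm hle n)).exp).adjoint_eq
    exact ((ContinuousLinearMap.eq_adjoint_iff _ _).1 h.symm x y).symm
  · intro C hC hcl hres t f hf
    exact hcl.mem_of_tendsto (hT t f) (Eventually.of_forall fun n =>
      exp_smul_yosidaApprox_mem hC hcl (fun g hg => hres n g hg _
        ((yosidaResolvent_spec hle n g _).1 rfl)) t.2 hf)

end HilleYosida

/-! ### Completion of a closable form inside the ambient Hilbert space. -/

section FormCompletion

universe u

/-- Copy of a vector space `W`, to be normed by the form `B`. -/
def EnergySpace {W : Type u} [AddCommGroup W] [Module ℝ W] (_ : W →ₗ[ℝ] W →ₗ[ℝ] ℝ) : Type u := W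

variable {W : Type u} [AddCommGroup W] [Module ℝ W]

instance (B : W →ₗ[ℝ] W →ₗ[ℝ] ℝ) : AddCommGroup (EnergySpace B) := inferInstanceAs (AddCommGroup W)

instance (B : W →ₗ[ℝ] W →ₗ[ℝ] ℝ) : Module ℝ (EnergySpace B) := inferInstanceAs (Module ℝ W)

/-- The inner product on `EnergySpace B`. -/
@[reducible] def energyCore (B : W →ₗ[ℝ] W →ₗ[ℝ] ℝ) (hs : ∀ x y, B x y = B y x)
    (h0 : ∀ x, 0 ≤ B x x) (hd : ∀ x, B x x = 0 → x = 0) :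
    InnerProductSpace.Core ℝ (EnergySpace B) where
  inner x y := B x y
  conj_inner_symm x y := hs y x
  re_inner_nonneg x := h0 x
  add_left x y z := congrArg (fun f : W →ₗ[ℝ] ℝ => f z) (LinearMap.map_add B x y)
  smul_left x y r := congrArg (fun f : W →ₗ[ℝ] ℝ => f y) (LinearMap.map_smul B r x)
  definite x h := hd x h

variable {H : Type*} [NormedAddCommGroup H] [InnerProductSpace ℝ H] [CompleteSpace H]

/-- The abstract completion of a closable form `a` on `W ⊆ H` is again embedded in `H`. -/
theorem exists_form_completion (j : W →ₗ[ℝ] H) (hj : Function.Injective j)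
    (a : W →ₗ[ℝ] W →ₗ[ℝ] ℝ) (hs : ∀ x y, a x y = a y x) (h0 : ∀ x, 0 ≤ a x x)
    (hcl : ∀ u : ℕ → W, Tendsto (fun k : ℕ × ℕ => a (u k.1 - u k.2) (u k.1 - u k.2)) atTop (𝓝 0) →
      Tendsto (fun n => ‖j (u n)‖) atTop (𝓝 0) → Tendsto (fun n => a (u n) (u n)) atTop (𝓝 0)) :
    ∃ (V : Type u) (_ : NormedAddCommGroup V) (_ : InnerProductSpace ℝ V) (_ : CompleteSpace V)
      (ι : V →L[ℝ] H) (k : W →ₗ[ℝ] V), Function.Injective ι ∧ DenseRange k ∧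
      (∀ w, ι (k w) = j w) ∧ (∀ v, ‖ι v‖ ≤ ‖v‖) ∧
      ∀ w w', inner ℝ (k w) (k w') = a w w' + inner ℝ (j w) (j w') := by
  let B : W →ₗ[ℝ] W →ₗ[ℝ] ℝ := a + (innerₗ H).compl₁₂ j j
  have hB : ∀ x y, B x y = a x y + inner ℝ (j x) (j y) := fun x y => rfl
  have hB0 : ∀ x, ‖j x‖ ^ 2 ≤ B x x := fun x => by
    rw [hB, real_inner_self_eq_norm_sq]; linarith [h0 x]
  let core := energyCore B (fun x y => by rw [hB, hB, hs, real_inner_comm])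
    (fun x => (sq_nonneg _).trans (hB0 x)) (fun x hx => hj (by
      have := hB0 x
      rw [hx] at this
      rw [map_zero]
      exact norm_eq_zero.1 (pow_eq_zero_iff two_ne_zero |>.1 (le_antisymm this (sq_nonneg _)))))
  let _ : NormedAddCommGroup (EnergySpace B) := core.toNormedAddCommGroup
  let _ : InnerProductSpace ℝ (EnergySpace B) := InnerProductSpace.ofCore core.toCore
  have hin : ∀ x y : EnergySpace B, inner ℝ x y = a x y + inner ℝ (j x) (j y) := fun x y => rfl
  have hno : ∀ x : EnergySpace B, ‖x‖ ^ 2 = a x x + ‖j x‖ ^ 2 := fun x => by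
    rw [← real_inner_self_eq_norm_sq, hin, real_inner_self_eq_norm_sq]
  have hjn : ∀ x : EnergySpace B, ‖j x‖ ≤ 1 * ‖x‖ := fun x => by
    rw [one_mul]
    exact (sq_le_sq₀ (norm_nonneg _) (norm_nonneg _)).1 (by rw [hno]; linarith [h0 x])
  let J : EnergySpace B →L[ℝ] H := LinearMap.mkContinuous (E := EnergySpace B) (σ := RingHom.id ℝ) j 1 hjn
  have hJ : ∀ x : EnergySpace B, J x = j x := fun x => rfl
  let c : EnergySpace B →L[ℝ] UniformSpace.Completion (EnergySpace B) :=
    UniformSpace.Completion.toComplL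
  have hc : DenseRange c := UniformSpace.Completion.denseRange_coe
  have hci : IsUniformInducing c := UniformSpace.Completion.isUniformInducing_coe _
  let ι := J.extend c
  have hι : ∀ x, ι (c x) = j x := fun x => ContinuousLinearMap.extend_eq _ hc hci x
  let e : W →ₗ[ℝ] EnergySpace B := (LinearMap.id : W →ₗ[ℝ] W)
  refine ⟨UniformSpace.Completion (EnergySpace B), inferInstance, inferInstance, inferInstance,
    ι,
    (c : EnergySpace B →ₗ[ℝ] UniformSpace.Completion (EnergySpace B)).comp e, ?_, hc, hι, ?_, ?_⟩
  -- This is where closability enters: a sequence converging to `v` in the completion is Cauchy in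
  -- energy, and if `ι v = 0` it tends to zero in `H`, so its full norm tends to zero.
  · rw [injective_iff_map_eq_zero]
    intro v hv
    obtain ⟨u', hu'r, hu'⟩ := mem_closure_iff_seq_limit.1 (hc v)
    choose u hu using hu'r
    have hcu : (fun n => c (u n)) = u' := funext hu
    rw [← hcu] at hu'
    have h1 : Tendsto (fun n => ‖j (u n)‖) atTop (𝓝 0) := by
      have := ((ι.continuous.tendsto v).comp hu').norm
      rw [hv, norm_zero] at this
      exact this.congr fun n => by rw [Function.comp_apply, hι]
    have h2 : Tendsto (fun k : ℕ × ℕ => ‖u k.1 - u k.2‖ ^ 2) atTop (𝓝 0) := by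
      have := (hu'.comp tendsto_fst).sub (hu'.comp tendsto_snd)
      rw [prod_atTop_atTop_eq, sub_self] at this
      have := this.norm.pow 2
      rw [norm_zero, zero_pow two_ne_zero] at this
      refine this.congr fun k => ?_
      rw [Function.comp_apply, Function.comp_apply, ← map_sub]
      exact congrArg (· ^ 2) (UniformSpace.Completion.norm_coe _)
    have h3 := hcl u (squeeze_zero (fun _ => h0 _) (fun k => by
      have := hno (u k.1 - u k.2)
      have h4 := sq_nonneg ‖j (u k.1 - u k.2)‖
      change a (u k.1 - u k.2) (u k.1 - u k.2) ≤ ‖u k.1 - u k.2‖ ^ 2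
      rw [this]; exact le_add_of_nonneg_right h4) h2) h1
    have h4 : Tendsto (fun n => ‖c (u n)‖ ^ 2) atTop (𝓝 0) := by
      have := h3.add (h1.pow 2)
      rw [zero_pow two_ne_zero, add_zero] at this
      refine this.congr fun n => ?_
      rw [← hno]
      exact congrArg (· ^ 2) (UniformSpace.Completion.norm_coe _).symm
    have h5 := tendsto_nhds_unique (hu'.norm.pow 2) h4
    exact norm_eq_zero.1 (pow_eq_zero_iff two_ne_zero |>.1 h5)
  · intro v
    refine hc.induction_on (p := fun v => ‖ι v‖ ≤ ‖v‖) v (isClosed_le (by fun_prop) (by fun_prop))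
      fun x => ?_
    rw [hι]
    exact (hjn x).trans_eq ((one_mul _).trans (UniformSpace.Completion.norm_coe _).symm)
  · intro w w'
    exact (UniformSpace.Completion.inner_coe (𝕜 := ℝ) (E := EnergySpace B) w w').trans (hin w w')

end FormCompletion

/-! ### Hilbert spaces embedded in `H`: closed balls, resolvents, semigroups. -/

section Embedding

variable {V H : Type*} [NormedAddCommGroup V] [InnerProductSpace ℝ V] [CompleteSpace V]
  [NormedAddCommGroup H] [InnerProductSpace ℝ H] [CompleteSpace H] {ι : V →L[ℝ] H}

/-- The image of a ball under an injective bounded operator between Hilbert spaces is closed. -/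
theorem exists_norm_le_of_tendsto (hι : Function.Injective ι) {v : ℕ → V} {c : ℕ → ℝ} {r : ℝ}
    {w : H} (hv : ∀ n, ‖v n‖ ≤ c n) (hc : Tendsto c atTop (𝓝 r))
    (hw : Tendsto (fun n => ι (v n)) atTop (𝓝 w)) : ∃ y, ι y = w ∧ ‖y‖ ≤ r := by
  -- Banach–Alaoglu: for `R > r` the vectors eventually lie in a weak-* compact ball, and testing a
  -- cluster point against `ι* f` identifies its image as `w`.
  have key : ∀ R, r < R → ∃ y, ι y = w ∧ ‖y‖ ≤ R := fun R hR => by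
    let ℓ : ℕ → WeakDual ℝ V := fun n => StrongDual.toWeakDual (InnerProductSpace.toDual ℝ V (v n))
    have hcomp := WeakDual.isCompact_closedBall (0 : StrongDual ℝ V) R
    have hmem : ∀ᶠ n in atTop, ℓ n ∈ WeakDual.toStrongDual ⁻¹' Metric.closedBall
        (0 : StrongDual ℝ V) R := by
      filter_upwards [hc.eventually_lt_const hR] with n hn
      rw [mem_preimage, mem_closedBall_zero_iff]
      refine (le_of_eq ?_).trans ((hv n).trans hn.le)
      exact (InnerProductSpace.toDual ℝ V).norm_map (v n)
    obtain ⟨L, hL, hcl⟩ := hcomp.exists_mapClusterPt_of_frequently hmem.frequently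
    refine ⟨(InnerProductSpace.toDual ℝ V).symm (WeakDual.toStrongDual L), ?_, ?_⟩
    · refine ext_inner_right ℝ fun f => ?_
      rw [← ContinuousLinearMap.adjoint_inner_right, InnerProductSpace.toDual_symm_apply]
      have h1 : MapClusterPt (L (ContinuousLinearMap.adjoint ι f)) atTop
          (fun n => ℓ n (ContinuousLinearMap.adjoint ι f)) :=
        hcl.continuousAt_comp
          (f := fun L : WeakDual ℝ V => L (ContinuousLinearMap.adjoint ι f))
          (WeakDual.eval_continuous _).continuousAt
      have h2 : Tendsto (fun n => ℓ n (ContinuousLinearMap.adjoint ι f)) atTop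
          (𝓝 (inner ℝ w f)) := by
        refine (hw.inner tendsto_const_nhds).congr fun n => ?_
        rw [← ContinuousLinearMap.adjoint_inner_right]; rfl
      exact eq_of_nhds_neBot (ClusterPt.mono h1 h2)
    · rw [LinearIsometryEquiv.norm_map]
      exact mem_closedBall_zero_iff.1 hL
  obtain ⟨y, hy, -⟩ := key (r + 1) (by linarith)
  refine ⟨y, hy, le_of_forall_gt_imp_ge_of_dense fun R hR => ?_⟩
  obtain ⟨z, hz, hzR⟩ := key R hR
  rwa [hι (hy.trans hz.symm)]

/-- The vector `u` is the unique minimiser of `E(v) + l ‖v - f‖²`, where `E(ιx) = ‖x‖² - ‖ιx‖²`.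
Since `P` does not increase either term at `u`, the point `P u` is a minimiser too. The computation
expands the three squared norms about `u` and uses `‖P u - u‖ ≤ ‖y - x‖` in place of an abstract
uniqueness argument. -/
theorem resolvent_eq_of_minimal {P : H → H} (hle : ∀ v, ‖ι v‖ ≤ ‖v‖)
    (hP : ∀ x, ∃ y, ι y = P (ι x) ∧ ‖y‖ ^ 2 - ‖ι y‖ ^ 2 ≤ ‖x‖ ^ 2 - ‖ι x‖ ^ 2) {l : ℝ} (hl : 0 < l)
    {u f : H} (hPf : ‖P u - f‖ ≤ ‖u - f‖)
    (hu : u = ι (ContinuousLinearMap.adjoint ι (u + l • (f - u)))) : P u = u := by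
  set x := ContinuousLinearMap.adjoint ι (u + l • (f - u)) with hx
  obtain ⟨y, hy, hyx⟩ := hP x
  rw [← hu] at hy hyx
  have h1 : inner ℝ x (y - x) = inner ℝ (u + l • (f - u)) (P u - u) := by
    rw [hx, ContinuousLinearMap.adjoint_inner_left, map_sub, hy, ← hx, ← hu]
  have h2 : ‖y‖ ^ 2 = ‖x‖ ^ 2 + 2 * inner ℝ x (y - x) + ‖y - x‖ ^ 2 := by
    rw [← norm_add_sq_real]; simp
  have h3 : ‖ι y‖ ^ 2 = ‖u‖ ^ 2 + 2 * inner ℝ u (P u - u) + ‖P u - u‖ ^ 2 := by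
    rw [← norm_add_sq_real, hy]; simp
  have h4 : ‖P u - f‖ ^ 2 = ‖u - f‖ ^ 2 - 2 * inner ℝ (f - u) (P u - u) + ‖P u - u‖ ^ 2 := by
    have := norm_add_sq_real (u - f) (P u - u)
    rw [show u - f + (P u - u) = P u - f by abel] at this
    rw [this, ← neg_sub f u, inner_neg_left]; ring
  have h5 : ‖P u - u‖ ≤ ‖y - x‖ := by
    have := hle (y - x)
    rwa [map_sub, hy, ← hu] at this
  have h6 : ‖P u - f‖ ^ 2 ≤ ‖u - f‖ ^ 2 := by gcongr
  have h7 : ‖P u - u‖ ^ 2 ≤ ‖y - x‖ ^ 2 := by gcongr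
  rw [h1, inner_add_left, inner_smul_left] at h2
  simp only [conj_trivial] at h2
  have h8 : ‖P u - u‖ ^ 2 ≤ 0 := by
    by_contra! h
    nlinarith
  exact sub_eq_zero.1 (norm_eq_zero.1 (pow_eq_zero_iff two_ne_zero |>.1
    (le_antisymm h8 (sq_nonneg _))))

/-- The operator `ι ι*` of an embedded Hilbert space satisfies the conditions on `(1 - L)⁻¹`. -/
theorem exists_semigroup_of_embedding (hι : Function.Injective ι) (hd : DenseRange ι)
    (hle : ∀ v, ‖ι v‖ ≤ ‖v‖) :
    ∃ T : ℝ≥0 → H →L[ℝ] H, IsSCContractionSemigroup T ∧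
      (∀ u w, IsGeneratorAt T u w ↔ ∃ x, ι x = u ∧
        ∀ y, inner ℝ x y - inner ℝ (ι x) (ι y) = -inner ℝ w (ι y)) ∧
      (∀ t x y, inner ℝ (T t x) y = inner ℝ x (T t y)) ∧
      ∀ C : Set H, Convex ℝ C → IsClosed C →
        (∀ l : ℝ, 0 < l → ∀ f ∈ C, ∀ u,
          u = ι (ContinuousLinearMap.adjoint ι (u + l • (f - u))) → u ∈ C) →
        ∀ t, ∀ f ∈ C, T t f ∈ C := by
  obtain ⟨T, hT, hgen, hsymm, hC⟩ := exists_semigroup_of_resolvent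
    (G := ι.comp (ContinuousLinearMap.adjoint ι))
    (fun x y => by
      simp only [ContinuousLinearMap.comp_apply]
      rw [← ContinuousLinearMap.adjoint_inner_right, ContinuousLinearMap.adjoint_inner_left])
    (fun x => by
      simp only [ContinuousLinearMap.comp_apply]
      rw [← ContinuousLinearMap.adjoint_inner_right, real_inner_self_eq_norm_sq]
      have := hle (ContinuousLinearMap.adjoint ι x)
      gcongr)
    (by
      -- The adjoint `ι*` is injective because the range of `ι` is dense.
      refine hι.comp ?_
      rw [injective_iff_map_eq_zero]
      intro f (hf : ContinuousLinearMap.adjoint ι f = 0)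
      refine hd.eq_zero_of_inner_right ℝ (x := f) fun v => ?_
      rw [← ContinuousLinearMap.adjoint_inner_right, hf, inner_zero_right])
  refine ⟨T, hT, fun u w => ?_, hsymm, fun C h1 h2 h3 => hC C h1 h2 fun n f hf u hu =>
    h3 _ (by positivity) f hf u hu⟩
  rw [hgen]
  -- Tested against all `y`, the weak equation `E(u, y) = -⟪w, y⟫` becomes `⟪x, y⟫ = ⟪u - w, ι y⟫`,
  -- which is the definition of the adjoint.
  have key : ∀ x, ι x = u → ((∀ y, inner ℝ x y - inner ℝ (ι x) (ι y) = -inner ℝ w (ι y)) ↔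
      x = ContinuousLinearMap.adjoint ι (u - w)) := fun x hx => by
    rw [hx, ext_iff_inner_right ℝ]
    refine forall_congr' fun y => ?_
    rw [ContinuousLinearMap.adjoint_inner_left, inner_sub_left]
    constructor <;> intro h <;> linarith
  constructor
  · intro h
    exact ⟨_, h.symm, (key _ h.symm).2 rfl⟩
  · rintro ⟨x, hx, h⟩
    rw [ContinuousLinearMap.comp_apply, ← (key x hx).1 h, hx]

end Embedding

/-! ### The form of an embedded Hilbert space, its closedness and Markov property. -/

section EmbeddedForm

variable {X : Type*} [MeasurableSpace X] {m : Measure X}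

/-- The form `a` on a vector space `W` embedded in `L²` by `j`. -/
noncomputable def preForm {W : Type*} [AddCommGroup W] [Module ℝ W] (j : W →ₗ[ℝ] Lp ℝ 2 m)
    (hj : Function.Injective j) (a : W →ₗ[ℝ] W →ₗ[ℝ] ℝ) : L2Form m where
  domain := LinearMap.range j
  form := a.compl₁₂ (LinearEquiv.ofInjective j hj).symm.toLinearMap
    (LinearEquiv.ofInjective j hj).symm.toLinearMap

theorem preForm_form {W : Type*} [AddCommGroup W] [Module ℝ W] {j : W →ₗ[ℝ] Lp ℝ 2 m}
    (hj : Function.Injective j) (a : W →ₗ[ℝ] W →ₗ[ℝ] ℝ) {u v : (preForm j hj a).domain} {x y : W}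
    (hu : (u : Lp ℝ 2 m) = j x) (hv : (v : Lp ℝ 2 m) = j y) : (preForm j hj a).form u v = a x y := by
  have key : ∀ (u : LinearMap.range j) (x : W), (u : Lp ℝ 2 m) = j x →
      (LinearEquiv.ofInjective j hj).symm u = x := fun u x hu => by
    rw [LinearEquiv.symm_apply_eq]; exact Subtype.ext hu
  change a ((LinearEquiv.ofInjective j hj).symm u) ((LinearEquiv.ofInjective j hj).symm v) = _
  rw [key u x hu, key v y hv]

variable {V : Type*} [NormedAddCommGroup V] [InnerProductSpace ℝ V] {ι : V →L[ℝ] Lp ℝ 2 m}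

/-- The form `⟪x, y⟫_V - ⟪x, y⟫_{L²}` of a Hilbert space `V` embedded in `L²`. -/
noncomputable def embeddedForm (ι : V →L[ℝ] Lp ℝ 2 m) (hι : Function.Injective ι) : L2Form m :=
  preForm (ι : V →ₗ[ℝ] Lp ℝ 2 m) hι
    (innerₗ V - (innerₗ (Lp ℝ 2 m)).compl₁₂ (ι : V →ₗ[ℝ] Lp ℝ 2 m) (ι : V →ₗ[ℝ] Lp ℝ 2 m))

variable {hι : Function.Injective ι}

theorem embeddedForm_form {u v : (embeddedForm ι hι).domain} {x y : V}
    (hu : (u : Lp ℝ 2 m) = ι x) (hv : (v : Lp ℝ 2 m) = ι y) :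
    (embeddedForm ι hι).form u v = inner ℝ x y - inner ℝ (ι x) (ι y) :=
  preForm_form hι _ hu hv

theorem exists_eq_of_embeddedForm_domain (u : (embeddedForm ι hι).domain) :
    ∃ x, (u : Lp ℝ 2 m) = ι x :=
  let ⟨x, hx⟩ := u.2; ⟨x, hx.symm⟩

theorem mem_embeddedForm_domain (x : V) : ι x ∈ (embeddedForm ι hι).domain := ⟨x, rfl⟩

theorem embeddedForm_form_self {u : (embeddedForm ι hι).domain} {x : V}
    (hu : (u : Lp ℝ 2 m) = ι x) :
    (embeddedForm ι hι).form u u = ‖x‖ ^ 2 - ‖ι x‖ ^ 2 := by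
  rw [embeddedForm_form hu hu, real_inner_self_eq_norm_sq, real_inner_self_eq_norm_sq]

theorem embeddedForm_energyOne {u : (embeddedForm ι hι).domain} {x : V}
    (hu : (u : Lp ℝ 2 m) = ι x) : (embeddedForm ι hι).energyOne u = ‖x‖ ^ 2 := by
  rw [L2Form.energyOne, embeddedForm_form_self hu, hu]; ring

/-- The norm `E_1^{1/2}` is the norm of `V`, so closedness is completeness of `V`. -/
theorem embeddedForm_isClosedForm [CompleteSpace V] : (embeddedForm ι hι).IsClosedForm := by
  intro u hu
  choose x hx using fun n => exists_eq_of_embeddedForm_domain (u n)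
  have hsub : ∀ a b, ((u a - u b : (embeddedForm ι hι).domain) : Lp ℝ 2 m) = ι (x a - x b) :=
    fun a b => by rw [map_sub, ← hx, ← hx]; rfl
  have hc : CauchySeq x := by
    rw [cauchySeq_iff_tendsto_dist_atTop_0]
    have h0 : Tendsto (fun k : ℕ × ℕ => ‖x k.1 - x k.2‖ ^ 2) atTop (𝓝 0) :=
      hu.congr fun k => embeddedForm_energyOne (hsub k.1 k.2)
    have h1 := h0.sqrt
    rw [Real.sqrt_zero] at h1
    exact h1.congr fun k => by rw [Real.sqrt_sq (norm_nonneg _), dist_eq_norm]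
  obtain ⟨y, hy⟩ := cauchySeq_tendsto_of_complete hc
  refine ⟨⟨ι y, mem_embeddedForm_domain y⟩, ?_⟩
  have h2 : ∀ n, ((u n - ⟨ι y, mem_embeddedForm_domain y⟩ : (embeddedForm ι hι).domain) :
      Lp ℝ 2 m) = ι (x n - y) := fun n => by rw [map_sub, ← hx]; rfl
  have h3 := (tendsto_iff_norm_sub_tendsto_zero.1 hy).pow 2
  rw [zero_pow two_ne_zero] at h3
  exact h3.congr fun n => (embeddedForm_energyOne (h2 n)).symm

theorem embeddedForm_isClosureOf [CompleteSpace V] {W : Type*} [AddCommGroup W] [Module ℝ W]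
    {j : W →ₗ[ℝ] Lp ℝ 2 m} (hj : Function.Injective j) {a : W →ₗ[ℝ] W →ₗ[ℝ] ℝ} {k : W →ₗ[ℝ] V}
    (hk : DenseRange k) (hιk : ∀ w, ι (k w) = j w)
    (hin : ∀ w w', inner ℝ (k w) (k w') = a w w' + inner ℝ (j w) (j w')) :
    (embeddedForm ι hι).IsClosureOf (preForm j hj a) := by
  refine ⟨?_, ?_, embeddedForm_isClosedForm, ?_⟩
  · rintro ⟨_, w, rfl⟩
    exact ⟨k w, hιk w⟩
  · rintro ⟨_, w, rfl⟩ ⟨_, w', rfl⟩ u' v' hu' hv'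
    rw [preForm_form (x := w) (y := w') hj a rfl rfl,
      embeddedForm_form (hu'.trans (hιk w).symm) (hv'.trans (hιk w').symm), hin, hιk, hιk]
    ring
  · intro u ε hε
    obtain ⟨x, hx⟩ := exists_eq_of_embeddedForm_domain u
    obtain ⟨_, hw, w, rfl⟩ := Metric.dense_iff.1 hk x (√ε) (Real.sqrt_pos.2 hε)
    refine ⟨⟨ι (k w), mem_embeddedForm_domain _⟩, ⟨w, (hιk w).symm⟩, ?_⟩
    rw [embeddedForm_energyOne (x := x - k w) (by rw [map_sub, ← hx]; rfl)]
    rw [Metric.mem_ball, dist_comm, dist_eq_norm] at hw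
    exact (Real.lt_sqrt (norm_nonneg _)).1 hw

theorem preForm_isClosable {W : Type*} [AddCommGroup W] [Module ℝ W]
    {j : W →ₗ[ℝ] Lp ℝ 2 m} (hj : Function.Injective j) {a : W →ₗ[ℝ] W →ₗ[ℝ] ℝ}
    (hcl : ∀ u : ℕ → W, Tendsto (fun k : ℕ × ℕ => a (u k.1 - u k.2) (u k.1 - u k.2)) atTop (𝓝 0) →
      Tendsto (fun n => ‖j (u n)‖) atTop (𝓝 0) → Tendsto (fun n => a (u n) (u n)) atTop (𝓝 0)) :
    (preForm j hj a).IsClosable := by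
  intro u h1 h2
  choose x hx using fun n => (u n).2
  have h3 := hcl x (h1.congr fun k => preForm_form hj a (by rw [map_sub, hx, hx]; rfl)
    (by rw [map_sub, hx, hx]; rfl)) (h2.congr fun n => by rw [hx])
  exact h3.congr fun n => (preForm_form hj a (hx n).symm (hx n).symm).symm

/-- A symmetric nonnegative form represented by a densely defined operator is closable. -/
theorem closable_of_generator {W H : Type*} [AddCommGroup W] [Module ℝ W] [NormedAddCommGroup H]
    [InnerProductSpace ℝ H] {j : W →ₗ[ℝ] H} {a : W →ₗ[ℝ] W →ₗ[ℝ] ℝ} (hs : ∀ x y, a x y = a y x)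
    (h0 : ∀ x, 0 ≤ a x x) (L : W → H) (hL : ∀ f g, a f g = -inner ℝ (L f) (j g)) (u : ℕ → W)
    (hu : Tendsto (fun k : ℕ × ℕ => a (u k.1 - u k.2) (u k.1 - u k.2)) atTop (𝓝 0))
    (hj : Tendsto (fun n => ‖j (u n)‖) atTop (𝓝 0)) :
    Tendsto (fun n => a (u n) (u n)) atTop (𝓝 0) := by
  rw [Metric.tendsto_atTop]
  intro ε hε
  -- With `N` frozen, `a(u_n, u_n) ≤ a(u_n - u_N, u_n - u_N) + 2 a(u_N, u_n)`. The first term is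
  -- small by the Cauchy property, and the second equals `-2⟪L u_N, j u_n⟫`, which tends to zero
  -- with `n`.
  obtain ⟨⟨N₁, N₂⟩, hN⟩ := eventually_atTop.1 (hu.eventually_lt_const (show (0 : ℝ) < ε / 2 by positivity))
  set N := max N₁ N₂
  have h1 : Tendsto (fun n => -2 * inner ℝ (L (u N)) (j (u n))) atTop (𝓝 0) := by
    have h2 : Tendsto (fun n => inner ℝ (L (u N)) (j (u n))) atTop (𝓝 0) := by
      refine squeeze_zero_norm (fun n => norm_inner_le_norm (𝕜 := ℝ) _ _) ?_
      simpa using hj.const_mul ‖L (u N)‖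
    simpa using h2.const_mul (-2)
  obtain ⟨M, hM⟩ := eventually_atTop.1 (h1.eventually_lt_const (show (0 : ℝ) < ε / 2 by positivity))
  refine ⟨max N M, fun n hn => ?_⟩
  rw [Real.dist_eq, sub_zero, abs_of_nonneg (h0 _)]
  have h3 := hN (n, N) ⟨(le_max_left _ _).trans ((le_max_left _ _).trans hn), le_max_right _ _⟩
  have h4 := hM n ((le_max_right _ _).trans hn)
  simp only at h3
  have h5 : a (u n - u N) (u n - u N) = a (u n) (u n) - 2 * a (u N) (u n) + a (u N) (u N) := by
    simp only [map_sub, LinearMap.sub_apply, hs (u n) (u N)]; ring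
  have h6 := h0 (u N)
  rw [h5, hL (u N) (u n)] at h3
  linarith

/-- The unit contraction on `L²`. -/
noncomputable def unitContraction (u : Lp ℝ 2 m) : Lp ℝ 2 m :=
  ((LipschitzWith.id.max_const (0 : ℝ)).min_const 1).compLp (by simp) u

theorem coeFn_unitContraction (u : Lp ℝ 2 m) :
    unitContraction u =ᵐ[m] fun x => min (max (u x) 0) 1 :=
  LipschitzWith.coeFn_compLp _ _ u

theorem norm_unitContraction_sub_le (u v : Lp ℝ 2 m) :
    ‖unitContraction u - unitContraction v‖ ≤ ‖u - v‖ := by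
  have := LipschitzWith.norm_compLp_sub_le ((LipschitzWith.id.max_const (0 : ℝ)).min_const 1)
    (by simp) u v
  rwa [NNReal.coe_one, one_mul] at this

theorem embeddedForm_isSymmDirichletForm [CompleteSpace V] (hd : DenseRange ι)
    (hle : ∀ v, ‖ι v‖ ≤ ‖v‖) (hP : ∀ x, ∃ y, ι y = unitContraction (ι x) ∧
      ‖y‖ ^ 2 - ‖ι y‖ ^ 2 ≤ ‖x‖ ^ 2 - ‖ι x‖ ^ 2) :
    (embeddedForm ι hι).IsSymmDirichletForm := by
  refine ⟨hd, fun u v => ?_, fun u => ?_, embeddedForm_isClosedForm, fun u => ?_⟩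
  · obtain ⟨x, hx⟩ := exists_eq_of_embeddedForm_domain u
    obtain ⟨y, hy⟩ := exists_eq_of_embeddedForm_domain v
    rw [embeddedForm_form hx hy, embeddedForm_form hy hx, real_inner_comm, real_inner_comm (ι y)]
  · obtain ⟨x, hx⟩ := exists_eq_of_embeddedForm_domain u
    rw [embeddedForm_form_self hx]
    have := hle x
    have : ‖ι x‖ ^ 2 ≤ ‖x‖ ^ 2 := by gcongr
    linarith
  · obtain ⟨x, hx⟩ := exists_eq_of_embeddedForm_domain u
    obtain ⟨y, hy, hyx⟩ := hP x
    refine ⟨⟨ι y, mem_embeddedForm_domain y⟩, ?_, ?_⟩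
    · rw [hx]
      exact (congrArg (fun f : Lp ℝ 2 m => (f : X → ℝ)) hy).eventuallyEq.trans
        (coeFn_unitContraction _)
    · rwa [embeddedForm_form_self rfl, embeddedForm_form_self hx]

/-- The set `0 ≤ f ≤ 1` is the fixed point set of the unit contraction, hence closed, and it is
convex. By `resolvent_eq_of_minimal` the resolvents preserve it, so the semigroup does as well. -/
theorem exists_semigroup_of_embeddedForm [CompleteSpace V] (hd : DenseRange ι)
    (hle : ∀ v, ‖ι v‖ ≤ ‖v‖) (hP : ∀ x, ∃ y, ι y = unitContraction (ι x) ∧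
      ‖y‖ ^ 2 - ‖ι y‖ ^ 2 ≤ ‖x‖ ^ 2 - ‖ι x‖ ^ 2) :
    ∃ T : ℝ≥0 → Lp ℝ 2 m →L[ℝ] Lp ℝ 2 m, IsL2Semigroup (embeddedForm ι hι) T ∧
      (∀ t x y, inner ℝ (T t x) y = inner ℝ x (T t y)) ∧
      ∀ t (f : Lp ℝ 2 m), (∀ᵐ x ∂m, 0 ≤ f x ∧ f x ≤ 1) → ∀ᵐ x ∂m, 0 ≤ T t f x ∧ T t f x ≤ 1 := by
  obtain ⟨T, hT, hgen, hsymm, hC⟩ := exists_semigroup_of_embedding hι hd hle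
  have hfix : ∀ f : Lp ℝ 2 m, (∀ᵐ x ∂m, 0 ≤ f x ∧ f x ≤ 1) ↔ unitContraction f = f := by
    intro f
    constructor
    · intro hf
      refine Lp.ext ?_
      filter_upwards [hf, coeFn_unitContraction f] with x hx h
      rw [h, max_eq_left hx.1, min_eq_left hx.2]
    · intro hf
      have := coeFn_unitContraction f
      rw [hf] at this
      filter_upwards [this] with x hx
      rw [hx]
      exact ⟨le_min (le_max_right _ _) zero_le_one, min_le_right _ _⟩
  have hlip : LipschitzWith 1 (unitContraction : Lp ℝ 2 m → Lp ℝ 2 m) :=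
    LipschitzWith.of_dist_le_mul fun u v => by
      rw [dist_eq_norm, dist_eq_norm, NNReal.coe_one, one_mul]
      exact norm_unitContraction_sub_le u v
  refine ⟨T, ⟨hT, fun u w => ?_⟩, hsymm, fun t f hf => ?_⟩
  · rw [hgen]
    constructor
    · rintro ⟨x, rfl, h⟩
      refine ⟨⟨ι x, mem_embeddedForm_domain x⟩, rfl, fun v => ?_⟩
      obtain ⟨y, hy⟩ := exists_eq_of_embeddedForm_domain v
      rw [embeddedForm_form rfl hy, h, hy]
    · rintro ⟨u', hu', h⟩
      obtain ⟨x, hx⟩ := exists_eq_of_embeddedForm_domain u'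
      refine ⟨x, hx.symm.trans hu', fun y => ?_⟩
      have := h ⟨ι y, mem_embeddedForm_domain y⟩
      rwa [embeddedForm_form hx rfl] at this
  · refine hC {f | ∀ᵐ x ∂m, 0 ≤ f x ∧ f x ≤ 1} ?_ ?_ ?_ t f hf
    · intro f hf g hg a b ha hb hab
      filter_upwards [hf, hg, Lp.coeFn_add (a • f) (b • g), Lp.coeFn_smul a f,
        Lp.coeFn_smul b g] with x h1 h2 h3 h4 h5
      rw [h3, Pi.add_apply, h4, h5, Pi.smul_apply, Pi.smul_apply, smul_eq_mul, smul_eq_mul]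
      exact ⟨add_nonneg (mul_nonneg ha h1.1) (mul_nonneg hb h2.1), by nlinarith⟩
    · simp_rw [hfix]
      exact isClosed_eq hlip.continuous continuous_id
    · intro l hl f hf u hu
      refine (hfix u).2 (resolvent_eq_of_minimal hle hP hl (f := f) ?_ hu)
      have := norm_unitContraction_sub_le u f
      rwa [(hfix f).1 hf] at this

end EmbeddedForm

/-! ### Truncation in `L^q`, and limits compared across exponents. -/

section Truncation

/-- The truncation of a real number at the levels `-n` and `n`. -/
def clip (n : ℕ) (s : ℝ) : ℝ := min (max s (-n)) n

theorem abs_clip_le (n : ℕ) (s : ℝ) : |clip n s| ≤ n := by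
  have hn : (0 : ℝ) ≤ n := n.cast_nonneg
  exact abs_le.2 ⟨le_min (le_max_right _ _) (by linarith), min_le_right _ _⟩

theorem clip_eq_self {n : ℕ} {s : ℝ} (h : |s| ≤ n) : clip n s = s := by
  rw [clip, max_eq_left (abs_le.1 h).1, min_eq_left (abs_le.1 h).2]

theorem clip_nonneg (n : ℕ) {s : ℝ} (h : 0 ≤ s) : 0 ≤ clip n s :=
  le_min (h.trans (le_max_left _ _)) n.cast_nonneg

theorem lipschitzWith_clip (n : ℕ) : LipschitzWith 1 (clip n) :=
  (LipschitzWith.id.max_const (-n : ℝ)).min_const n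

@[simp] theorem clip_zero (n : ℕ) : clip n 0 = 0 := clip_eq_self (by simp)

theorem abs_clip_le_abs (n : ℕ) (s : ℝ) : |clip n s| ≤ |s| := by
  have := (lipschitzWith_clip n).dist_le_mul s 0
  simpa [Real.dist_eq] using this

theorem abs_clip_sub_le (n : ℕ) (s : ℝ) : |clip n s - s| ≤ |s| := by
  have hn : (0 : ℝ) ≤ n := n.cast_nonneg
  unfold clip
  rcases le_total 0 s with h | h
  · rw [max_eq_left (by linarith), abs_of_nonneg h]
    exact abs_le.2 ⟨by linarith [le_min h hn], by linarith [min_le_left s n]⟩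
  · rw [min_eq_left (max_le (by linarith) (by linarith)), abs_of_nonpos h]
    exact abs_le.2 ⟨by linarith [le_max_left s (-n)], by linarith [max_le h (neg_nonpos.2 hn)]⟩

variable {X : Type*} [MeasurableSpace X] {m : Measure X} {q : ℝ≥0∞}

/-- Truncation on `L^q`. -/
noncomputable def clipLp (n : ℕ) (f : Lp ℝ q m) : Lp ℝ q m :=
  (lipschitzWith_clip n).compLp (clip_zero n) f

theorem coeFn_clipLp (n : ℕ) (f : Lp ℝ q m) : clipLp n f =ᵐ[m] fun x => clip n (f x) :=
  LipschitzWith.coeFn_compLp _ _ f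

/-- Dominated convergence: the error is at most `|f|` and vanishes at each point once `n ≥ |f|`. -/
theorem tendsto_clipLp [Fact (1 ≤ q)] (hq : q ≠ ∞) (f : Lp ℝ q m) :
    Tendsto (fun n => clipLp n f) atTop (𝓝 f) := by
  have hq0 : q ≠ 0 := (zero_lt_one.trans_le Fact.out).ne'
  have hq' : 0 < q.toReal := ENNReal.toReal_pos hq0 hq
  rw [Lp.tendsto_Lp_iff_tendsto_eLpNorm']
  have e : ∀ n, eLpNorm ((clipLp n f : X → ℝ) - (f : X → ℝ)) q m =
      (∫⁻ x, ‖clip n (f x) - f x‖ₑ ^ q.toReal ∂m) ^ (1 / q.toReal) := fun n => by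
    rw [eLpNorm_congr_ae ((coeFn_clipLp n f).sub (ae_eq_refl _)),
      eLpNorm_eq_lintegral_rpow_enorm_toReal hq0 hq]
    rfl
  simp_rw [e]
  have hm : AEStronglyMeasurable f m := Lp.aestronglyMeasurable f
  have h1 : Tendsto (fun n : ℕ => ∫⁻ x, ‖clip n (f x) - f x‖ₑ ^ q.toReal ∂m) atTop
      (𝓝 (∫⁻ _, 0 ∂m)) := by
    refine tendsto_lintegral_of_dominated_convergence' (fun x => ‖f x‖ₑ ^ q.toReal)
      (fun n => ((((lipschitzWith_clip n).continuous.comp_aestronglyMeasurable hm).sub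
        hm).enorm).pow_const _) (fun n => Eventually.of_forall fun x => ?_)
      ((lintegral_rpow_enorm_lt_top_of_eLpNorm_lt_top hq0 hq (Lp.memLp f).2).ne)
      (Eventually.of_forall fun x => ?_)
    · refine ENNReal.rpow_le_rpow ?_ hq'.le
      rw [enorm_le_iff_norm_le, Real.norm_eq_abs, Real.norm_eq_abs]
      exact abs_clip_sub_le n _
    · refine tendsto_const_nhds.congr' ?_
      filter_upwards [tendsto_natCast_atTop_atTop.eventually_ge_atTop |f x|] with n hn
      rw [clip_eq_self hn, sub_self, enorm_zero, ENNReal.zero_rpow_of_pos hq']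
  rw [lintegral_zero] at h1
  have h2 := (ENNReal.continuous_rpow_const (y := 1 / q.toReal)).tendsto 0 |>.comp h1
  rwa [ENNReal.zero_rpow_of_pos (by positivity)] at h2

/-- Fatou along an almost everywhere convergent subsequence. The exponent `r` of the bound may
differ from the exponent `q` of the convergence. -/
theorem eLpNorm_le_of_tendsto_Lp [Fact (1 ≤ q)] {u : ℕ → Lp ℝ q m} {v : Lp ℝ q m}
    (h : Tendsto u atTop (𝓝 v)) {r C : ℝ≥0∞} (hC : ∀ n, eLpNorm (u n) r m ≤ C) :
    eLpNorm v r m ≤ C := by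
  obtain ⟨ns, -, hns⟩ := (tendstoInMeasure_of_tendsto_Lp h).exists_seq_tendsto_ae
  refine (Lp.eLpNorm_lim_le_liminf_eLpNorm (fun n => Lp.aestronglyMeasurable (u (ns n))) v
    hns).trans ?_
  exact liminf_le_of_frequently_le' (Frequently.of_forall fun n => hC _)

theorem ae_eq_of_tendsto_Lp {r : ℝ≥0∞} [Fact (1 ≤ q)] [Fact (1 ≤ r)] {u : ℕ → Lp ℝ q m}
    {u' : Lp ℝ q m} {v : ℕ → Lp ℝ r m} {v' : Lp ℝ r m} (hu : Tendsto u atTop (𝓝 u'))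
    (hv : Tendsto v atTop (𝓝 v')) (h : ∀ n, u n =ᵐ[m] v n) : u' =ᵐ[m] v' :=
  tendstoInMeasure_ae_unique (tendstoInMeasure_of_tendsto_Lp hu)
    ((tendstoInMeasure_of_tendsto_Lp hv).congr_left fun n => (h n).symm)

end Truncation

/-! ### Symmetric sub-Markovian operators contract `L^p`. -/

section SubMarkov

variable {X : Type*} [MeasurableSpace X] {m : Measure X}

/-- Sub-Markovian operators on `L²`. -/
def IsSubMarkov (T : Lp ℝ 2 m →L[ℝ] Lp ℝ 2 m) : Prop :=
  ∀ f : Lp ℝ 2 m, (∀ᵐ x ∂m, 0 ≤ f x ∧ f x ≤ 1) → ∀ᵐ x ∂m, 0 ≤ T f x ∧ T f x ≤ 1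

variable {T : Lp ℝ 2 m →L[ℝ] Lp ℝ 2 m}

theorem IsSubMarkov.map_bounds (hT : IsSubMarkov T) {f : Lp ℝ 2 m} {c : ℝ} (hc : 0 < c)
    (hf : ∀ᵐ x ∂m, 0 ≤ f x ∧ f x ≤ c) : ∀ᵐ x ∂m, 0 ≤ T f x ∧ T f x ≤ c := by
  have h := hT (c⁻¹ • f) (by
    filter_upwards [hf, Lp.coeFn_smul c⁻¹ f] with x hx h
    rw [h, Pi.smul_apply, smul_eq_mul, inv_mul_le_iff₀ hc, mul_one]
    exact ⟨mul_nonneg (by positivity) hx.1, hx.2⟩)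
  rw [map_smul] at h
  filter_upwards [h, Lp.coeFn_smul c⁻¹ (T f)] with x hx h
  rw [h, Pi.smul_apply, smul_eq_mul, inv_mul_le_iff₀ hc, mul_one] at hx
  exact ⟨(mul_nonneg_iff_of_pos_left (by positivity)).1 hx.1, hx.2⟩

/-- The defining property concerns only functions with values in `[0, 1]`; scaling extends it to
bounded functions, and truncation to all of `L²`. -/
theorem IsSubMarkov.map_nonneg (hT : IsSubMarkov T) {f : Lp ℝ 2 m} (hf : 0 ≤ f) : 0 ≤ T f := by
  have h1 := (T.continuous.tendsto f).comp (tendsto_clipLp ENNReal.ofNat_ne_top f)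
  refine ge_of_tendsto h1 ((eventually_gt_atTop 0).mono fun n hn => ?_)
  have hn' : (0 : ℝ) < n := by exact_mod_cast hn
  rw [Function.comp_apply, ← Lp.coeFn_nonneg]
  filter_upwards [hT.map_bounds hn' (f := clipLp n f) (by
    filter_upwards [coeFn_clipLp n f, (Lp.coeFn_nonneg f).2 hf] with x h1 h2
    rw [h1]
    exact ⟨clip_nonneg n h2, (abs_le.1 (abs_clip_le n _)).2⟩)] with x hx using hx.1

theorem IsSubMarkov.monotone (hT : IsSubMarkov T) {f g : Lp ℝ 2 m} (h : f ≤ g) : T f ≤ T g := by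
  have := hT.map_nonneg (sub_nonneg.2 h)
  rwa [map_sub, sub_nonneg] at this

theorem IsSubMarkov.map_le_const (hT : IsSubMarkov T) {f : Lp ℝ 2 m} {c : ℝ} (hc : 0 < c)
    (hf : ∀ᵐ x ∂m, f x ≤ c) : ∀ᵐ x ∂m, T f x ≤ c := by
  have h1 : f ≤ Lp.posPart f := by
    rw [← Lp.coeFn_le]
    filter_upwards [Lp.coeFn_posPart f] with x hx
    rw [hx]; exact le_max_left _ _
  filter_upwards [(Lp.coeFn_le _ _).2 (hT.monotone h1), hT.map_bounds hc (f := Lp.posPart f) (by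
    filter_upwards [Lp.coeFn_posPart f, hf] with x h h'
    rw [h]
    exact ⟨le_max_right _ _, max_le h' hc.le⟩)] with x h2 h3 using h2.trans h3.2

theorem IsSubMarkov.abs_map_le_const (hT : IsSubMarkov T) {f : Lp ℝ 2 m} {c : ℝ} (hc : 0 < c)
    (hf : ∀ᵐ x ∂m, |f x| ≤ c) : ∀ᵐ x ∂m, |T f x| ≤ c := by
  have h1 := hT.map_le_const hc (hf.mono fun x hx => (abs_le.1 hx).2)
  have h2 := hT.map_le_const hc (f := -f) (by
    filter_upwards [hf, Lp.coeFn_neg f] with x hx h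
    rw [h, Pi.neg_apply]; linarith [(abs_le.1 hx).1])
  rw [map_neg] at h2
  filter_upwards [h1, h2, Lp.coeFn_neg (T f)] with x h1 h2 h3
  rw [h3, Pi.neg_apply] at h2
  exact abs_le.2 ⟨by linarith, h1⟩

/-- By convexity `s ↦ s^q` lies above its tangent at `r`, which is Bernoulli's inequality at `s/r -
1`. A linear bound in `s` and `s^q` is what a positive operator can be applied to. -/
theorem tangent_le_rpow {q r s : ℝ} (hq : 1 ≤ q) (hr : 0 < r) (hs : 0 ≤ s) :
    q * r ^ (q - 1) * s - s ^ q ≤ (q - 1) * r ^ q := by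
  have h1 := one_add_mul_self_le_rpow_one_add (s := s / r - 1) (by
    have : 0 ≤ s / r := by positivity
    linarith) hq
  rw [add_sub_cancel, Real.div_rpow hs hr.le, le_div_iff₀ (by positivity)] at h1
  have h2 : r ^ q = r ^ (q - 1) * r := by
    rw [← Real.rpow_add_one hr.ne', sub_add_cancel]
  have h3 : (1 + q * (s / r - 1)) * r ^ q = q * r ^ (q - 1) * s - (q - 1) * r ^ q := by
    rw [h2]; field_simp; ring
  linarith

/-- Jensen's inequality for sub-Markovian operators. -/
theorem IsSubMarkov.rpow_map_le (hT : IsSubMarkov T) {u v : Lp ℝ 2 m} {q : ℝ} (hq : 1 < q)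
    (hu : ∀ᵐ x ∂m, 0 ≤ u x) (hv : ∀ᵐ x ∂m, v x = u x ^ q) :
    ∀ᵐ x ∂m, 0 ≤ T u x ∧ T u x ^ q ≤ T v x := by
  -- The tangent inequality is transported by `T` for rational `r` only, so that a single null set
  -- suffices. Continuity then allows every `r ≥ 0`, in particular `r = T u x`, for which it becomes
  -- the claim.
  have h1 : ∀ r : ℚ, ∀ᵐ x ∂m, 0 < r →
      q * (r : ℝ) ^ (q - 1) * T u x - T v x ≤ (q - 1) * (r : ℝ) ^ q := fun r => by
    by_cases hr : 0 < r
    swap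
    · exact Eventually.of_forall fun x h => absurd h hr
    have hr' : (0 : ℝ) < r := by exact_mod_cast hr
    set a := q * (r : ℝ) ^ (q - 1)
    have h2 := hT.map_le_const (f := a • u - v) (c := (q - 1) * (r : ℝ) ^ q)
      (mul_pos (by linarith) (by positivity)) (by
        filter_upwards [hu, hv, Lp.coeFn_sub (a • u) v, Lp.coeFn_smul a u] with x h1 h2 h3 h4
        rw [h3, Pi.sub_apply, h4, Pi.smul_apply, smul_eq_mul, h2]
        exact tangent_le_rpow hq.le hr' h1)
    rw [map_sub, map_smul] at h2
    filter_upwards [h2, Lp.coeFn_sub (a • T u) (T v), Lp.coeFn_smul a (T u)] with x h1 h3 h4 _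
    rwa [h3, Pi.sub_apply, h4, Pi.smul_apply, smul_eq_mul] at h1
  have h0 := (Lp.coeFn_nonneg _).2 (hT.map_nonneg ((Lp.coeFn_nonneg u).1 hu))
  filter_upwards [ae_all_iff.2 h1, h0] with x hx (hx0 : 0 ≤ T u x)
  refine ⟨hx0, ?_⟩
  set y := T u x
  have hcl : ∀ r : ℝ, 0 ≤ r → q * r ^ (q - 1) * y - T v x ≤ (q - 1) * r ^ q := by
    have hcont : IsClosed {r : ℝ | q * r ^ (q - 1) * y - T v x ≤ (q - 1) * r ^ q} := by
      refine isClosed_le ?_ ?_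
      · exact ((continuous_const.mul (Real.continuous_rpow_const (by linarith))).mul
          continuous_const).sub continuous_const
      · exact continuous_const.mul (Real.continuous_rpow_const (by linarith))
    have hsub : Ioi (0 : ℝ) ⊆ {r : ℝ | q * r ^ (q - 1) * y - T v x ≤ (q - 1) * r ^ q} := by
      intro r hr
      obtain ⟨s, -, hs, hlim⟩ := Real.exists_seq_rat_strictAnti_tendsto r
      refine hcont.mem_of_tendsto hlim (Eventually.of_forall fun n => hx (s n) ?_)
      have : (0 : ℝ) < s n := lt_trans hr (hs n)
      exact_mod_cast this
    intro r hr
    have := closure_minimal hsub hcont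
    rw [closure_Ioi] at this
    exact this hr
  have h3 := hcl y hx0
  have h4 : y ^ q = y ^ (q - 1) * y := by
    rcases hx0.eq_or_lt with h | h
    · rw [← h, Real.zero_rpow (by linarith), mul_zero]
    · rw [← Real.rpow_add_one h.ne', sub_add_cancel]
  rw [mul_assoc, ← h4] at h3
  linarith

/-- Duality: for a set `s` of finite measure, `∫_s T g = ⟪T 1_s, g⟫ ≤ ∫ g`, because `T 1_s ≤ 1`.
Sigma-finiteness passes to the whole space. -/
theorem IsSubMarkov.lintegral_map_le [SigmaFinite m] (hT : IsSubMarkov T)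
    (hs : ∀ x y, inner ℝ (T x) y = inner ℝ x (T y)) {g : Lp ℝ 2 m} (hg : 0 ≤ g) :
    ∫⁻ x, ENNReal.ofReal (T g x) ∂m ≤ ∫⁻ x, ENNReal.ofReal (g x) ∂m := by
  refine lintegral_le_of_forall_fin_meas_le _ fun s hsm hsf => ?_
  have hTg := (Lp.coeFn_nonneg _).2 (hT.map_nonneg hg)
  have hg' := (Lp.coeFn_nonneg _).2 hg
  have : IsFiniteMeasure (m.restrict s) := ⟨by simpa using hsf.lt_top⟩
  have hint : IntegrableOn (T g) s m := ((Lp.memLp (T g)).restrict s).integrable one_le_two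
  rw [← ofReal_integral_eq_lintegral_ofReal hint (ae_restrict_of_ae hTg),
    ← L2.inner_indicatorConstLp_one (𝕜 := ℝ) hsm hsf (T g), ← hs, L2.inner_def]
  set e : Lp ℝ 2 m := indicatorConstLp 2 hsm hsf (1 : ℝ)
  have hTe := hT e (by
    filter_upwards [indicatorConstLp_coeFn (p := 2) (hs := hsm) (hμs := hsf) (c := (1 : ℝ))] with x hx
    rw [hx]
    by_cases h : x ∈ s <;> simp [h])
  have hi : Integrable (fun x => inner ℝ (T e x) (g x)) m := L2.integrable_inner (𝕜 := ℝ) (T e) g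
  rw [ofReal_integral_eq_lintegral_ofReal hi (by
    filter_upwards [hTe, hg'] with x h1 h2
    exact mul_nonneg h2 h1.1)]
  refine lintegral_mono_ae ?_
  filter_upwards [hTe, hg'] with x h1 h2
  refine ENNReal.ofReal_le_ofReal ?_
  change g x * T e x ≤ g x
  exact mul_le_of_le_one_right h2 h1.2

theorem IsSubMarkov.abs_map_le (hT : IsSubMarkov T) (u : Lp ℝ 2 m) : |T u| ≤ T |u| :=
  abs_le'.2 ⟨hT.monotone (le_abs_self u), by rw [← map_neg]; exact hT.monotone (neg_le_abs u)⟩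

/-- Jensen gives `|Tu|^q ≤ T(|u|^q)`, whose integral is at most that of `|u|^q`. Boundedness of `u`
ensures that `|u|^q` belongs to `L²`, where `T` acts. -/
theorem IsSubMarkov.eLpNorm_map_le_of_bounded [SigmaFinite m] (hT : IsSubMarkov T)
    (hs : ∀ x y, inner ℝ (T x) y = inner ℝ x (T y)) {p : ℝ≥0∞} (hp : 1 < p) (hp' : p ≠ ∞)
    {u : Lp ℝ 2 m} {c : ℝ} (hc : ∀ᵐ x ∂m, |u x| ≤ c) :
    eLpNorm (T u) p m ≤ eLpNorm u p m := by
  have hp0 : p ≠ 0 := (zero_lt_one.trans hp).ne'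
  have hq : 1 < p.toReal := by
    rwa [← ENNReal.toReal_one, ENNReal.toReal_lt_toReal ENNReal.one_ne_top hp']
  set q := p.toReal
  have hmem : MemLp (fun x => |u x| ^ q) 2 m := by
    refine (Lp.memLp u).of_le_mul (c := c ^ (q - 1)) ?_ ?_
    · exact (Real.continuous_rpow_const (by linarith)).comp_aestronglyMeasurable
        (Lp.aestronglyMeasurable u).norm
    · filter_upwards [hc] with x hx
      rw [Real.norm_of_nonneg (by positivity), Real.norm_eq_abs]
      rcases (abs_nonneg (u x)).eq_or_lt with h | h
      · rw [← h, Real.zero_rpow (by linarith), mul_zero]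
      · calc |u x| ^ q = |u x| ^ (q - 1) * |u x| := by
              rw [← Real.rpow_add_one h.ne', sub_add_cancel]
          _ ≤ _ := by
              gcongr
  have hv0 : 0 ≤ hmem.toLp := by
    rw [← Lp.coeFn_nonneg]
    filter_upwards [hmem.coeFn_toLp] with x hx
    rw [hx]; simp only [Pi.zero_apply]; positivity
  have hJ := hT.rpow_map_le (u := |u|) (v := hmem.toLp) hq (by
    filter_upwards [Lp.coeFn_abs u] with x hx
    rw [hx]; exact abs_nonneg _) (by
    filter_upwards [Lp.coeFn_abs u, hmem.coeFn_toLp] with x h1 h2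
    rw [h1, h2])
  rw [eLpNorm_eq_lintegral_rpow_enorm_toReal hp0 hp', eLpNorm_eq_lintegral_rpow_enorm_toReal hp0 hp']
  refine ENNReal.rpow_le_rpow ?_ (by positivity)
  have hpow : ∀ s : ℝ, ‖s‖ₑ ^ q = ENNReal.ofReal (|s| ^ q) := fun s => by
    rw [← ofReal_norm, Real.norm_eq_abs,
      ENNReal.ofReal_rpow_of_nonneg (abs_nonneg _) (by linarith)]
  calc ∫⁻ x, ‖T u x‖ₑ ^ q ∂m ≤ ∫⁻ x, ENNReal.ofReal (T hmem.toLp x) ∂m := by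
        refine lintegral_mono_ae ?_
        filter_upwards [hJ, (Lp.coeFn_le _ _).2 (hT.abs_map_le u), Lp.coeFn_abs (T u)] with x h1 h2 h3
        rw [h3] at h2
        rw [hpow]
        refine ENNReal.ofReal_le_ofReal (le_trans ?_ h1.2)
        gcongr
    _ ≤ ∫⁻ x, ENNReal.ofReal ((hmem.toLp _ : Lp ℝ 2 m) x) ∂m := hT.lintegral_map_le hs hv0
    _ = ∫⁻ x, ‖u x‖ₑ ^ q ∂m := by
        refine lintegral_congr_ae ?_
        filter_upwards [hmem.coeFn_toLp] with x hx
        exact (congrArg ENNReal.ofReal hx).trans (hpow _).symm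

theorem IsSubMarkov.eLpNorm_map_le [SigmaFinite m] (hT : IsSubMarkov T)
    (hs : ∀ x y, inner ℝ (T x) y = inner ℝ x (T y)) {p : ℝ≥0∞} (hp : 1 < p) (hp' : p ≠ ∞)
    (u : Lp ℝ 2 m) : eLpNorm (T u) p m ≤ eLpNorm u p m := by
  refine eLpNorm_le_of_tendsto_Lp
    ((T.continuous.tendsto u).comp (tendsto_clipLp ENNReal.ofNat_ne_top u)) fun n => ?_
  refine (hT.eLpNorm_map_le_of_bounded hs hp hp' (c := n) ?_).trans ?_
  · filter_upwards [coeFn_clipLp n u] with x hx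
    rw [hx]; exact abs_clip_le n _
  · refine eLpNorm_mono_ae ?_
    filter_upwards [coeFn_clipLp n u] with x hx
    rw [hx]; exact abs_clip_le_abs n _

end SubMarkov

/-! ### The semigroup on `L^p` and the transfer of generators. -/

section LpSemigroup

variable {X : Type*} [MeasurableSpace X] {m : Measure X} {p : ℝ≥0∞} [Fact (1 ≤ p)]

theorem dense_Lp_memLp_two_bounded (hp : p ≠ ∞) :
    Dense {v : Lp ℝ p m | MemLp v 2 m ∧ ∃ c : ℝ, 0 < c ∧ ∀ᵐ x ∂m, |v x| ≤ c} := by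
  have hp0 : p ≠ 0 := (zero_lt_one.trans_le Fact.out).ne'
  refine (Lp.simpleFunc.denseRange (E := ℝ) (μ := m) hp).mono ?_
  rintro _ ⟨f, rfl⟩
  have h1 := Lp.simpleFunc.toSimpleFunc_eq_toFun f
  have h2 := (SimpleFunc.memLp_iff hp0 hp).1 (Lp.simpleFunc.memLp f)
  obtain ⟨c, hc⟩ := (Lp.simpleFunc.toSimpleFunc f).exists_forall_norm_le
  refine ⟨(SimpleFunc.memLp_of_finite_measure_preimage 2 h2).ae_eq h1, max c 1, by positivity, ?_⟩
  filter_upwards [h1] with x hx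
  rw [← hx]
  exact (hc x).trans (le_max_left _ _)

/-- An `L²` operator which contracts the `L^p` norm extends to `L^p`. -/
theorem exists_Lp_extension (hp : p ≠ ∞) (T : Lp ℝ 2 m →L[ℝ] Lp ℝ 2 m)
    (hT : ∀ u, eLpNorm (T u) p m ≤ eLpNorm u p m) :
    ∃ S : Lp ℝ p m →L[ℝ] Lp ℝ p m, ‖S‖ ≤ 1 ∧
      ∀ (u : Lp ℝ 2 m) (v : Lp ℝ p m), u =ᵐ[m] v → T u =ᵐ[m] S v := by
  let D : Submodule ℝ (Lp ℝ p m) :=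
    { carrier := {v | MemLp v 2 m}
      add_mem' := fun {a b} ha hb => (ha.add hb).ae_eq (Lp.coeFn_add a b).symm
      zero_mem' := MemLp.zero.ae_eq (Lp.coeFn_zero ℝ p m).symm
      smul_mem' := fun c a ha => (MemLp.const_smul ha c).ae_eq (Lp.coeFn_smul c a).symm }
  have hm2 : ∀ v : D, MemLp (v : Lp ℝ p m) 2 m := fun v => v.2
  have hTp : ∀ v : D, MemLp (T ((hm2 v).toLp _)) p m := fun v =>
    ⟨Lp.aestronglyMeasurable _, (hT _).trans_lt (by
      rw [eLpNorm_congr_ae (hm2 v).coeFn_toLp]; exact (Lp.memLp (v : Lp ℝ p m)).2)⟩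
  let S₀ : D →ₗ[ℝ] Lp ℝ p m :=
    { toFun := fun v => (hTp v).toLp _
      map_add' := fun a b => by
        have e : (hm2 (a + b)).toLp _ = (hm2 a).toLp _ + (hm2 b).toLp _ := by
          rw [← MemLp.toLp_add]
          exact (MemLp.toLp_eq_toLp_iff _ _).2 (Lp.coeFn_add (a : Lp ℝ p m) b)
        rw [← MemLp.toLp_add, MemLp.toLp_eq_toLp_iff, e, map_add]
        exact Lp.coeFn_add _ _
      map_smul' := fun c a => by
        have e : (hm2 (c • a)).toLp _ = c • (hm2 a).toLp _ := by
          rw [← MemLp.toLp_const_smul]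
          exact (MemLp.toLp_eq_toLp_iff _ _).2 (Lp.coeFn_smul c (a : Lp ℝ p m))
        rw [RingHom.id_apply, ← MemLp.toLp_const_smul, MemLp.toLp_eq_toLp_iff, e, map_smul]
        exact Lp.coeFn_smul _ _ }
  have hS₀ : ∀ v, ‖S₀ v‖ ≤ 1 * ‖v‖ := fun v => by
    rw [one_mul]
    change ‖(hTp v).toLp _‖ ≤ ‖(v : Lp ℝ p m)‖
    rw [Lp.norm_toLp, Lp.norm_def]
    refine ENNReal.toReal_mono (Lp.memLp (v : Lp ℝ p m)).2.ne ((hT _).trans_eq ?_)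
    exact eLpNorm_congr_ae (hm2 v).coeFn_toLp
  have hD : DenseRange D.subtypeL := by
    have : Dense (D : Set (Lp ℝ p m)) := (dense_Lp_memLp_two_bounded hp).mono fun v hv => hv.1
    simpa [DenseRange] using this
  have hind : IsUniformInducing D.subtypeL := isUniformEmbedding_subtype_val.isUniformInducing
  let S := (S₀.mkContinuous 1 hS₀).extend D.subtypeL
  have hS : ∀ v : D, S (v : Lp ℝ p m) = S₀ v := fun v =>
    ContinuousLinearMap.extend_eq _ hD hind v
  refine ⟨S, ContinuousLinearMap.opNorm_le_bound _ zero_le_one fun v => ?_, fun u v huv => ?_⟩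
  · refine hD.induction_on (p := fun v => ‖S v‖ ≤ 1 * ‖v‖) v
      (isClosed_le (by fun_prop) (by fun_prop)) fun x => ?_
    exact (congrArg norm (hS x)).trans_le (hS₀ x)
  · have hv : v ∈ D := (Lp.memLp u).ae_eq huv
    have h1 := hS ⟨v, hv⟩
    have h2 : (hm2 ⟨v, hv⟩).toLp _ = u := Lp.ext ((hm2 ⟨v, hv⟩).coeFn_toLp.trans huv.symm)
    rw [show S v = S₀ ⟨v, hv⟩ from h1]
    have h3 := (hTp ⟨v, hv⟩).coeFn_toLp
    refine EventuallyEq.trans ?_ h3.symm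
    rw [h2]

/-- From `|w|^p ≤ c^{p-2} |w|²`: on uniformly bounded functions, convergence in `L²` implies
convergence in `L^p`. -/
theorem eLpNorm_le_of_bounded {p : ℝ≥0∞} (hp : 2 < p) (hp' : p ≠ ∞) {w : X → ℝ} {c : ℝ}
    (hc : ∀ᵐ x ∂m, |w x| ≤ c) : eLpNorm w p m ≤
      (ENNReal.ofReal (c ^ (p.toReal - 2)) * eLpNorm w 2 m ^ (2 : ℝ)) ^ (1 / p.toReal) := by
  have hp0 : p ≠ 0 := (zero_lt_two.trans hp).ne'
  have hq : 2 < p.toReal := by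
    have := (ENNReal.toReal_lt_toReal ENNReal.ofNat_ne_top hp').2 hp
    simpa using this
  rw [eLpNorm_eq_lintegral_rpow_enorm_toReal hp0 hp', eLpNorm_eq_lintegral_rpow_enorm_toReal
    two_ne_zero ENNReal.ofNat_ne_top, ← ENNReal.rpow_mul, ENNReal.toReal_ofNat, one_div, one_div,
    inv_mul_cancel₀ two_ne_zero, ENNReal.rpow_one, ← lintegral_const_mul' _ _ ENNReal.ofReal_ne_top]
  refine ENNReal.rpow_le_rpow (lintegral_mono_ae ?_) (by positivity)
  filter_upwards [hc] with x hx
  have hc0 : 0 ≤ c := (abs_nonneg _).trans hx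
  rw [← ofReal_norm, Real.norm_eq_abs, ENNReal.ofReal_rpow_of_nonneg (abs_nonneg _) (by linarith),
    ENNReal.ofReal_rpow_of_nonneg (abs_nonneg _) (by norm_num), ← ENNReal.ofReal_mul (by positivity)]
  refine ENNReal.ofReal_le_ofReal ?_
  rcases (abs_nonneg (w x)).eq_or_lt with h | h
  · rw [← h, Real.zero_rpow (by linarith), Real.zero_rpow (by norm_num), mul_zero]
  · calc |w x| ^ p.toReal = |w x| ^ (p.toReal - 2) * |w x| ^ (2 : ℝ) := by
          rw [← Real.rpow_add h, sub_add_cancel]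
      _ ≤ _ := by
          gcongr

/-- Each operator extends by contractivity, and the semigroup law is inherited on the dense set of
bounded `L²` functions. On that set strong continuity also comes from `L²`, since the orbits stay
bounded. -/
theorem exists_isLpSemigroup [SigmaFinite m] (hp : 2 < p) (hp' : p ≠ ∞)
    {T : ℝ≥0 → Lp ℝ 2 m →L[ℝ] Lp ℝ 2 m} (hT : IsSCContractionSemigroup T)
    (hs : ∀ t x y, inner ℝ (T t x) y = inner ℝ x (T t y)) (hM : ∀ t, IsSubMarkov (T t)) :
    ∃ S : ℝ≥0 → Lp ℝ p m →L[ℝ] Lp ℝ p m, IsLpSemigroup T S := by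
  have hp1 : 1 < p := ENNReal.one_lt_two.trans hp
  choose S hS1 hS using fun t => exists_Lp_extension hp' (T t)
    fun u => (hM t).eLpNorm_map_le (hs t) hp1 hp' u
  have hdense := dense_Lp_memLp_two_bounded (m := m) hp'
  refine ⟨S, ⟨?_, ?_, hS1, ?_⟩, fun t u v _ _ h => hS t u v h⟩
  · refine ContinuousLinearMap.ext_on (hdense.mono Submodule.subset_span) fun v hv => Lp.ext ?_
    have h1 := hS 0 _ v hv.1.coeFn_toLp
    rw [hT.zero] at h1
    exact h1.symm.trans hv.1.coeFn_toLp
  · intro s t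
    refine ContinuousLinearMap.ext_on (hdense.mono Submodule.subset_span) fun v hv => Lp.ext ?_
    have h1 := hS (s + t) _ v hv.1.coeFn_toLp
    rw [hT.add] at h1
    exact h1.symm.trans (hS s _ _ (hS t _ v hv.1.coeFn_toLp))
  · refine forall_tendsto_of_dense hS1 hdense fun v hv => ?_
    obtain ⟨hv2, c, hc0, hc⟩ := hv
    set u : Lp ℝ 2 m := hv2.toLp _ with hu
    have huv : u =ᵐ[m] v := hv2.coeFn_toLp
    have h1 := (tendsto_iff_norm_sub_tendsto_zero.1 (hT.strong_continuity u))
    rw [Lp.tendsto_Lp_iff_tendsto_eLpNorm']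
    have h2 : Tendsto (fun t => eLpNorm (T t u - u : Lp ℝ 2 m) 2 m) (𝓝 0) (𝓝 0) := by
      have := ENNReal.tendsto_ofReal h1
      rw [ENNReal.ofReal_zero] at this
      refine this.congr fun t => ?_
      rw [Lp.norm_def, ENNReal.ofReal_toReal (Lp.memLp (T t u - u)).2.ne]
    have hq : 0 < p.toReal := ENNReal.toReal_pos (zero_lt_one.trans hp1).ne' hp'
    -- Both `T t u` and `u` are bounded by `c`, hence the bound `2 * c` for their difference.
    have h3 : Tendsto (fun t => (ENNReal.ofReal ((2 * c) ^ (p.toReal - 2)) *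
        eLpNorm (T t u - u : Lp ℝ 2 m) 2 m ^ (2 : ℝ)) ^ (1 / p.toReal)) (𝓝 0) (𝓝 0) := by
      have h4 := ((ENNReal.continuous_rpow_const (y := (2 : ℝ))).tendsto 0).comp h2
      rw [ENNReal.zero_rpow_of_pos two_pos] at h4
      have h5 := ENNReal.Tendsto.const_mul h4
        (Or.inr (ENNReal.ofReal_ne_top (r := (2 * c) ^ (p.toReal - 2))))
      rw [mul_zero] at h5
      have h6 := ((ENNReal.continuous_rpow_const (y := 1 / p.toReal)).tendsto 0).comp h5
      rwa [ENNReal.zero_rpow_of_pos (by positivity)] at h6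
    refine tendsto_of_tendsto_of_tendsto_of_le_of_le tendsto_const_nhds h3 (fun _ => zero_le)
      fun t => ?_
    have h7 : ((S t v : X → ℝ) - (v : X → ℝ)) =ᵐ[m] (T t u - u : Lp ℝ 2 m) :=
      ((hS t u v huv).symm.sub huv.symm).trans (Lp.coeFn_sub _ _).symm
    refine (eLpNorm_congr_ae h7).trans_le (eLpNorm_le_of_bounded hp hp' ?_)
    have h8 : ∀ᵐ x ∂m, |u x| ≤ c := by
      filter_upwards [huv, hc] with x h h'
      rwa [h]
    filter_upwards [(hM t).abs_map_le_const hc0 h8, h8, Lp.coeFn_sub (T t u) u] with x h9 h10 h11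
    rw [h11, Pi.sub_apply]
    have := abs_sub (T t u x) (u x)
    linarith

/-- Difference quotients of a semigroup are limits of averages of the orbit of the generator. -/
theorem tendsto_average_of_isGeneratorAt {V : Type*} [NormedAddCommGroup V] [NormedSpace ℝ V]
    {T : ℝ≥0 → V →L[ℝ] V} (hT : IsSCContractionSemigroup T) {u w : V} (h : IsGeneratorAt T u w)
    {t : ℝ≥0} (ht : 0 < t) :
    Tendsto (fun n : ℕ => ((n : ℝ) + 1)⁻¹ • ∑ k ∈ Finset.range (n + 1), T (k * (t / (n + 1))) w)
      atTop (𝓝 ((t : ℝ)⁻¹ • (T t u - u))) := by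
  have hstep : Tendsto (fun n : ℕ => t / ((n : ℝ≥0) + 1)) atTop (𝓝[>] 0) := by
    rw [tendsto_nhdsWithin_iff]
    refine ⟨?_, Eventually.of_forall fun n => by simp only [mem_Ioi]; positivity⟩
    rw [← NNReal.tendsto_coe]
    have := (tendsto_one_div_add_atTop_nhds_zero_nat (𝕜 := ℝ)).const_mul (t : ℝ)
    simpa [div_eq_mul_inv] using this
  have hq := tendsto_iff_norm_sub_tendsto_zero.1 (h.comp hstep)
  rw [tendsto_iff_norm_sub_tendsto_zero]
  refine squeeze_zero (fun _ => norm_nonneg _) (fun n => ?_) hq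
  set s : ℝ≥0 := t / (n + 1) with hs
  have hn : (0 : ℝ) < (n : ℝ) + 1 := by positivity
  have hts : ((n : ℝ≥0) + 1) * s = t := by rw [hs]; field_simp
  -- The increment over `[0, t]` telescopes into `n + 1` increments of length `s`, each of which is
  -- `T (k * s)` applied to the first. Replacing `(T s u - u) / s` by `w` costs at most the error of
  -- the difference quotient at `s`.
  have htel : T t u - u = ∑ k ∈ Finset.range (n + 1), T (k * s) (T s u - u) := by
    have h1 : ∀ k : ℕ, T (k * s) (T s u - u) = T ((k + 1 : ℕ) * s) u - T (k * s) u := fun k => by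
      rw [map_sub, Nat.cast_add, Nat.cast_one, add_mul, one_mul, hT.add]; rfl
    simp_rw [h1]
    rw [Finset.sum_range_sub (fun k : ℕ => T (k * s) u)]
    simp [hts, hT.zero]
  have e : (t : ℝ)⁻¹ = ((n : ℝ) + 1)⁻¹ * (s : ℝ)⁻¹ := by
    rw [← mul_inv, ← hts]; push_cast; rfl
  rw [htel, e, mul_smul, ← smul_sub, norm_smul, norm_inv, Real.norm_of_nonneg hn.le,
    inv_mul_le_iff₀ hn, Finset.smul_sum, ← Finset.sum_sub_distrib]
  refine (norm_sum_le _ _).trans ((Finset.sum_le_card_nsmul _ _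
    ‖(s : ℝ)⁻¹ • (T s u - u) - w‖ fun k _ => ?_).trans_eq ?_)
  · rw [← map_smul, ← map_sub, norm_sub_rev]
    exact (ContinuousLinearMap.le_of_opNorm_le _ (hT.contraction _) _).trans_eq (one_mul _)
  · rw [Finset.card_range, nsmul_eq_mul]; push_cast; rfl

/-- Compatibility is assumed only on `L¹ ∩ L^∞`; truncation removes the boundedness, with limits
taken in `L²` and `L^p` at once. -/
theorem IsLpSemigroup.ae_eq {T : ℝ≥0 → Lp ℝ 2 m →L[ℝ] Lp ℝ 2 m}
    {S : ℝ≥0 → Lp ℝ p m →L[ℝ] Lp ℝ p m} (hS : IsLpSemigroup T S) (hp' : p ≠ ∞) (t : ℝ≥0)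
    {w : Lp ℝ 2 m} {z : Lp ℝ p m} (h1 : MemLp w 1 m) (hwz : w =ᵐ[m] z) : T t w =ᵐ[m] S t z := by
  refine ae_eq_of_tendsto_Lp (((T t).continuous.tendsto w).comp
    (tendsto_clipLp ENNReal.ofNat_ne_top w)) (((S t).continuous.tendsto z).comp
    (tendsto_clipLp hp' z)) fun n => hS.2 t _ _ ?_ ?_ ?_
  · refine h1.mono (Lp.aestronglyMeasurable _) ?_
    filter_upwards [coeFn_clipLp n w] with x hx
    rw [hx]; exact abs_clip_le_abs n _
  · refine memLp_top_of_bound (Lp.aestronglyMeasurable _) n ?_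
    filter_upwards [coeFn_clipLp n w] with x hx
    rw [hx]; exact abs_clip_le n _
  · filter_upwards [coeFn_clipLp n w, coeFn_clipLp n z, hwz] with x h1 h2 h3
    rw [h1, h2, h3]

/-- In `L²` the difference quotient at `t` is a limit of averages of `T_s w` with `s ≤ t`. These
averages agree with those of `S_s z`, which are close to `z` in `L^p` by strong continuity. Fatou's
lemma carries that bound over to the difference quotient, although the convergence is known only in
`L²`. -/
theorem IsLpSemigroup.hasGeneratorValue {T : ℝ≥0 → Lp ℝ 2 m →L[ℝ] Lp ℝ 2 m}
    {S : ℝ≥0 → Lp ℝ p m →L[ℝ] Lp ℝ p m} (hT : IsSCContractionSemigroup T) (hS : IsLpSemigroup T S)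
    (hp' : p ≠ ∞) {f g : X → ℝ} (hf1 : MemLp f 1 m) (hfp : MemLp f p m)
    (hg1 : MemLp g 1 m) (hgp : MemLp g p m) (h : HasGeneratorValue T f g) :
    HasGeneratorValue S f g := by
  obtain ⟨u, w, hu, hw, hgen⟩ := h
  refine ⟨hfp.toLp, hgp.toLp, hfp.coeFn_toLp, hgp.coeFn_toLp, ?_⟩
  set v := hfp.toLp
  set z := hgp.toLp
  have huv : ∀ t, T t u =ᵐ[m] S t v := fun t =>
    hS.ae_eq hp' t (hf1.ae_eq hu.symm) (hu.trans hfp.coeFn_toLp.symm)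
  have hwz : ∀ t, T t w =ᵐ[m] S t z := fun t =>
    hS.ae_eq hp' t (hg1.ae_eq hw.symm) (hw.trans hgp.coeFn_toLp.symm)
  have hz := hS.1.strong_continuity z
  rw [IsGeneratorAt, Metric.tendsto_nhds]
  intro ε hε
  obtain ⟨δ, hδ, hball⟩ := Metric.eventually_nhds_iff.1
    (Metric.tendsto_nhds.1 hz (ε / 2) (by positivity))
  have hev : ∀ᶠ t : ℝ≥0 in 𝓝[>] 0, dist t 0 < δ :=
    mem_nhdsWithin_of_mem_nhds (Metric.ball_mem_nhds 0 hδ)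
  filter_upwards [hev, self_mem_nhdsWithin] with t ht (ht0 : 0 < t)
  have hav := (tendsto_average_of_isGeneratorAt hT hgen ht0).sub_const w
  have hsum : ∀ n : ℕ, (((n : ℝ) + 1)⁻¹ • ∑ k ∈ Finset.range (n + 1), T (k * (t / (n + 1))) w - w :
      Lp ℝ 2 m) =ᵐ[m] (((n : ℝ) + 1)⁻¹ • ∑ k ∈ Finset.range (n + 1), S (k * (t / (n + 1))) z - z :
      Lp ℝ p m) := fun n => by
    have h1 : (∑ k ∈ Finset.range (n + 1), T (k * (t / (n + 1))) w : Lp ℝ 2 m) =ᵐ[m]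
        (∑ k ∈ Finset.range (n + 1), S (k * (t / (n + 1))) z : Lp ℝ p m) := by
      generalize n + 1 = N
      generalize (t / ((n : ℝ≥0) + 1)) = s
      induction N with
      | zero => exact (Lp.coeFn_zero ℝ 2 m).trans (Lp.coeFn_zero ℝ p m).symm
      | succ N ih =>
        rw [Finset.sum_range_succ, Finset.sum_range_succ]
        exact (Lp.coeFn_add _ _).trans ((ih.add (hwz _)).trans (Lp.coeFn_add _ _).symm)
    refine (Lp.coeFn_sub _ _).trans (EventuallyEq.trans ?_ (Lp.coeFn_sub _ _).symm)
    refine EventuallyEq.sub ((Lp.coeFn_smul _ _).trans (EventuallyEq.trans ?_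
      (Lp.coeFn_smul _ _).symm)) (hw.trans hgp.coeFn_toLp.symm)
    exact h1.const_smul _
  have hnorm : ∀ n : ℕ, ‖(((n : ℝ) + 1)⁻¹ • ∑ k ∈ Finset.range (n + 1), S (k * (t / (n + 1))) z - z :
      Lp ℝ p m)‖ ≤ ε / 2 := fun n => by
    have hn : (0 : ℝ) < (n : ℝ) + 1 := by positivity
    have e : z = ((n : ℝ) + 1)⁻¹ • ∑ k ∈ Finset.range (n + 1), z := by
      rw [Finset.sum_const, Finset.card_range, ← Nat.cast_smul_eq_nsmul ℝ, smul_smul]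
      push_cast
      rw [inv_mul_cancel₀ hn.ne', one_smul]
    nth_rewrite 2 [e]
    rw [← smul_sub, norm_smul, norm_inv, Real.norm_of_nonneg hn.le, inv_mul_le_iff₀ hn,
      ← Finset.sum_sub_distrib]
    refine (norm_sum_le _ _).trans ((Finset.sum_le_card_nsmul _ _ (ε / 2) fun k hk => ?_).trans_eq ?_)
    · rw [← dist_eq_norm]
      refine (hball ?_).le
      refine lt_of_le_of_lt ?_ ht
      rw [NNReal.dist_eq, NNReal.dist_eq, NNReal.coe_zero, sub_zero, sub_zero,
        abs_of_nonneg (NNReal.coe_nonneg _), abs_of_nonneg (NNReal.coe_nonneg _), NNReal.coe_le_coe]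
      have hk' : (k : ℝ≥0) ≤ n + 1 := by exact_mod_cast (Finset.mem_range.1 hk).le
      calc (k : ℝ≥0) * (t / (n + 1)) ≤ (n + 1) * (t / (n + 1)) := by gcongr
        _ = t := by field_simp
    · rw [Finset.card_range, nsmul_eq_mul]; push_cast; rfl
  -- The limit is taken in `L²` while the norm being bounded is that of `L^p`.
  have hfin : eLpNorm ((t : ℝ)⁻¹ • (T t u - u) - w : Lp ℝ 2 m) p m ≤ ENNReal.ofReal (ε / 2) := by
    refine eLpNorm_le_of_tendsto_Lp hav fun n => ?_
    rw [eLpNorm_congr_ae (hsum n), ← ENNReal.ofReal_toReal (Lp.memLp _).2.ne, ← Lp.norm_def]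
    exact ENNReal.ofReal_le_ofReal (hnorm n)
  have hae : ((t : ℝ)⁻¹ • (T t u - u) - w : Lp ℝ 2 m) =ᵐ[m]
      ((t : ℝ)⁻¹ • (S t v - v) - z : Lp ℝ p m) := by
    refine (Lp.coeFn_sub _ _).trans (EventuallyEq.trans ?_ (Lp.coeFn_sub _ _).symm)
    refine EventuallyEq.sub ((Lp.coeFn_smul _ _).trans (EventuallyEq.trans ?_
      (Lp.coeFn_smul _ _).symm)) (hw.trans hgp.coeFn_toLp.symm)
    refine EventuallyEq.const_smul ((Lp.coeFn_sub _ _).trans (EventuallyEq.trans ?_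
      (Lp.coeFn_sub _ _).symm)) _
    exact (huv t).sub (hu.trans hfp.coeFn_toLp.symm)
  rw [eLpNorm_congr_ae hae] at hfin
  rw [dist_eq_norm, Lp.norm_def]
  exact (ENNReal.toReal_le_of_le_ofReal (by positivity) hfin).trans_lt (by linarith)

end LpSemigroup

/-! ### Mollification with normed bump functions. -/

section Mollification

variable {d : ℕ}

/-- The convolution of `u` with the normed bump function `ψ`. -/
noncomputable def mollify (ψ : ContDiffBump (0 : EuclideanSpace ℝ (Fin d)))
    (u : EuclideanSpace ℝ (Fin d) → ℝ) : EuclideanSpace ℝ (Fin d) → ℝ :=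
  convolution (ψ.normed volume) u (ContinuousLinearMap.lsmul ℝ ℝ) volume

variable {ψ : ContDiffBump (0 : EuclideanSpace ℝ (Fin d))} {u : EuclideanSpace ℝ (Fin d) → ℝ}

theorem mollify_apply (ψ : ContDiffBump (0 : EuclideanSpace ℝ (Fin d)))
    (u : EuclideanSpace ℝ (Fin d) → ℝ) (x : EuclideanSpace ℝ (Fin d)) :
    mollify ψ u x = ∫ t, ψ.normed volume (x - t) * u t := by
  rw [mollify, convolution_eq_swap]; rfl

theorem contDiff_mollify (hu : LocallyIntegrable u) : ContDiff ℝ (⊤ : ℕ∞) (mollify ψ u) :=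
  ψ.hasCompactSupport_normed.contDiff_convolution_left _ ψ.contDiff_normed hu

theorem integrable_mollify_kernel (hu : LocallyIntegrable u) (x : EuclideanSpace ℝ (Fin d)) :
    Integrable fun t => ψ.normed volume (x - t) * u t :=
  (ψ.hasCompactSupport_normed.convolutionExists_left (μ := volume) (ContinuousLinearMap.lsmul ℝ ℝ)
    (ψ.contDiff_normed (n := 0)).continuous hu x).integrable_swap

theorem normed_sub_eq_zero {x t : EuclideanSpace ℝ (Fin d)} (h : ψ.rOut ≤ dist t x) :
    ψ.normed volume (x - t) = 0 := by
  have : x - t ∉ Function.support (ψ.normed volume) := by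
    rw [ψ.support_normed_eq, mem_ball_zero_iff, ← dist_eq_norm, dist_comm]
    exact not_lt.2 h
  simpa using this

theorem integral_normed_sub (ψ : ContDiffBump (0 : EuclideanSpace ℝ (Fin d)))
    (x : EuclideanSpace ℝ (Fin d)) : ∫ t, ψ.normed volume (x - t) = 1 := by
  rw [integral_sub_left_eq_self (fun t => ψ.normed volume t) volume x, ψ.integral_normed]

theorem abs_mollify_le {C : ℝ} (hC : ∀ᵐ t, |u t| ≤ C)
    (x : EuclideanSpace ℝ (Fin d)) : |mollify ψ u x| ≤ C := by
  have hi : Integrable fun t => ψ.normed volume (x - t) :=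
    ((ψ.contDiff_normed (n := 0)).continuous.integrable_of_hasCompactSupport
      ψ.hasCompactSupport_normed).comp_sub_left x
  rw [mollify_apply, ← Real.norm_eq_abs]
  refine (norm_integral_le_of_norm_le (hi.const_mul C) ?_).trans_eq ?_
  · filter_upwards [hC] with t ht
    rw [norm_mul, Real.norm_of_nonneg (ψ.nonneg_normed _), mul_comm]
    exact mul_le_mul_of_nonneg_right ht (ψ.nonneg_normed _)
  · rw [integral_const_mul, integral_normed_sub, mul_one]

theorem mollify_nonneg (hu : ∀ᵐ t, 0 ≤ u t) (x : EuclideanSpace ℝ (Fin d)) :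
    0 ≤ mollify ψ u x := by
  rw [mollify_apply]
  exact integral_nonneg_of_ae (hu.mono fun t ht => mul_nonneg (ψ.nonneg_normed _) ht)

theorem mollify_eq_zero {K : Set (EuclideanSpace ℝ (Fin d))} (hK : ∀ x ∉ K, u x = 0)
    {x : EuclideanSpace ℝ (Fin d)} (hx : x ∉ Metric.cthickening ψ.rOut K) : mollify ψ u x = 0 := by
  rw [mollify_apply]
  refine integral_eq_zero_of_ae (Eventually.of_forall fun t => ?_)
  by_cases ht : t ∈ K
  · have : ψ.rOut ≤ dist t x := by
      by_contra! h
      exact hx (Metric.mem_cthickening_of_dist_le x t _ K ht (by rw [dist_comm]; exact h.le))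
    simp [normed_sub_eq_zero this]
  · simp [hK t ht]

theorem tendsto_mollify_ae {φ : ℕ → ContDiffBump (0 : EuclideanSpace ℝ (Fin d))}
    (h0 : Tendsto (fun n => (φ n).rOut) atTop (𝓝 0)) (h2 : ∀ n, (φ n).rOut ≤ 2 * (φ n).rIn)
    (hu : LocallyIntegrable u) : ∀ᵐ x, Tendsto (fun n => mollify (φ n) u x) atTop (𝓝 (u x)) :=
  ContDiffBump.ae_convolution_tendsto_right_of_locallyIntegrable h0 (Eventually.of_forall h2) hu

/-- A sequence of bump functions with supports in the ball of radius `δ` shrinking to a point. -/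
theorem exists_bump_seq {δ : ℝ} (hδ : 0 < δ) :
    ∃ φ : ℕ → ContDiffBump (0 : EuclideanSpace ℝ (Fin d)),
      Tendsto (fun n => (φ n).rOut) atTop (𝓝 0) ∧ (∀ n, (φ n).rOut ≤ 2 * (φ n).rIn) ∧
      ∀ n, (φ n).rOut ≤ δ := by
  refine ⟨fun n => ⟨δ * (1 / ((n : ℝ) + 1)) / 2, δ * (1 / ((n : ℝ) + 1)), by positivity,
    half_lt_self (by positivity)⟩, ?_, fun n => by simp only; linarith, fun n => ?_⟩
  · simpa using (tendsto_one_div_add_atTop_nhds_zero_nat (𝕜 := ℝ)).const_mul δ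
  · refine mul_le_of_le_one_right hδ.le ?_
    rw [div_le_one (by positivity)]
    simp

/-- Hölder's inequality for mollifications. -/
theorem abs_mollify_rpow_le {q : ℝ} (hq : 1 < q) {g γ ρ : EuclideanSpace ℝ (Fin d) → ℝ}
    (hγ : Integrable γ) (hρ : Integrable ρ) (hγ0 : ∀ᵐ x, 0 ≤ γ x)
    (hρ0 : ∀ᵐ x, 0 ≤ ρ x) (h : ∀ᵐ x, |g x| ≤ γ x ^ (1 / q) * ρ x ^ (1 - 1 / q))
    (x : EuclideanSpace ℝ (Fin d)) :
    |mollify ψ g x| ^ q ≤ mollify ψ γ x * mollify ψ ρ x ^ (q - 1) := by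
  have hq0 : 0 < q := by linarith
  have hconj : q.HolderConjugate (q / (q - 1)) := Real.HolderConjugate.conjExponent hq
  set r := q / (q - 1) with hr
  have hr0 : 0 < r := hconj.symm.pos
  have hr1 : 1 / r = 1 - 1 / q := by rw [hr]; field_simp
  set k : EuclideanSpace ℝ (Fin d) → ℝ := fun t => ψ.normed volume (x - t)
  have hk0 : ∀ t, 0 ≤ k t := fun t => ψ.nonneg_normed _
  have hi1 : Integrable fun t => k t * γ t := integrable_mollify_kernel hγ.locallyIntegrable x
  have hi2 : Integrable fun t => k t * ρ t := integrable_mollify_kernel hρ.locallyIntegrable x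
  have hmem : ∀ {f : EuclideanSpace ℝ (Fin d) → ℝ} {s : ℝ}, 0 < s → (∀ᵐ t, 0 ≤ f t) →
      Integrable f → MemLp (fun t => f t ^ (1 / s)) (ENNReal.ofReal s) := by
    intro f s hs hf0 hf
    have h1 : MemLp f 1 := memLp_one_iff_integrable.2 hf
    have h2 := h1.norm_rpow_div (ENNReal.ofReal (1 / s))
    rw [ENNReal.toReal_ofReal (by positivity), ← ENNReal.ofReal_one,
      ← ENNReal.ofReal_div_of_pos (by positivity), one_div_one_div] at h2
    refine h2.ae_eq ?_
    filter_upwards [hf0] with t ht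
    rw [Real.norm_of_nonneg ht]
  have hkγ0 : ∀ᵐ t, 0 ≤ k t * γ t := hγ0.mono fun t ht => mul_nonneg (hk0 t) ht
  have hkρ0 : ∀ᵐ t, 0 ≤ k t * ρ t := hρ0.mono fun t ht => mul_nonneg (hk0 t) ht
  have m1 := hmem hq0 hkγ0 hi1
  have m2 := hmem hr0 hkρ0 hi2
  have hH := integral_mul_le_Lp_mul_Lq_of_nonneg (μ := volume) hconj
    (hkγ0.mono fun t ht => Real.rpow_nonneg ht _) (hkρ0.mono fun t ht => Real.rpow_nonneg ht _) m1 m2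
  have e1 : ∫ t, ((k t * γ t) ^ (1 / q)) ^ q = mollify ψ γ x := by
    rw [mollify_apply]
    refine integral_congr_ae ?_
    filter_upwards [hkγ0] with t ht
    rw [← Real.rpow_mul ht, one_div_mul_cancel hq0.ne', Real.rpow_one]
  have e2 : ∫ t, ((k t * ρ t) ^ (1 / r)) ^ r = mollify ψ ρ x := by
    rw [mollify_apply]
    refine integral_congr_ae ?_
    filter_upwards [hkρ0] with t ht
    rw [← Real.rpow_mul ht, one_div_mul_cancel hr0.ne', Real.rpow_one]
  rw [e1, e2] at hH
  have hprod : Integrable fun t => (k t * γ t) ^ (1 / q) * (k t * ρ t) ^ (1 / r) :=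
    haveI : ENNReal.HolderConjugate (ENNReal.ofReal q) (ENNReal.ofReal r) := hconj.ennrealOfReal
    MemLp.integrable_mul (p := ENNReal.ofReal q) (q := ENNReal.ofReal r) m1 m2
  have hle : |mollify ψ g x| ≤ mollify ψ γ x ^ (1 / q) * mollify ψ ρ x ^ (1 / r) := by
    refine le_trans ?_ hH
    rw [mollify_apply, ← Real.norm_eq_abs]
    refine norm_integral_le_of_norm_le hprod ?_
    filter_upwards [h, hγ0, hρ0] with t ht h1 h2
    rw [norm_mul, Real.norm_of_nonneg (hk0 t), Real.norm_eq_abs, Real.mul_rpow (hk0 t) h1,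
      Real.mul_rpow (hk0 t) h2]
    -- The kernel is split between the two Hölder factors, so that each factor integrates to a
    -- mollification.
    have e3 : k t = k t ^ (1 / q) * k t ^ (1 / r) := by
      rcases (hk0 t).eq_or_lt with h | h
      · rw [← h, Real.zero_rpow (by positivity), zero_mul]
      · rw [← Real.rpow_add h, hr1, add_sub_cancel, Real.rpow_one]
    calc k t * |g t| ≤ k t * (γ t ^ (1 / q) * ρ t ^ (1 / r)) := by
          rw [hr1]; exact mul_le_mul_of_nonneg_left ht (hk0 t)
      _ = (k t ^ (1 / q) * k t ^ (1 / r)) * (γ t ^ (1 / q) * ρ t ^ (1 / r)) := by rw [← e3]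
      _ = _ := by ring
  have hn1 := mollify_nonneg (ψ := ψ) hγ0 x
  have hn2 := mollify_nonneg (ψ := ψ) hρ0 x
  calc |mollify ψ g x| ^ q ≤ (mollify ψ γ x ^ (1 / q) * mollify ψ ρ x ^ (1 / r)) ^ q := by gcongr
    _ = _ := by
      rw [Real.mul_rpow (by positivity) (by positivity), ← Real.rpow_mul hn1, ← Real.rpow_mul hn2,
        one_div_mul_cancel hq0.ne', Real.rpow_one, hr1]
      congr 2
      field_simp

end Mollification

/-! ### Calculus of weak derivatives. -/

section WeakDerivatives

variable {d : ℕ} {Ω : Opens (EuclideanSpace ℝ (Fin d))} {i : Fin d}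

theorem integrable_mul_of_hasCompactSupport {u φ : EuclideanSpace ℝ (Fin d) → ℝ}
    (hu : LocallyIntegrableOn u Ω volume) (hφ : Continuous φ) (hc : HasCompactSupport φ)
    (hs : tsupport φ ⊆ Ω) : Integrable fun x => u x * φ x := by
  have h1 := (hu.integrableOn_compact_subset hs hc).mul_continuousOn hφ.continuousOn hc
  refine (integrableOn_iff_integrable_of_support_subset ?_).1 h1
  intro x hx
  by_contra h
  exact hx (by simp [image_eq_zero_of_notMem_tsupport h])

theorem continuous_partialDeriv {φ : EuclideanSpace ℝ (Fin d) → ℝ} (hφ : ContDiff ℝ (⊤ : ℕ∞) φ) :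
    Continuous (partialDeriv i φ) :=
  (hφ.continuous_fderiv (by simp)).clm_apply continuous_const

theorem contDiff_partialDeriv {φ : EuclideanSpace ℝ (Fin d) → ℝ} (hφ : ContDiff ℝ (⊤ : ℕ∞) φ) :
    ContDiff ℝ (⊤ : ℕ∞) (partialDeriv i φ) :=
  (hφ.fderiv_right (m := (⊤ : ℕ∞)) (by simp)).clm_apply contDiff_const

theorem tsupport_partialDeriv_subset (φ : EuclideanSpace ℝ (Fin d) → ℝ) :
    tsupport (partialDeriv i φ) ⊆ tsupport φ :=
  (closure_mono fun x hx => by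
    rw [Function.mem_support] at hx ⊢
    exact fun h => hx (by simp [partialDeriv, h])).trans (tsupport_fderiv_subset ℝ)

theorem partialDeriv_mul {f g : EuclideanSpace ℝ (Fin d) → ℝ} {x : EuclideanSpace ℝ (Fin d)}
    (hf : DifferentiableAt ℝ f x) (hg : DifferentiableAt ℝ g x) :
    partialDeriv i (fun y => f y * g y) x = partialDeriv i f x * g x + f x * partialDeriv i g x := by
  rw [partialDeriv, fderiv_fun_mul hf hg]
  simp [partialDeriv]; ring

/-- The `i`-th derivative of a test function. -/
noncomputable def TestFunction.partialDeriv (i : Fin d) (φ : TestFunction Ω ℝ ⊤) : TestFunction Ω ℝ ⊤ :=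
  ⟨_root_.partialDeriv i φ, contDiff_partialDeriv φ.contDiff,
    φ.hasCompactSupport.of_isClosed_subset (isClosed_tsupport _) (tsupport_partialDeriv_subset φ),
    (tsupport_partialDeriv_subset φ).trans φ.tsupport_subset⟩

/-- The product of a test function with a smooth function. -/
noncomputable def TestFunction.mulSmooth (φ : TestFunction Ω ℝ ⊤) (η : EuclideanSpace ℝ (Fin d) → ℝ)
    (hη : ContDiff ℝ (⊤ : ℕ∞) η) : TestFunction Ω ℝ ⊤ :=
  ⟨fun x => φ x * η x, φ.contDiff.mul hη, φ.hasCompactSupport.mul_right,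
    (tsupport_mul_subset_left).trans φ.tsupport_subset⟩

theorem IsWeakPartial.ae_eq {f g g' : EuclideanSpace ℝ (Fin d) → ℝ} (h : IsWeakPartial Ω i f g)
    (h' : IsWeakPartial Ω i f g') :
    g =ᵐ[volume.restrict (Ω : Set (EuclideanSpace ℝ (Fin d)))] g' := by
  have key : ∀ᵐ x, x ∈ (Ω : Set (EuclideanSpace ℝ (Fin d))) → (g - g') x = 0 := by
    refine Ω.isOpen.ae_eq_zero_of_integral_contDiff_smul_eq_zero (h.2.1.sub h'.2.1) ?_
    intro φ hφ hc hs
    have h1 := h.2.2 ⟨φ, hφ, hc, hs⟩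
    have h2 := h'.2.2 ⟨φ, hφ, hc, hs⟩
    rw [h1, neg_inj] at h2
    have i1 := integrable_mul_of_hasCompactSupport h.2.1 hφ.continuous hc hs
    have i2 := integrable_mul_of_hasCompactSupport h'.2.1 hφ.continuous hc hs
    have e : ∀ g : EuclideanSpace ℝ (Fin d) → ℝ, ∫ x in (Ω : Set (EuclideanSpace ℝ (Fin d))),
        g x * φ x = ∫ x, g x * φ x := fun g =>
      setIntegral_eq_integral_of_forall_compl_eq_zero fun x hx => by
        rw [image_eq_zero_of_notMem_tsupport fun h => hx (hs h), mul_zero]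
    have h3 : ∫ x, g x * φ x = ∫ x, g' x * φ x := by rw [← e, ← e]; exact h2
    have h4 : ∀ x, φ x • (g - g') x = g x * φ x - g' x * φ x := fun x => by
      simp only [smul_eq_mul, Pi.sub_apply]; ring
    simp_rw [h4]
    rw [integral_sub i1 i2, h3, sub_self]
  filter_upwards [ae_restrict_of_ae key, ae_restrict_mem Ω.isOpen.measurableSet] with x h1 h2
  exact sub_eq_zero.1 (h1 h2)

theorem isWeakPartial_weakPartial {f : EuclideanSpace ℝ (Fin d) → ℝ}
    (h : ∃ g, IsWeakPartial Ω i f g) : IsWeakPartial Ω i f (weakPartial Ω i f) := by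
  rw [weakPartial, dif_pos h]; exact Classical.choose_spec h

theorem setIntegral_mul_testFunction (u : EuclideanSpace ℝ (Fin d) → ℝ) (φ : TestFunction Ω ℝ ⊤) :
    ∫ x in (Ω : Set (EuclideanSpace ℝ (Fin d))), u x * φ x = ∫ x, u x * φ x :=
  setIntegral_eq_integral_of_forall_compl_eq_zero fun x hx => by
    rw [image_eq_zero_of_notMem_tsupport fun h => hx (φ.tsupport_subset h), mul_zero]

theorem IsWeakPartial.integral_eq {f g : EuclideanSpace ℝ (Fin d) → ℝ} (h : IsWeakPartial Ω i f g)
    (φ : TestFunction Ω ℝ ⊤) : ∫ x, f x * partialDeriv i φ x = -∫ x, g x * φ x := by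
  rw [← setIntegral_mul_testFunction, ← h.2.2 φ]
  exact (setIntegral_mul_testFunction f (φ.partialDeriv i)).symm

/-- The definition for `u`, tested with `φ η`, rearranges into the product rule. -/
theorem IsWeakPartial.mul_smooth {u u' η : EuclideanSpace ℝ (Fin d) → ℝ}
    (h : IsWeakPartial Ω i u u') (hη : ContDiff ℝ (⊤ : ℕ∞) η) :
    IsWeakPartial Ω i (fun x => u x * η x) (fun x => u' x * η x + u x * partialDeriv i η x) := by
  have hΩ := Ω.isOpen.isLocallyClosed
  have hη' := continuous_partialDeriv (i := i) hη
  refine ⟨h.1.mul_continuousOn hη.continuous.continuousOn hΩ,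
    (h.2.1.mul_continuousOn hη.continuous.continuousOn hΩ).add
      (h.1.mul_continuousOn hη'.continuousOn hΩ), fun φ => ?_⟩
  have h1 := h.integral_eq (φ.mulSmooth η hη)
  have h2 : ∀ x, partialDeriv i (φ.mulSmooth η hη) x =
      partialDeriv i φ x * η x + φ x * partialDeriv i η x := fun x =>
    partialDeriv_mul (φ.contDiff.differentiable (by simp) x) (hη.differentiable (by simp) x)
  have i1 : Integrable fun x => u x * (partialDeriv i φ x * η x) :=
    integrable_mul_of_hasCompactSupport h.1 ((φ.partialDeriv i).mulSmooth η hη).continuous ((φ.partialDeriv i).mulSmooth η hη).hasCompactSupport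
    ((φ.partialDeriv i).mulSmooth η hη).tsupport_subset
  have i2 : Integrable fun x => u x * (φ x * partialDeriv i η x) :=
    integrable_mul_of_hasCompactSupport h.1 (φ.mulSmooth _ (contDiff_partialDeriv (i := i) hη)).continuous
    (φ.mulSmooth _ (contDiff_partialDeriv (i := i) hη)).hasCompactSupport
    (φ.mulSmooth _ (contDiff_partialDeriv (i := i) hη)).tsupport_subset
  have i3 : Integrable fun x => u' x * (φ x * η x) :=
    integrable_mul_of_hasCompactSupport h.2.1 (φ.mulSmooth η hη).continuous
    (φ.mulSmooth η hη).hasCompactSupport (φ.mulSmooth η hη).tsupport_subset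
  have e1 : ∫ x, u x * partialDeriv i (φ.mulSmooth η hη) x =
      (∫ x, u x * (partialDeriv i φ x * η x)) + ∫ x, u x * (φ x * partialDeriv i η x) := by
    rw [← integral_add i1 i2]
    exact integral_congr_ae (Eventually.of_forall fun x => by simp only [h2]; ring)
  rw [e1] at h1
  have e2 := setIntegral_mul_testFunction (fun x => u x * η x) (φ.partialDeriv i)
  have e3 := setIntegral_mul_testFunction (fun x => u' x * η x + u x * partialDeriv i η x) φ
  have e4 : ∫ x, (u' x * η x + u x * partialDeriv i η x) * φ x =
      (∫ x, u' x * (φ x * η x)) + ∫ x, u x * (φ x * partialDeriv i η x) := by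
    rw [← integral_add i3 i2]
    exact integral_congr_ae (Eventually.of_forall fun x => by simp only; ring)
  have e5 : ∫ x, u x * η x * (φ.partialDeriv i) x = ∫ x, u x * (partialDeriv i φ x * η x) :=
    integral_congr_ae (Eventually.of_forall fun x => by
      change u x * η x * partialDeriv i φ x = _; ring)
  rw [e3, e4]
  refine e2.trans (e5.trans ?_)
  have e6 : ∫ x, u' x * (φ.mulSmooth η hη) x = ∫ x, u' x * (φ x * η x) := rfl
  rw [e6] at h1
  linarith

/-- The kernel `t ↦ ψ(x - t)` as a test function. -/
noncomputable def kernelTest (ψ : ContDiffBump (0 : EuclideanSpace ℝ (Fin d)))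
    (x : EuclideanSpace ℝ (Fin d)) (hx : Metric.closedBall x ψ.rOut ⊆ Ω) : TestFunction Ω ℝ ⊤ :=
  have hs : tsupport (fun t => ψ.normed volume (x - t)) ⊆ Metric.closedBall x ψ.rOut :=
    closure_minimal (fun t ht => by
      by_contra h
      rw [Metric.mem_closedBall, not_le] at h
      exact ht (normed_sub_eq_zero h.le)) Metric.isClosed_closedBall
  ⟨fun t => ψ.normed volume (x - t), ψ.contDiff_normed.comp (contDiff_const.sub contDiff_id),
    (isCompact_closedBall x ψ.rOut).of_isClosed_subset (isClosed_tsupport _) hs, hs.trans hx⟩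

theorem partialDeriv_kernelTest (ψ : ContDiffBump (0 : EuclideanSpace ℝ (Fin d)))
    {x : EuclideanSpace ℝ (Fin d)} (hx : Metric.closedBall x ψ.rOut ⊆ Ω)
    (t : EuclideanSpace ℝ (Fin d)) :
    partialDeriv i (kernelTest ψ x hx) t = -partialDeriv i (ψ.normed volume) (x - t) := by
  have h1 : HasFDerivAt (fun t => ψ.normed volume (x - t))
      ((fderiv ℝ (ψ.normed volume) (x - t)).comp (-ContinuousLinearMap.id ℝ _)) t :=
    ((ψ.contDiff_normed (n := 1)).differentiable (by simp) (x - t)).hasFDerivAt.comp t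
      ((hasFDerivAt_id t).const_sub x)
  change fderiv ℝ (fun t => ψ.normed volume (x - t)) t _ = _
  rw [h1.fderiv]
  simp [partialDeriv]

theorem partialDeriv_mollify {ψ : ContDiffBump (0 : EuclideanSpace ℝ (Fin d))}
    {u : EuclideanSpace ℝ (Fin d) → ℝ} (hu : LocallyIntegrable u) (x : EuclideanSpace ℝ (Fin d)) :
    partialDeriv i (mollify ψ u) x = ∫ t, partialDeriv i (ψ.normed volume) (x - t) * u t := by
  have hψ1 : ContDiff ℝ 1 (ψ.normed (volume : Measure (EuclideanSpace ℝ (Fin d)))) :=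
    ψ.contDiff_normed (n := 1)
  have h1 := ψ.hasCompactSupport_normed.hasFDerivAt_convolution_left (μ := volume)
    (ContinuousLinearMap.lsmul ℝ ℝ) hψ1 hu x
  have hex := (ψ.hasCompactSupport_normed.fderiv ℝ).convolutionExists_left (μ := volume)
    ((ContinuousLinearMap.lsmul ℝ ℝ : ℝ →L[ℝ] ℝ →L[ℝ] ℝ).precompL (EuclideanSpace ℝ (Fin d)))
    (hψ1.continuous_fderiv (by simp)) hu x
  rw [partialDeriv, mollify, h1.fderiv, convolution_eq_swap,
    ContinuousLinearMap.integral_apply hex.integrable_swap]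
  rfl

/-- The derivative falls on the kernel `t ↦ ψ(x - t)`. As the ball about `x` lies in `K ⊆ Ω`, this
kernel is a test function and does not see the cutoff to `K`, so the weak derivative can be moved
onto `u`. -/
theorem IsWeakPartial.partialDeriv_mollify {u g : EuclideanSpace ℝ (Fin d) → ℝ}
    (h : IsWeakPartial Ω i u g) {K : Set (EuclideanSpace ℝ (Fin d))} (hK : IsCompact K)
    (hKΩ : K ⊆ Ω) {ψ : ContDiffBump (0 : EuclideanSpace ℝ (Fin d))} {x : EuclideanSpace ℝ (Fin d)}
    (hx : Metric.closedBall x ψ.rOut ⊆ K) :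
    partialDeriv i (mollify ψ (K.indicator u)) x = mollify ψ (K.indicator g) x := by
  have hu : Integrable (K.indicator u) :=
    (h.1.integrableOn_compact_subset hKΩ hK).integrable_indicator hK.measurableSet
  rw [_root_.partialDeriv_mollify hu.locallyIntegrable, mollify_apply]
  have h1 := h.integral_eq (kernelTest ψ x (hx.trans hKΩ))
  simp_rw [partialDeriv_kernelTest, mul_neg, integral_neg, neg_inj] at h1
  have hout : ∀ t ∉ K, ψ.rOut < dist t x := fun t ht => by
    by_contra! h; exact ht (hx (Metric.mem_closedBall.2 h))
  have e1 : ∀ t, partialDeriv i (ψ.normed volume) (x - t) * K.indicator u t =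
      u t * partialDeriv i (ψ.normed volume) (x - t) := fun t => by
    by_cases ht : t ∈ K
    · rw [indicator_of_mem ht, mul_comm]
    · rw [indicator_of_notMem ht, mul_zero]
      have : x - t ∉ tsupport (partialDeriv i (ψ.normed volume)) := fun h => by
        have := tsupport_partialDeriv_subset _ h
        rw [ψ.tsupport_normed_eq, mem_closedBall_zero_iff, ← dist_eq_norm, dist_comm] at this
        exact absurd this (not_le.2 (hout t ht))
      rw [image_eq_zero_of_notMem_tsupport this, mul_zero]
  have e2 : ∀ t, ψ.normed volume (x - t) * K.indicator g t =
      g t * kernelTest ψ x (hx.trans hKΩ) t := fun t => by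
    change _ = g t * ψ.normed volume (x - t)
    by_cases ht : t ∈ K
    · rw [indicator_of_mem ht, mul_comm]
    · rw [indicator_of_notMem ht, normed_sub_eq_zero (hout t ht).le, mul_zero, mul_zero]
  simp_rw [e1, e2]
  exact h1

end WeakDerivatives

/-! ### The measure with density `ϱ`. -/

section Density

variable {d : ℕ} {Ω : Opens (EuclideanSpace ℝ (Fin d))} {i : Fin d}
  {ϱ : EuclideanSpace ℝ (Fin d) → ℝ}

theorem ae_densityMeasure_of_ae {P : EuclideanSpace ℝ (Fin d) → Prop}
    (h : ∀ᵐ x ∂(volume.restrict (Ω : Set (EuclideanSpace ℝ (Fin d)))), P x) :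
    ∀ᵐ x ∂(densityMeasure Ω ϱ), P x :=
  (withDensity_absolutelyContinuous _ _).ae_le h

theorem ae_mem_densityMeasure : ∀ᵐ x ∂(densityMeasure Ω ϱ), x ∈ Ω :=
  ae_densityMeasure_of_ae (ae_restrict_mem Ω.isOpen.measurableSet)

/-- `ϱ` is positive almost everywhere and locally integrable on `Ω`. -/
structure IsDensity (Ω : Opens (EuclideanSpace ℝ (Fin d))) (ϱ : EuclideanSpace ℝ (Fin d) → ℝ) :
    Prop where
  pos : ∀ᵐ x ∂(volume.restrict (Ω : Set (EuclideanSpace ℝ (Fin d)))), 0 < ϱ x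
  locallyIntegrableOn : LocallyIntegrableOn ϱ Ω volume

theorem IsDensity.aemeasurable (h : IsDensity Ω ϱ) :
    AEMeasurable (fun x => ENNReal.ofReal (ϱ x))
      (volume.restrict (Ω : Set (EuclideanSpace ℝ (Fin d)))) :=
  h.2.aestronglyMeasurable.aemeasurable.ennreal_ofReal

/-- Positivity of `ϱ` makes `μ` and Lebesgue measure on `Ω` mutually absolutely continuous. -/
theorem IsDensity.ae_of_ae (h : IsDensity Ω ϱ) {P : EuclideanSpace ℝ (Fin d) → Prop}
    (hP : ∀ᵐ x ∂(densityMeasure Ω ϱ), P x) :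
    ∀ᵐ x ∂(volume.restrict (Ω : Set (EuclideanSpace ℝ (Fin d)))), P x :=
  (withDensity_absolutelyContinuous' h.aemeasurable
    (h.1.mono fun _ hx => (ENNReal.ofReal_pos.2 hx).ne')).ae_le hP

theorem IsDensity.integral_eq (h : IsDensity Ω ϱ) (F : EuclideanSpace ℝ (Fin d) → ℝ) :
    ∫ x, F x ∂(densityMeasure Ω ϱ) =
      ∫ x in (Ω : Set (EuclideanSpace ℝ (Fin d))), ϱ x * F x := by
  rw [densityMeasure, integral_withDensity_eq_integral_toReal_smul₀ h.aemeasurable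
    (Eventually.of_forall fun x => ENNReal.ofReal_lt_top)]
  refine integral_congr_ae (h.1.mono fun x hx => ?_)
  simp only [ENNReal.toReal_ofReal hx.le, smul_eq_mul]

theorem IsDensity.measure_lt_top (h : IsDensity Ω ϱ) {K : Set (EuclideanSpace ℝ (Fin d))}
    (hK : IsCompact K) (hKΩ : K ⊆ Ω) : densityMeasure Ω ϱ K < ∞ := by
  rw [densityMeasure, withDensity_apply _ hK.measurableSet,
    Measure.restrict_restrict_of_subset hKΩ]
  have := (h.2.integrableOn_compact_subset hKΩ hK).2
  refine lt_of_le_of_lt (lintegral_mono fun x => ?_) this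
  exact Real.ofReal_le_enorm _

theorem IsDensity.isFiniteMeasure_restrict (h : IsDensity Ω ϱ)
    {K : Set (EuclideanSpace ℝ (Fin d))} (hK : IsCompact K) (hKΩ : K ⊆ Ω) :
    IsFiniteMeasure ((densityMeasure Ω ϱ).restrict K) :=
  ⟨by rw [Measure.restrict_apply_univ]; exact h.measure_lt_top hK hKΩ⟩

instance : SigmaFinite (densityMeasure Ω ϱ) := by
  unfold densityMeasure; infer_instance

theorem IsDensity.measure_pos (h : IsDensity Ω ϱ) {U : Set (EuclideanSpace ℝ (Fin d))}
    (hU : IsOpen U) (hUΩ : U ⊆ Ω) (hne : U.Nonempty) : 0 < densityMeasure Ω ϱ U := by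
  refine pos_iff_ne_zero.2 fun h0 => ?_
  have h1 : ∀ᵐ x ∂(densityMeasure Ω ϱ), x ∉ U := measure_eq_zero_iff_ae_notMem.1 h0
  have h2 := measure_eq_zero_iff_ae_notMem.2 (h.ae_of_ae h1)
  rw [Measure.restrict_apply hU.measurableSet, inter_eq_self_of_subset_left hUΩ] at h2
  exact (hU.measure_pos volume hne).ne' h2

theorem IsDensity.memLp_of_zero_off (h : IsDensity Ω ϱ) {K : Set (EuclideanSpace ℝ (Fin d))}
    (hK : IsCompact K) {q q' : ℝ≥0∞} (hKΩ : K ⊆ Ω)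
    {f : EuclideanSpace ℝ (Fin d) → ℝ} (hf : ∀ x ∉ K, f x = 0)
    (hm : MemLp f q' ((densityMeasure Ω ϱ).restrict K)) (hq : q ≤ q') :
    MemLp f q (densityMeasure Ω ϱ) := by
  have := h.isFiniteMeasure_restrict hK hKΩ
  rw [← indicator_eq_self.2 (show Function.support f ⊆ K from fun x hx => by
    by_contra hxK; exact hx (hf x hxK))]
  exact (memLp_indicator_iff_restrict hK.measurableSet).2 (hm.mono_exponent hq)

theorem IsDensity.memLp_of_continuous (h : IsDensity Ω ϱ) {f : EuclideanSpace ℝ (Fin d) → ℝ}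
    (hf : Continuous f) (hc : HasCompactSupport f) (hs : tsupport f ⊆ Ω) (q : ℝ≥0∞) :
    MemLp f q (densityMeasure Ω ϱ) := by
  obtain ⟨C, hC⟩ := hc.exists_bound_of_continuous hf
  have := h.isFiniteMeasure_restrict hc hs
  exact h.memLp_of_zero_off (q' := q) hc hs (fun x hx => image_eq_zero_of_notMem_tsupport hx)
    (MemLp.of_bound hf.aestronglyMeasurable C (Eventually.of_forall hC)) le_rfl

theorem IsDensity.memLp_testFunction (h : IsDensity Ω ϱ) (f : TestFunction Ω ℝ ⊤) (q : ℝ≥0∞) :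
    MemLp f q (densityMeasure Ω ϱ) :=
  h.memLp_of_continuous f.continuous f.hasCompactSupport f.tsupport_subset q

/-- Functions continuous on `Ω` and almost everywhere equal agree. -/
theorem IsDensity.eqOn_of_ae_eq (h : IsDensity Ω ϱ) {f g : EuclideanSpace ℝ (Fin d) → ℝ}
    (hf : ContinuousOn f Ω) (hg : ContinuousOn g Ω) (hfg : f =ᵐ[densityMeasure Ω ϱ] g) :
    EqOn f g Ω := by
  intro x hx
  by_contra hne
  have hU : IsOpen {y | y ∈ (Ω : Set (EuclideanSpace ℝ (Fin d))) ∧ f y - g y ∈ ({0}ᶜ : Set ℝ)} :=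
    (hf.sub hg).isOpen_inter_preimage Ω.isOpen isOpen_compl_singleton
  refine (h.measure_pos hU (fun y hy => hy.1) ⟨x, hx, sub_ne_zero.2 hne⟩).ne' ?_
  exact measure_mono_null (fun y hy => fun heq => hy.2 (sub_eq_zero.2 heq)) hfg

end Density

/-! ### Integration by parts against bounded weakly differentiable functions. -/

section IntegrationByParts

variable {d : ℕ} {Ω : Opens (EuclideanSpace ℝ (Fin d))} {i : Fin d}

theorem MemLpLoc.exists_bound {m : Measure (EuclideanSpace ℝ (Fin d))}
    {f : EuclideanSpace ℝ (Fin d) → ℝ} (hf : MemLpLoc Ω m ∞ f)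
    {K : Set (EuclideanSpace ℝ (Fin d))} (hK : IsCompact K) (hKΩ : K ⊆ Ω) :
    ∃ C : ℝ, ∀ᵐ x ∂m, x ∈ K → |f x| ≤ C := by
  have h := hf K hK hKΩ
  have h2 := h.2
  rw [eLpNorm_exponent_top] at h2
  refine ⟨(eLpNormEssSup f (m.restrict K)).toReal, (ae_restrict_iff' hK.measurableSet).1 ?_⟩
  filter_upwards [ae_le_eLpNormEssSup (f := f) (μ := m.restrict K)] with x hx
  rw [← Real.norm_eq_abs, ← toReal_enorm]
  exact ENNReal.toReal_mono h2.ne hx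

/-- Integration by parts against a bounded, compactly supported, weakly differentiable function
with bounded derivative. -/
theorem IsWeakPartial.integral_mul_eq {u u' k k' : EuclideanSpace ℝ (Fin d) → ℝ}
    (hu : IsWeakPartial Ω i u u') (hk : IsWeakPartial Ω i k k')
    {K : Set (EuclideanSpace ℝ (Fin d))} (hK : IsCompact K) (hKΩ : K ⊆ Ω) {C : ℝ}
    (hC : ∀ᵐ x, x ∈ K → |k x| ≤ C) (hC' : ∀ᵐ x, x ∈ K → |k' x| ≤ C)
    (h0 : ∀ x ∉ K, k x = 0) (h0' : ∀ x ∉ K, k' x = 0) :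
    ∫ x, u x * k' x = -∫ x, u' x * k x := by
  wlog hC0 : 0 ≤ C generalizing C
  · refine this (C := |C|) (hC.mono fun x hx h => (hx h).trans (le_abs_self _))
      (hC'.mono fun x hx h => (hx h).trans (le_abs_self _)) (abs_nonneg _)
  obtain ⟨δ, hδ, hδΩ⟩ := hK.exists_cthickening_subset_open Ω.isOpen hKΩ
  -- Two layers are needed: mollifications at scale `δ / 2` are supported in `K₁`, and at points of
  -- `K₁` the kernel still lives in `K₂ ⊆ Ω`, where derivative and mollification commute.
  set K₁ := Metric.cthickening (δ / 2) K
  set K₂ := Metric.cthickening δ K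
  have hK₁ : IsCompact K₁ := hK.cthickening
  have hK₂ : IsCompact K₂ := hK.cthickening
  have hKK₂ : K ⊆ K₂ := Metric.self_subset_cthickening _
  have hK₁Ω : K₁ ⊆ Ω := (Metric.cthickening_mono (half_le_self hδ.le) _).trans hδΩ
  have hball : ∀ x ∈ K₁, ∀ r ≤ δ / 2, Metric.closedBall x r ⊆ K₂ := by
    intro x hx r hr y hy
    have := Metric.cthickening_cthickening_subset (half_pos hδ).le (half_pos hδ).le K
    rw [add_halves] at this
    exact this (Metric.mem_cthickening_of_dist_le y x _ _ hx (hy.trans hr))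
  obtain ⟨ψ, hψ0, hψ2, hψδ⟩ := exists_bump_seq (d := d) (half_pos hδ)
  have hind : ∀ {f : EuclideanSpace ℝ (Fin d) → ℝ}, (∀ x ∉ K, f x = 0) → K₂.indicator f = f := by
    intro f hf
    exact indicator_eq_self.2 fun x hx => hKK₂ (by by_contra h; exact hx (hf x h))
  have hbd : ∀ {f : EuclideanSpace ℝ (Fin d) → ℝ}, (∀ x ∉ K, f x = 0) →
      (∀ᵐ x, x ∈ K → |f x| ≤ C) → ∀ᵐ x, |f x| ≤ C := by
    intro f hf h
    filter_upwards [h] with x hx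
    by_cases hxK : x ∈ K
    · exact hx hxK
    · rw [hf x hxK, abs_zero]; exact hC0
  have hki : Integrable k := by
    rw [← hind h0]
    exact (hk.1.integrableOn_compact_subset hδΩ hK₂).integrable_indicator hK₂.measurableSet
  have hki' : Integrable k' := by
    rw [← hind h0']
    exact (hk.2.1.integrableOn_compact_subset hδΩ hK₂).integrable_indicator hK₂.measurableSet
  have hoff : ∀ {f : EuclideanSpace ℝ (Fin d) → ℝ}, (∀ x ∉ K, f x = 0) → ∀ n, ∀ x ∉ K₁,
      mollify (ψ n) f x = 0 := fun hf n x hx =>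
    mollify_eq_zero hf fun h => hx (Metric.cthickening_mono (hψδ n) _ h)
  have hts : ∀ n, tsupport (mollify (ψ n) k) ⊆ K₁ := fun n =>
    closure_minimal (fun x hx => by by_contra h; exact hx (hoff h0 n x h)) hK₁.isClosed
  let φ : ℕ → TestFunction Ω ℝ ⊤ := fun n => ⟨mollify (ψ n) k,
    contDiff_mollify hki.locallyIntegrable,
    hK₁.of_isClosed_subset (isClosed_tsupport _) (hts n), (hts n).trans hK₁Ω⟩
  have hφ : ∀ n x, φ n x = mollify (ψ n) k x := fun n x => rfl
  have hdφ : ∀ n x, partialDeriv i (φ n) x = mollify (ψ n) k' x := by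
    intro n x
    by_cases hx : x ∈ K₁
    · have := hk.partialDeriv_mollify hK₂ hδΩ (hball x hx _ (hψδ n))
      rwa [hind h0, hind h0'] at this
    · rw [hoff h0' n x hx]
      exact image_eq_zero_of_notMem_tsupport fun h => hx (hts n (tsupport_partialDeriv_subset _ h))
  -- Mollifications of `k` and `k'` converge almost everywhere and keep the bound `C`, so dominated
  -- convergence applies with `|v| * C` on `K₁` even though `v` is merely locally integrable.
  have key : ∀ {v f : EuclideanSpace ℝ (Fin d) → ℝ}, LocallyIntegrableOn v Ω volume →
      Integrable f → (∀ x ∉ K, f x = 0) → (∀ᵐ x, x ∈ K → |f x| ≤ C) →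
      Tendsto (fun n => ∫ x, v x * mollify (ψ n) f x) atTop (𝓝 (∫ x, v x * f x)) := by
    intro v f hv hf hf0 hfC
    have hvK : IntegrableOn v K₁ := hv.integrableOn_compact_subset hK₁Ω hK₁
    have hw : ∀ n, (fun x => v x * mollify (ψ n) f x) =
        fun x => K₁.indicator v x * mollify (ψ n) f x := fun n => funext fun x => by
      by_cases hx : x ∈ K₁
      · rw [indicator_of_mem hx]
      · rw [hoff hf0 n x hx, mul_zero, mul_zero]
    refine tendsto_integral_of_dominated_convergence (fun x => K₁.indicator (fun x => |v x| * C) x)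
      (fun n => ?_) ((integrable_indicator_iff hK₁.measurableSet).2 (hvK.abs.mul_const C)) (fun n => ?_) ?_
    · rw [hw]
      exact (hvK.integrable_indicator hK₁.measurableSet).aestronglyMeasurable.mul
        (contDiff_mollify hf.locallyIntegrable).continuous.aestronglyMeasurable
    · refine Eventually.of_forall fun x => ?_
      by_cases hx : x ∈ K₁
      · rw [indicator_of_mem hx, norm_mul]
        exact mul_le_mul_of_nonneg_left (abs_mollify_le (hbd hf0 hfC) x) (abs_nonneg _)
      · rw [hoff hf0 n x hx, mul_zero, indicator_of_notMem hx, norm_zero]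
    · filter_upwards [tendsto_mollify_ae hψ0 hψ2 hf.locallyIntegrable] with x hx
      exact hx.const_mul _
  have h1 := key hu.1 hki' h0' hC'
  have h2 := (key hu.2.1 hki h0 hC).neg
  refine tendsto_nhds_unique h1 (h2.congr fun n => ?_)
  have := hu.integral_eq (φ n)
  simp_rw [hdφ, hφ] at this
  exact this.symm

theorem IsWeakPartial.congr_left {u v g : EuclideanSpace ℝ (Fin d) → ℝ}
    (h : IsWeakPartial Ω i u g)
    (huv : u =ᵐ[volume.restrict (Ω : Set (EuclideanSpace ℝ (Fin d)))] v) :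
    IsWeakPartial Ω i v g := by
  refine ⟨?_, h.2.1, fun φ => ?_⟩
  · rw [locallyIntegrableOn_iff Ω.isOpen.isLocallyClosed]
    intro K hK hKc
    exact (h.1.integrableOn_compact_subset hK hKc).congr (ae_restrict_of_ae_restrict_of_subset hK huv)
  · rw [← h.2.2 φ]
    exact integral_congr_ae (huv.mono fun x hx => by simp only [hx])

end IntegrationByParts

/-! ### Functions essentially bounded on a set. -/

section EssentialBounds

variable {d : ℕ} {K : Set (EuclideanSpace ℝ (Fin d))} {f g : EuclideanSpace ℝ (Fin d) → ℝ}

/-- `f` is essentially bounded on `K` for the Lebesgue measure. -/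
def AEBddOn (K : Set (EuclideanSpace ℝ (Fin d))) (f : EuclideanSpace ℝ (Fin d) → ℝ) : Prop :=
  ∃ C : ℝ, ∀ᵐ x, x ∈ K → |f x| ≤ C

theorem AEBddOn.add (hf : AEBddOn K f) (hg : AEBddOn K g) : AEBddOn K fun x => f x + g x := by
  obtain ⟨C, hC⟩ := hf
  obtain ⟨D, hD⟩ := hg
  refine ⟨C + D, ?_⟩
  filter_upwards [hC, hD] with x h1 h2 hx
  exact (abs_add_le _ _).trans (add_le_add (h1 hx) (h2 hx))

theorem AEBddOn.mul (hf : AEBddOn K f) (hg : AEBddOn K g) : AEBddOn K fun x => f x * g x := by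
  obtain ⟨C, hC⟩ := hf
  obtain ⟨D, hD⟩ := hg
  refine ⟨C * D, ?_⟩
  filter_upwards [hC, hD] with x h1 h2 hx
  rw [abs_mul]
  exact mul_le_mul (h1 hx) (h2 hx) (abs_nonneg _) ((abs_nonneg _).trans (h1 hx))

theorem AEBddOn.of_continuous (hf : Continuous f) (hc : HasCompactSupport f) : AEBddOn K f := by
  obtain ⟨C, hC⟩ := hc.exists_bound_of_continuous hf
  exact ⟨C, Eventually.of_forall fun x _ => hC x⟩

theorem AEBddOn.testFunction {Ω : Opens (EuclideanSpace ℝ (Fin d))} (φ : TestFunction Ω ℝ ⊤) :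
    AEBddOn K φ :=
  .of_continuous φ.continuous φ.hasCompactSupport

theorem AEBddOn.partialDeriv {Ω : Opens (EuclideanSpace ℝ (Fin d))} (φ : TestFunction Ω ℝ ⊤)
    (i : Fin d) : AEBddOn K (partialDeriv i φ) :=
  .testFunction (φ.partialDeriv i)

theorem AEBddOn.sum {ι : Type*} (s : Finset ι) {F : ι → EuclideanSpace ℝ (Fin d) → ℝ}
    (hF : ∀ i, AEBddOn K (F i)) : AEBddOn K fun x => ∑ i ∈ s, F i x := by
  classical
  induction s using Finset.induction_on with
  | empty => exact ⟨0, Eventually.of_forall fun x _ => by simp⟩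
  | insert i s hi ih => simp_rw [Finset.sum_insert hi]; exact (hF i).add ih

end EssentialBounds

/-! ### The generator on test functions and Green's formula. -/

section EllipticConditions

variable {d : ℕ} {Ω : Opens (EuclideanSpace ℝ (Fin d))} {i j : Fin d}
  {A : EuclideanSpace ℝ (Fin d) → Matrix (Fin d) (Fin d) ℝ}
  {ϱ : EuclideanSpace ℝ (Fin d) → ℝ} {p : ℝ≥0∞}

theorem ae_densityMeasure_of_ae_volume {P : EuclideanSpace ℝ (Fin d) → Prop}
    (hP : ∀ᵐ x, P x) : ∀ᵐ x ∂(densityMeasure Ω ϱ), P x :=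
  ae_densityMeasure_of_ae (ae_restrict_of_ae hP)

theorem IsDensity.memLp_of_aebddOn (h : IsDensity Ω ϱ) {K : Set (EuclideanSpace ℝ (Fin d))}
    (hK : IsCompact K) (hKΩ : K ⊆ Ω) {f : EuclideanSpace ℝ (Fin d) → ℝ} (hf : AEBddOn K f)
    (hm : AEStronglyMeasurable f (volume.restrict (Ω : Set (EuclideanSpace ℝ (Fin d)))))
    (q : ℝ≥0∞) : MemLp f q ((densityMeasure Ω ϱ).restrict K) := by
  have := h.isFiniteMeasure_restrict hK hKΩ
  obtain ⟨C, hC⟩ := hf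
  refine MemLp.of_bound (hm.mono_ac (withDensity_absolutelyContinuous _ _)).restrict C ?_
  rw [ae_restrict_iff' hK.measurableSet]
  exact ae_densityMeasure_of_ae_volume hC

namespace EllipticConditions

/-- Local integrability holds because `ϱ` is the square of the locally square integrable `√ϱ`. -/
theorem isDensity (h : EllipticConditions Ω A ϱ p) : IsDensity Ω ϱ := by
  refine ⟨h.density_pos, ?_⟩
  rw [locallyIntegrableOn_iff Ω.isOpen.isLocallyClosed]
  intro K hK hKc
  refine (h.sqrt_density.1 K hKc hK).integrable_sq.congr ?_
  filter_upwards [ae_restrict_of_ae_restrict_of_subset hK h.density_pos] with x hx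
  exact Real.sq_sqrt hx.le

theorem isWeakPartial_density (h : EllipticConditions Ω A ϱ p) (i : Fin d) :
    IsWeakPartial Ω i ϱ (weakPartial Ω i ϱ) :=
  isWeakPartial_weakPartial ((h.log_gradient i).imp fun _ h => h.1)

/-- The chosen weak derivative and the one supplied by the hypothesis agree almost everywhere. -/
theorem memLpLoc_logPartial (h : EllipticConditions Ω A ϱ p) (i : Fin d) :
    MemLpLoc Ω (densityMeasure Ω ϱ) p (logPartial Ω ϱ i) := by
  obtain ⟨g, hg, hgp⟩ := h.log_gradient i
  intro K hK hKΩ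
  refine (hgp K hK hKΩ).ae_eq ?_
  filter_upwards [ae_restrict_of_ae
    (ae_densityMeasure_of_ae (ϱ := ϱ) (hg.ae_eq (h.isWeakPartial_density i)))] with x hx
  rw [hx, logPartial]

theorem aestronglyMeasurable_coeff (h : EllipticConditions Ω A ϱ p) (i j : Fin d) :
    AEStronglyMeasurable (fun x => A x i j)
      (volume.restrict (Ω : Set (EuclideanSpace ℝ (Fin d)))) :=
  let ⟨_, hg, _⟩ := (h.coeff i j).2 i
  hg.1.aestronglyMeasurable

theorem isWeakPartial_coeff (h : EllipticConditions Ω A ϱ p) (k i j : Fin d) :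
    IsWeakPartial Ω k (fun x => A x i j) (weakPartial Ω k fun x => A x i j) :=
  isWeakPartial_weakPartial (((h.coeff i j).2 k).imp fun _ h => h.1)

theorem aebddOn_coeff (h : EllipticConditions Ω A ϱ p) (i j : Fin d)
    {K : Set (EuclideanSpace ℝ (Fin d))} (hK : IsCompact K) (hKΩ : K ⊆ Ω) :
    AEBddOn K fun x => A x i j :=
  (h.coeff i j).1.exists_bound hK hKΩ

theorem aebddOn_weakPartial_coeff (h : EllipticConditions Ω A ϱ p) (k i j : Fin d)
    {K : Set (EuclideanSpace ℝ (Fin d))} (hK : IsCompact K) (hKΩ : K ⊆ Ω) :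
    AEBddOn K (weakPartial Ω k fun x => A x i j) := by
  obtain ⟨g, hg, hgp⟩ := (h.coeff i j).2 k
  obtain ⟨C, hC⟩ := hgp.exists_bound hK hKΩ
  refine ⟨C, ?_⟩
  have := (ae_restrict_iff' Ω.isOpen.measurableSet).1 (hg.ae_eq (h.isWeakPartial_coeff k i j))
  filter_upwards [hC, this] with x h1 h2 hx
  rw [← h2 (hKΩ hx)]
  exact h1 hx

end EllipticConditions

/-- The `i`-th derivative of `a_{ij} ∂_j f`, by the product rule. -/
noncomputable def fluxPartial (Ω : Opens (EuclideanSpace ℝ (Fin d)))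
    (A : EuclideanSpace ℝ (Fin d) → Matrix (Fin d) (Fin d) ℝ) (i j : Fin d)
    (f : EuclideanSpace ℝ (Fin d) → ℝ) (x : EuclideanSpace ℝ (Fin d)) : ℝ :=
  weakPartial Ω i (fun y => A y i j) x * partialDeriv j f x +
    A x i j * partialDeriv i (partialDeriv j f) x

/-- The summands of the generator, with the product rule applied. -/
noncomputable def generatorTerm (Ω : Opens (EuclideanSpace ℝ (Fin d)))
    (A : EuclideanSpace ℝ (Fin d) → Matrix (Fin d) (Fin d) ℝ) (ϱ : EuclideanSpace ℝ (Fin d) → ℝ)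
    (i j : Fin d) (f : EuclideanSpace ℝ (Fin d) → ℝ) (x : EuclideanSpace ℝ (Fin d)) : ℝ :=
  fluxPartial Ω A i j f x + logPartial Ω ϱ i x * (A x i j * partialDeriv j f x)

theorem partialDeriv_eq_zero_of_notMem (f : EuclideanSpace ℝ (Fin d) → ℝ)
    {x : EuclideanSpace ℝ (Fin d)} (hx : x ∉ tsupport f) : partialDeriv i f x = 0 :=
  image_eq_zero_of_notMem_tsupport fun h => hx (tsupport_partialDeriv_subset f h)

theorem fluxPartial_eq_zero_of_notMem (f : EuclideanSpace ℝ (Fin d) → ℝ)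
    {x : EuclideanSpace ℝ (Fin d)} (hx : x ∉ tsupport f) : fluxPartial Ω A i j f x = 0 := by
  rw [fluxPartial, partialDeriv_eq_zero_of_notMem f hx, partialDeriv_eq_zero_of_notMem
    (i := i) (partialDeriv j f) (fun h => hx (tsupport_partialDeriv_subset f h))]
  simp

theorem generatorTerm_eq_zero_of_notMem (f : EuclideanSpace ℝ (Fin d) → ℝ)
    {x : EuclideanSpace ℝ (Fin d)} (hx : x ∉ tsupport f) : generatorTerm Ω A ϱ i j f x = 0 := by
  rw [generatorTerm, fluxPartial_eq_zero_of_notMem f hx, partialDeriv_eq_zero_of_notMem f hx]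
  simp

namespace EllipticConditions

variable (h : EllipticConditions Ω A ϱ p)
include h

theorem isWeakPartial_flux (f : TestFunction Ω ℝ ⊤) (i j : Fin d) :
    IsWeakPartial Ω i (fun x => A x i j * partialDeriv j f x) (fluxPartial Ω A i j f) :=
  (h.isWeakPartial_coeff i i j).mul_smooth (f.partialDeriv j).contDiff

theorem aebddOn_fluxPartial (f : TestFunction Ω ℝ ⊤) (i j : Fin d)
    {K : Set (EuclideanSpace ℝ (Fin d))} (hK : IsCompact K) (hKΩ : K ⊆ Ω) :
    AEBddOn K (fluxPartial Ω A i j f) :=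
  ((h.aebddOn_weakPartial_coeff i i j hK hKΩ).mul (.partialDeriv f j)).add
    ((h.aebddOn_coeff i j hK hKΩ).mul (.partialDeriv (f.partialDeriv j) i))

theorem memLp_fluxPartial (f : TestFunction Ω ℝ ⊤) (i j : Fin d) (q : ℝ≥0∞) :
    MemLp (fluxPartial Ω A i j f) q ((densityMeasure Ω ϱ).restrict (tsupport f)) :=
  h.isDensity.memLp_of_aebddOn f.hasCompactSupport f.tsupport_subset
    (h.aebddOn_fluxPartial f i j f.hasCompactSupport f.tsupport_subset)
    (h.isWeakPartial_flux f i j).2.1.aestronglyMeasurable q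

theorem memLp_logPartial_mul (f : TestFunction Ω ℝ ⊤) (i j : Fin d) :
    MemLp (fun x => logPartial Ω ϱ i x * (A x i j * partialDeriv j f x)) p
      ((densityMeasure Ω ϱ).restrict (tsupport f)) := by
  have h1 := h.memLpLoc_logPartial i _ f.hasCompactSupport f.tsupport_subset
  obtain ⟨C, hC⟩ := (h.aebddOn_coeff i j f.hasCompactSupport f.tsupport_subset).mul
    (.partialDeriv f j)
  refine MemLp.of_le_mul (c := C) h1 (h1.1.mul ?_) ?_
  · exact ((h.isWeakPartial_flux f i j).1.aestronglyMeasurable.mono_ac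
      (withDensity_absolutelyContinuous _ _)).restrict
  · rw [ae_restrict_iff' f.hasCompactSupport.measurableSet]
    filter_upwards [ae_densityMeasure_of_ae_volume hC] with x hx hxK
    rw [norm_mul, mul_comm]
    exact mul_le_mul_of_nonneg_right (hx hxK) (norm_nonneg _)

/-- The flux derivative is bounded on the support of `f`; only the logarithmic derivative limits the
integrability, to the exponent `p`. The compact support has finite measure, which lowers the
exponent. -/
theorem memLp_generatorTerm (f : TestFunction Ω ℝ ⊤) (i j : Fin d) {q : ℝ≥0∞} (hq : q ≤ p) :
    MemLp (generatorTerm Ω A ϱ i j f) q (densityMeasure Ω ϱ) :=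
  h.isDensity.memLp_of_zero_off f.hasCompactSupport f.tsupport_subset
    (fun _ hx => generatorTerm_eq_zero_of_notMem f hx)
    ((h.memLp_fluxPartial f i j p).add (h.memLp_logPartial_mul f i j)) hq

theorem divergenceGenerator_ae_eq (f : TestFunction Ω ℝ ⊤) :
    divergenceGenerator Ω A ϱ f =ᵐ[densityMeasure Ω ϱ]
      fun x => ∑ i, ∑ j, generatorTerm Ω A ϱ i j f x := by
  have h1 : ∀ i j, ∀ᵐ x ∂(densityMeasure Ω ϱ),
      weakPartial Ω i (fun y => A y i j * partialDeriv j f y) x = fluxPartial Ω A i j f x :=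
    fun i j => ae_densityMeasure_of_ae
      ((isWeakPartial_weakPartial ⟨_, h.isWeakPartial_flux f i j⟩).ae_eq (h.isWeakPartial_flux f i j))
  filter_upwards [ae_all_iff.2 fun i => ae_all_iff.2 (h1 i)] with x hx
  refine Finset.sum_congr rfl fun i _ => Finset.sum_congr rfl fun j _ => ?_
  rw [hx, generatorTerm, mul_assoc]

theorem memLp_divergenceGenerator (f : TestFunction Ω ℝ ⊤) {q : ℝ≥0∞} (hq : q ≤ p) :
    MemLp (divergenceGenerator Ω A ϱ f) q (densityMeasure Ω ϱ) :=
  (memLp_congr_ae (h.divergenceGenerator_ae_eq f)).2 <|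
    memLp_finsetSum _ fun i _ => memLp_finsetSum _ fun j _ => h.memLp_generatorTerm f i j hq

/-- Product rule for `∂_i(a_ij ∂_j f)`, then an exchange of `i` and `j` in the first-order terms.
The symmetry of `A` passes to its weak derivatives by their uniqueness. -/
theorem divergenceGenerator_ae_eq_driftGenerator (f : TestFunction Ω ℝ ⊤) :
    divergenceGenerator Ω A ϱ f =ᵐ[densityMeasure Ω ϱ] driftGenerator Ω A ϱ f := by
  have h1 : ∀ i j, ∀ᵐ x ∂(densityMeasure Ω ϱ),
      weakPartial Ω i (fun y => A y i j) x = weakPartial Ω i (fun y => A y j i) x := fun i j =>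
    ae_densityMeasure_of_ae (((h.isWeakPartial_coeff i i j).congr_left
      (h.symmetric.mono fun x hx => hx.apply j i)).ae_eq (h.isWeakPartial_coeff i j i))
  filter_upwards [h.divergenceGenerator_ae_eq f, ae_all_iff.2 fun i => ae_all_iff.2 (h1 i),
    ae_densityMeasure_of_ae h.symmetric] with x hx hs hA
  rw [hx, driftGenerator]
  simp only [driftCoeff, generatorTerm, fluxPartial, Finset.sum_mul, Finset.sum_add_distrib, add_mul]
  have e1 : ∑ i, ∑ j, weakPartial Ω i (fun y => A y i j) x * partialDeriv j f x =
      ∑ i, ∑ j, weakPartial Ω j (fun y => A y i j) x * partialDeriv i f x := by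
    rw [Finset.sum_comm]
    exact Finset.sum_congr rfl fun i _ => Finset.sum_congr rfl fun j _ => by rw [hs]
  have e2 : ∑ i, ∑ j, logPartial Ω ϱ i x * (A x i j * partialDeriv j f x) =
      ∑ i, ∑ j, logPartial Ω ϱ j x * A x i j * partialDeriv i f x := by
    rw [Finset.sum_comm]
    exact Finset.sum_congr rfl fun i _ => Finset.sum_congr rfl fun j _ => by
      rw [hA.apply i j, mul_assoc]
  rw [e1, e2]
  ring

theorem memLp_one_coeff_mul (f g : TestFunction Ω ℝ ⊤) (i j : Fin d) :
    MemLp (fun x => A x i j * partialDeriv j f x * g x) 1 (densityMeasure Ω ϱ) :=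
  h.isDensity.memLp_of_zero_off (q' := 1) g.hasCompactSupport g.tsupport_subset
    (fun x hx => by simp only [image_eq_zero_of_notMem_tsupport hx, mul_zero])
    (h.isDensity.memLp_of_aebddOn g.hasCompactSupport g.tsupport_subset
      (((h.aebddOn_coeff i j g.hasCompactSupport g.tsupport_subset).mul (.partialDeriv f j)).mul
        (.testFunction g)) (((h.aestronglyMeasurable_coeff i j).mul
          (f.partialDeriv j).continuous.aestronglyMeasurable).mul
            g.continuous.aestronglyMeasurable) 1) le_rfl

theorem integrable_gradientTerm (f g : TestFunction Ω ℝ ⊤) (i j : Fin d) :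
    Integrable (fun x => A x i j * partialDeriv i f x * partialDeriv j g x)
      (densityMeasure Ω ϱ) := by
  refine (memLp_one_iff_integrable.1 (h.memLp_one_coeff_mul g (f.partialDeriv i) i j)).congr ?_
  refine Eventually.of_forall fun x => ?_
  change A x i j * partialDeriv j g x * partialDeriv i f x = _
  ring

theorem integrable_gradientDensity (f g : TestFunction Ω ℝ ⊤) :
    Integrable (gradientDensity A f g) (densityMeasure Ω ϱ) :=
  integrable_finsetSum _ fun i _ => integrable_finsetSum _ fun j _ =>
    h.integrable_gradientTerm f g i j

/-- Integration by parts of `ϱ` against `a_ij ∂_j f g`, which is bounded with bounded derivative and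
supported in the support of `g`. The derivative hitting `ϱ` is rewritten as `ϱ` times the
logarithmic derivative. -/
theorem integral_gradientTerm (hp : 1 ≤ p) (f g : TestFunction Ω ℝ ⊤) (i j : Fin d) :
    ∫ x, A x i j * partialDeriv i g x * partialDeriv j f x ∂(densityMeasure Ω ϱ) =
      -∫ x, generatorTerm Ω A ϱ i j f x * g x ∂(densityMeasure Ω ϱ) := by
  have hgc := g.hasCompactSupport
  have hgs := g.tsupport_subset
  have hk := (h.isWeakPartial_flux f i j).mul_smooth (i := i) g.contDiff
  have hkb := ((h.aebddOn_coeff i j hgc hgs).mul (.partialDeriv f j)).mul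
    (AEBddOn.testFunction (K := tsupport g) g)
  have hkb' := ((h.aebddOn_fluxPartial f i j hgc hgs).mul (.testFunction g)).add
    (((h.aebddOn_coeff i j hgc hgs).mul (.partialDeriv f j)).mul (.partialDeriv g i))
  obtain ⟨C, hC⟩ := hkb
  obtain ⟨C', hC'⟩ := hkb'
  have h1 := (h.isWeakPartial_density i).integral_mul_eq hk hgc hgs (C := max C C')
    (hC.mono fun x hx h => (hx h).trans (le_max_left _ _))
    (hC'.mono fun x hx h => (hx h).trans (le_max_right _ _))
    (fun x hx => by rw [image_eq_zero_of_notMem_tsupport hx, mul_zero])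
    (fun x hx => by rw [image_eq_zero_of_notMem_tsupport hx, partialDeriv_eq_zero_of_notMem g hx,
      mul_zero, mul_zero, add_zero])
  have hoff : ∀ F : EuclideanSpace ℝ (Fin d) → ℝ, (∀ x ∉ tsupport g, F x = 0) →
      ∫ x in (Ω : Set (EuclideanSpace ℝ (Fin d))), F x = ∫ x, F x := fun F hF =>
    setIntegral_eq_integral_of_forall_compl_eq_zero fun x hx => hF x fun h => hx (hgs h)
  rw [← hoff _ (fun x hx => by rw [image_eq_zero_of_notMem_tsupport hx,
      partialDeriv_eq_zero_of_notMem g hx]; simp), ← h.isDensity.integral_eq, ← hoff _ (fun x hx => by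
      rw [image_eq_zero_of_notMem_tsupport hx]; simp)] at h1
  have h2 : ∫ x in (Ω : Set (EuclideanSpace ℝ (Fin d))),
      weakPartial Ω i ϱ x * (A x i j * partialDeriv j f x * g x) =
      ∫ x, logPartial Ω ϱ i x * (A x i j * partialDeriv j f x) * g x ∂(densityMeasure Ω ϱ) := by
    rw [h.isDensity.integral_eq]
    refine integral_congr_ae (h.density_pos.mono fun x hx => ?_)
    simp only [logPartial]
    field_simp
  have hg1 : ∀ {F : EuclideanSpace ℝ (Fin d) → ℝ}, MemLp F 1 (densityMeasure Ω ϱ) →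
      Integrable (fun x => F x * g x) (densityMeasure Ω ϱ) := by
    intro F hF
    exact memLp_one_iff_integrable.1 ((h.isDensity.memLp_testFunction g ∞).mul hF (r := 1))
  have i1 := hg1 (h.isDensity.memLp_of_zero_off f.hasCompactSupport f.tsupport_subset
    (fun _ hx => fluxPartial_eq_zero_of_notMem f hx) (h.memLp_fluxPartial f i j 1) le_rfl)
  have i2 := hg1 (h.isDensity.memLp_of_zero_off f.hasCompactSupport f.tsupport_subset
    (fun _ hx => by rw [partialDeriv_eq_zero_of_notMem f hx, mul_zero, mul_zero])
    (h.memLp_logPartial_mul f i j) hp)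
  have i3 := h.integrable_gradientTerm g f i j
  have e1 : ∫ x, (fluxPartial Ω A i j f x * g x + A x i j * partialDeriv j f x * partialDeriv i g x)
      ∂(densityMeasure Ω ϱ) = (∫ x, fluxPartial Ω A i j f x * g x ∂(densityMeasure Ω ϱ)) +
      ∫ x, A x i j * partialDeriv i g x * partialDeriv j f x ∂(densityMeasure Ω ϱ) := by
    rw [← integral_add i1 i3]
    exact integral_congr_ae (Eventually.of_forall fun x => by simp only; ring)
  have e2 : ∫ x, generatorTerm Ω A ϱ i j f x * g x ∂(densityMeasure Ω ϱ) =
      (∫ x, fluxPartial Ω A i j f x * g x ∂(densityMeasure Ω ϱ)) +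
      ∫ x, logPartial Ω ϱ i x * (A x i j * partialDeriv j f x) * g x ∂(densityMeasure Ω ϱ) := by
    rw [← integral_add i1 i2]
    exact integral_congr_ae (Eventually.of_forall fun x => by simp only [generatorTerm]; ring)
  rw [e1, h2] at h1
  rw [e2]
  linarith

theorem gradientDensity_comm (f g : EuclideanSpace ℝ (Fin d) → ℝ) :
    gradientDensity A f g =ᵐ[densityMeasure Ω ϱ] gradientDensity A g f := by
  filter_upwards [ae_densityMeasure_of_ae h.symmetric] with x hx
  rw [gradientDensity, gradientDensity, Finset.sum_comm]
  exact Finset.sum_congr rfl fun i _ => Finset.sum_congr rfl fun j _ => by rw [hx.apply i j]; ring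

theorem integral_gradientDensity (hp : 1 ≤ p) (f g : TestFunction Ω ℝ ⊤) :
    ∫ x, gradientDensity A f g x ∂(densityMeasure Ω ϱ) =
      -∫ x, divergenceGenerator Ω A ϱ f x * g x ∂(densityMeasure Ω ϱ) := by
  -- The flux `a_ij ∂_j f` pairs with `∂_i g`, so the arguments are first exchanged by symmetry.
  rw [integral_congr_ae (h.gradientDensity_comm f g)]
  have e1 : ∫ x, divergenceGenerator Ω A ϱ f x * g x ∂(densityMeasure Ω ϱ) =
      ∫ x, ∑ i, ∑ j, generatorTerm Ω A ϱ i j f x * g x ∂(densityMeasure Ω ϱ) := by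
    refine integral_congr_ae ((h.divergenceGenerator_ae_eq f).mono fun x hx => ?_)
    simp only [hx, Finset.sum_mul]
  have i1 : ∀ i j, Integrable (fun x => generatorTerm Ω A ϱ i j f x * g x) (densityMeasure Ω ϱ) :=
    fun i j => memLp_one_iff_integrable.1
      ((h.isDensity.memLp_testFunction g ∞).mul (h.memLp_generatorTerm f i j hp) (r := 1))
  rw [e1, integral_finsetSum _ fun i _ => integrable_finsetSum _ fun j _ => i1 i j]
  simp only [gradientDensity]
  rw [integral_finsetSum _ fun i _ => integrable_finsetSum _ fun j _ =>
    h.integrable_gradientTerm g f i j, ← Finset.sum_neg_distrib]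
  refine Finset.sum_congr rfl fun i _ => ?_
  rw [integral_finsetSum _ fun j _ => i1 i j,
    integral_finsetSum _ fun j _ => h.integrable_gradientTerm g f i j, ← Finset.sum_neg_distrib]
  exact Finset.sum_congr rfl fun j _ => h.integral_gradientTerm hp f g i j

theorem ae_nonneg {K : Set (EuclideanSpace ℝ (Fin d))} (hK : IsCompact K) (hKΩ : K ⊆ Ω) :
    ∀ᵐ x ∂(densityMeasure Ω ϱ), x ∈ K → ∀ ξ : Fin d → ℝ,
      0 ≤ ∑ i, ∑ j, A x i j * ξ i * ξ j := by
  obtain ⟨κ, hκ, hA⟩ := h.elliptic K hK hKΩ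
  rw [ae_restrict_iff' hK.measurableSet] at hA
  filter_upwards [ae_densityMeasure_of_ae_volume hA] with x hx hxK ξ
  exact le_trans (by positivity) (hx hxK ξ)

theorem gradientDensity_self_nonneg (f : TestFunction Ω ℝ ⊤) :
    ∀ᵐ x ∂(densityMeasure Ω ϱ), 0 ≤ gradientDensity A f f x := by
  filter_upwards [h.ae_nonneg f.hasCompactSupport f.tsupport_subset] with x hx
  by_cases hxK : x ∈ tsupport f
  · exact hx hxK fun i => partialDeriv i f x
  · simp [gradientDensity, partialDeriv_eq_zero_of_notMem (f : EuclideanSpace ℝ (Fin d) → ℝ) hxK]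

end EllipticConditions

end EllipticConditions

/-! ### Inner products and uniform convergence in `L²`. -/

section SquareIntegrable

variable {X : Type*} [MeasurableSpace X] {m : Measure X}

theorem Lp_two_inner_eq {u v : Lp ℝ 2 m} {f g : X → ℝ} (hu : u =ᵐ[m] f) (hv : v =ᵐ[m] g) :
    inner ℝ u v = ∫ x, f x * g x ∂m := by
  rw [L2.inner_def]
  refine integral_congr_ae ?_
  filter_upwards [hu, hv] with x h1 h2
  rw [h1, h2, real_inner_eq_re_inner, mul_comm]
  simp

theorem tendsto_Lp_two_of_uniform {u : ℕ → Lp ℝ 2 m} {w : Lp ℝ 2 m} {K : Set X}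
    (hK : MeasurableSet K) (hmK : m K ≠ ∞) {ε : ℕ → ℝ} (hε : Tendsto ε atTop (𝓝 0))
    (h : ∀ n, ∀ᵐ x ∂m, |u n x - w x| ≤ K.indicator (fun _ => ε n) x) :
    Tendsto u atTop (𝓝 w) := by
  rw [tendsto_iff_norm_sub_tendsto_zero]
  have h1 : Tendsto (fun n => ‖ε n‖ * m.real K ^ (1 / (2 : ℝ≥0∞).toReal)) atTop (𝓝 0) := by
    simpa using hε.norm.mul_const (m.real K ^ (1 / (2 : ℝ≥0∞).toReal))
  refine squeeze_zero (fun _ => norm_nonneg _) (fun n => ?_) h1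
  rw [← norm_indicatorConstLp (hs := hK) (hμs := hmK) (by simp) (by simp)]
  refine Lp.norm_le_norm_of_ae_le ?_
  filter_upwards [h n, Lp.coeFn_sub (u n) w, indicatorConstLp_coeFn (p := 2) (hs := hK)
    (hμs := hmK) (c := ε n)] with x h1 h2 h3
  rw [h2, h3, Pi.sub_apply, Real.norm_eq_abs]
  exact h1.trans (le_abs_self _)

end SquareIntegrable

/-! ### Smooth approximation of the unit contraction. -/

section SmoothContraction

/-- A smooth approximation of the unit contraction. -/
noncomputable def smoothUnit (ε s : ℝ) : ℝ :=
  (√(s ^ 2 + ε ^ 2) - √((s - 1) ^ 2 + ε ^ 2) + √(1 + ε ^ 2) - ε) / 2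

variable {ε : ℝ}

theorem smoothUnit_zero (hε : 0 < ε) : smoothUnit ε 0 = 0 := by
  simp [smoothUnit, Real.sqrt_sq hε.le]

theorem contDiff_smoothUnit (hε : 0 < ε) : ContDiff ℝ (⊤ : ℕ∞) (smoothUnit ε) := by
  have h1 : ContDiff ℝ (⊤ : ℕ∞) fun s : ℝ => √(s ^ 2 + ε ^ 2) :=
    ((contDiff_id.pow 2).add contDiff_const).sqrt fun s => by positivity
  have h2 : ContDiff ℝ (⊤ : ℕ∞) fun s : ℝ => √((s - 1) ^ 2 + ε ^ 2) :=
    (((contDiff_id.sub contDiff_const).pow 2).add contDiff_const).sqrt fun s => by positivity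
  exact (((h1.sub h2).add contDiff_const).sub contDiff_const).div_const 2

/-- The derivative is half the difference of two numbers in `[-1, 1]`. -/
theorem abs_deriv_smoothUnit_le (hε : 0 < ε) (s : ℝ) : |deriv (smoothUnit ε) s| ≤ 1 := by
  have key : ∀ c, HasDerivAt (fun s : ℝ => √((s - c) ^ 2 + ε ^ 2))
      ((s - c) / √((s - c) ^ 2 + ε ^ 2)) s := fun c => by
    have h1 : HasDerivAt (fun s : ℝ => (s - c) ^ 2 + ε ^ 2) (2 * (s - c)) s := by
      simpa using (((hasDerivAt_id s).sub_const c).pow 2).add_const (ε ^ 2)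
    convert h1.sqrt (by positivity) using 1
    field_simp
  have hle : ∀ a : ℝ, |a / √(a ^ 2 + ε ^ 2)| ≤ 1 := fun a => by
    rw [abs_div, abs_of_nonneg (Real.sqrt_nonneg _), div_le_one (by positivity)]
    exact Real.abs_le_sqrt (by nlinarith)
  have h0 := key 0
  simp only [sub_zero] at h0
  have h := ((((h0.sub (key 1)).add_const (√(1 + ε ^ 2))).sub_const ε).div_const 2).deriv
  have e : deriv (smoothUnit ε) s =
      (s / √(s ^ 2 + ε ^ 2) - (s - 1) / √((s - 1) ^ 2 + ε ^ 2)) / 2 := h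
  rw [e, abs_div, abs_two, div_le_one two_pos]
  refine (abs_sub _ _).trans ?_
  linarith [hle s, hle (s - 1)]

/-- The unit contraction is `(|s| - |s - 1| + 1) / 2`, and replacing each absolute value `|a|` by
`√(a² + ε²)` changes it by at most `ε`. -/
theorem abs_smoothUnit_sub_le (hε : 0 < ε) (s : ℝ) :
    |smoothUnit ε s - min (max s 0) 1| ≤ 2 * ε := by
  have key : ∀ a : ℝ, |a| ≤ √(a ^ 2 + ε ^ 2) ∧ √(a ^ 2 + ε ^ 2) ≤ |a| + ε := fun a => by
    refine ⟨Real.abs_le_sqrt (by nlinarith), Real.sqrt_le_iff.2 ⟨by positivity, ?_⟩⟩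
    nlinarith [sq_abs a, abs_nonneg a]
  have h0 := key s
  have h1 := key (s - 1)
  have h2 := key 1
  rw [abs_one, one_pow] at h2
  have e : min (max s 0) 1 = (|s| - |s - 1| + 1) / 2 := by
    rcases le_total s 0 with h | h
    · rw [max_eq_right h, min_eq_left zero_le_one, abs_of_nonpos h, abs_of_nonpos (by linarith)]
      ring
    · rw [max_eq_left h, abs_of_nonneg h]
      rcases le_total s 1 with h' | h'
      · rw [min_eq_left h', abs_of_nonpos (by linarith)]; ring
      · rw [min_eq_right h', abs_of_nonneg (by linarith)]; ring
  rw [e, smoothUnit, abs_le]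
  constructor <;> linarith [h0.1, h0.2, h1.1, h1.2, h2.1, h2.2]

end SmoothContraction

/-! ### Operations on test functions and cutoffs. -/

section TestFunctions

variable {d : ℕ} {Ω : Opens (EuclideanSpace ℝ (Fin d))} {i : Fin d}

/-- The composition of a test function with a smooth function vanishing at zero. -/
noncomputable def TestFunction.postcomp (f : TestFunction Ω ℝ ⊤) (φ : ℝ → ℝ)
    (hφ : ContDiff ℝ (⊤ : ℕ∞) φ) (h0 : φ 0 = 0) : TestFunction Ω ℝ ⊤ :=
  ⟨φ ∘ f, hφ.comp f.contDiff, f.hasCompactSupport.comp_left h0,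
    (closure_mono (Function.support_comp_subset h0 f)).trans f.tsupport_subset⟩

theorem partialDeriv_comp {φ : ℝ → ℝ} {f : EuclideanSpace ℝ (Fin d) → ℝ}
    {x : EuclideanSpace ℝ (Fin d)} (hφ : DifferentiableAt ℝ φ (f x))
    (hf : DifferentiableAt ℝ f x) :
    partialDeriv i (fun y => φ (f y)) x = deriv φ (f x) * partialDeriv i f x := by
  have := (hφ.hasDerivAt.comp_hasFDerivAt x hf.hasFDerivAt).fderiv
  rw [partialDeriv]
  change fderiv ℝ (φ ∘ f) x _ = _
  rw [this]; rfl

theorem differentiable_testFunction (f : TestFunction Ω ℝ ⊤) : Differentiable ℝ f :=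
  f.contDiff.differentiable (by simp)

theorem partialDeriv_add {f g : EuclideanSpace ℝ (Fin d) → ℝ} {x : EuclideanSpace ℝ (Fin d)}
    (hf : DifferentiableAt ℝ f x) (hg : DifferentiableAt ℝ g x) :
    partialDeriv i (fun y => f y + g y) x = partialDeriv i f x + partialDeriv i g x := by
  simp [partialDeriv, fderiv_fun_add hf hg]

theorem partialDeriv_const_mul {f : EuclideanSpace ℝ (Fin d) → ℝ} {x : EuclideanSpace ℝ (Fin d)}
    (c : ℝ) (hf : DifferentiableAt ℝ f x) :
    partialDeriv i (fun y => c * f y) x = c * partialDeriv i f x := by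
  simp [partialDeriv, fderiv_const_mul hf]

/-- A smooth cutoff function between a compact set and an open set. -/
theorem exists_cutoff {K U : Set (EuclideanSpace ℝ (Fin d))} (hK : IsCompact K) (hU : IsOpen U)
    (hKU : K ⊆ U) (hUΩ : U ⊆ Ω) : ∃ χ : TestFunction Ω ℝ ⊤, tsupport χ ⊆ U ∧
      (∃ V, IsOpen V ∧ K ⊆ V ∧ ∀ x ∈ V, χ x = 1) ∧ ∀ x, 0 ≤ χ x ∧ χ x ≤ 1 := by
  obtain ⟨δ, hδ, hδU⟩ := hK.exists_cthickening_subset_open hU hKU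
  have hint : K ⊆ interior (Metric.cthickening δ K) :=
    (Metric.self_subset_thickening hδ K).trans
      (interior_maximal (Metric.thickening_subset_cthickening δ K) Metric.isOpen_thickening)
  obtain ⟨χ, h1, h0, hχ⟩ := exists_contMDiffMap_one_nhds_of_subset_interior
    (modelWithCornersSelf ℝ (EuclideanSpace ℝ (Fin d))) (n := (⊤ : ℕ∞)) hK.isClosed hint
  have hts : tsupport χ ⊆ Metric.cthickening δ K :=
    closure_minimal (fun x hx => by by_contra h; exact hx (h0 x h)) Metric.isClosed_cthickening
  obtain ⟨V, hV, hKV, hV1⟩ := mem_nhdsSet_iff_exists.1 h1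
  exact ⟨⟨χ, χ.contMDiff.contDiff, hK.cthickening.of_isClosed_subset (isClosed_tsupport _) hts,
    (hts.trans hδU).trans hUΩ⟩, hts.trans hδU, ⟨V, hV, hKV, hV1⟩, fun x => hχ x⟩

end TestFunctions

/-! ### The gradient form on test functions and its closability. -/

section Gradient

variable {d : ℕ} {Ω : Opens (EuclideanSpace ℝ (Fin d))} {i j : Fin d}
  {A : EuclideanSpace ℝ (Fin d) → Matrix (Fin d) (Fin d) ℝ}
  {ϱ : EuclideanSpace ℝ (Fin d) → ℝ} {p : ℝ≥0∞}

theorem gradientDensity_postcomp (f : TestFunction Ω ℝ ⊤) (φ : ℝ → ℝ)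
    (hφ : ContDiff ℝ (⊤ : ℕ∞) φ) (h0 : φ 0 = 0) (x : EuclideanSpace ℝ (Fin d)) :
    gradientDensity A (f.postcomp φ hφ h0) (f.postcomp φ hφ h0) x =
      deriv φ (f x) ^ 2 * gradientDensity A f f x := by
  have h1 : ∀ i, partialDeriv i (f.postcomp φ hφ h0) x = deriv φ (f x) * partialDeriv i f x :=
    fun i => partialDeriv_comp (hφ.differentiable (by simp) _) (differentiable_testFunction f x)
  simp_rw [gradientDensity, h1, Finset.mul_sum]
  exact Finset.sum_congr rfl fun i _ => Finset.sum_congr rfl fun j _ => by ring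

theorem gradientDensity_add_left (f f' g : TestFunction Ω ℝ ⊤) (x : EuclideanSpace ℝ (Fin d)) :
    gradientDensity A (f + f' : TestFunction Ω ℝ ⊤) g x =
      gradientDensity A f g x + gradientDensity A f' g x := by
  have h1 : ∀ i, partialDeriv i (f + f' : TestFunction Ω ℝ ⊤) x =
      partialDeriv i f x + partialDeriv i f' x :=
    fun i => partialDeriv_add (differentiable_testFunction f x) (differentiable_testFunction f' x)
  simp_rw [gradientDensity, h1, ← Finset.sum_add_distrib]
  exact Finset.sum_congr rfl fun i _ => Finset.sum_congr rfl fun j _ => by ring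

theorem gradientDensity_add_right (f g g' : TestFunction Ω ℝ ⊤) (x : EuclideanSpace ℝ (Fin d)) :
    gradientDensity A f (g + g' : TestFunction Ω ℝ ⊤) x =
      gradientDensity A f g x + gradientDensity A f g' x := by
  have h1 : ∀ i, partialDeriv i (g + g' : TestFunction Ω ℝ ⊤) x =
      partialDeriv i g x + partialDeriv i g' x :=
    fun i => partialDeriv_add (differentiable_testFunction g x) (differentiable_testFunction g' x)
  simp_rw [gradientDensity, h1, ← Finset.sum_add_distrib]
  exact Finset.sum_congr rfl fun i _ => Finset.sum_congr rfl fun j _ => by ring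

theorem gradientDensity_smul_left (c : ℝ) (f g : TestFunction Ω ℝ ⊤)
    (x : EuclideanSpace ℝ (Fin d)) :
    gradientDensity A (c • f : TestFunction Ω ℝ ⊤) g x = c * gradientDensity A f g x := by
  have h1 : ∀ i, partialDeriv i (c • f : TestFunction Ω ℝ ⊤) x = c * partialDeriv i f x :=
    fun i => partialDeriv_const_mul c (differentiable_testFunction f x)
  simp_rw [gradientDensity, h1, Finset.mul_sum]
  exact Finset.sum_congr rfl fun i _ => Finset.sum_congr rfl fun j _ => by ring

theorem gradientDensity_smul_right (c : ℝ) (f g : TestFunction Ω ℝ ⊤)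
    (x : EuclideanSpace ℝ (Fin d)) :
    gradientDensity A f (c • g : TestFunction Ω ℝ ⊤) x = c * gradientDensity A f g x := by
  have h1 : ∀ i, partialDeriv i (c • g : TestFunction Ω ℝ ⊤) x = c * partialDeriv i g x :=
    fun i => partialDeriv_const_mul c (differentiable_testFunction g x)
  simp_rw [gradientDensity, h1, Finset.mul_sum]
  exact Finset.sum_congr rfl fun i _ => Finset.sum_congr rfl fun j _ => by ring

/-- The classes of test functions in `L²(μ)`. -/
noncomputable def IsDensity.toLp (h : IsDensity Ω ϱ) :
    TestFunction Ω ℝ ⊤ →ₗ[ℝ] Lp ℝ 2 (densityMeasure Ω ϱ) where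
  toFun f := (h.memLp_testFunction f 2).toLp f
  map_add' f g := MemLp.toLp_add (h.memLp_testFunction f 2) (h.memLp_testFunction g 2)
  map_smul' c f := MemLp.toLp_const_smul c (h.memLp_testFunction f 2)

theorem IsDensity.coeFn_toLp (h : IsDensity Ω ϱ) (f : TestFunction Ω ℝ ⊤) :
    h.toLp f =ᵐ[densityMeasure Ω ϱ] f :=
  MemLp.coeFn_toLp (h.memLp_testFunction f 2)

theorem IsDensity.testFunction_eq_of_ae_eq (h : IsDensity Ω ϱ) {f g : TestFunction Ω ℝ ⊤}
    (hfg : f =ᵐ[densityMeasure Ω ϱ] g) : f = g := by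
  ext x
  by_cases hx : x ∈ Ω
  · exact h.eqOn_of_ae_eq f.continuous.continuousOn g.continuous.continuousOn hfg hx
  · rw [image_eq_zero_of_notMem_tsupport fun h => hx (f.tsupport_subset h),
      image_eq_zero_of_notMem_tsupport fun h => hx (g.tsupport_subset h)]

theorem IsDensity.toLp_injective (h : IsDensity Ω ϱ) : Function.Injective h.toLp :=
  fun f g hfg => h.testFunction_eq_of_ae_eq
    ((h.coeFn_toLp f).symm.trans ((by rw [hfg] : _ =ᵐ[_] _).trans (h.coeFn_toLp g)))

theorem IsDensity.integrable_iff (h : IsDensity Ω ϱ) {F : EuclideanSpace ℝ (Fin d) → ℝ} :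
    Integrable F (densityMeasure Ω ϱ) ↔
      Integrable (fun x => ϱ x * F x) (volume.restrict (Ω : Set (EuclideanSpace ℝ (Fin d)))) := by
  rw [densityMeasure, integrable_withDensity_iff_integrable_smul₀' h.aemeasurable
    (Eventually.of_forall fun _ => ENNReal.ofReal_lt_top)]
  refine integrable_congr (h.pos.mono fun x hx => ?_)
  simp only [ENNReal.toReal_ofReal hx.le, smul_eq_mul]

theorem IsDensity.integrableOn_mul (h : IsDensity Ω ϱ) {K : Set (EuclideanSpace ℝ (Fin d))}
    (hK : IsCompact K) (hKΩ : K ⊆ Ω) {F : EuclideanSpace ℝ (Fin d) → ℝ}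
    (hF : IntegrableOn F K (densityMeasure Ω ϱ)) : IntegrableOn (fun x => ϱ x * F x) K volume := by
  rw [← integrable_indicator_iff hK.measurableSet, h.integrable_iff] at hF
  have h1 : Integrable (K.indicator fun x => ϱ x * F x)
      (volume.restrict (Ω : Set (EuclideanSpace ℝ (Fin d)))) := by
    refine hF.congr (Eventually.of_forall fun x => ?_)
    by_cases hxK : x ∈ K <;> simp [hxK]
  rwa [integrable_indicator_iff hK.measurableSet, IntegrableOn,
    Measure.restrict_restrict_of_subset hKΩ] at h1

/-- If `u` is orthogonal to the test functions, then `ϱ u` is locally integrable and annihilates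
them, so it vanishes almost everywhere; `ϱ > 0` then gives `u = 0`. -/
theorem IsDensity.denseRange_toLp (h : IsDensity Ω ϱ) : DenseRange h.toLp := by
  have h1 : (LinearMap.range h.toLp).topologicalClosure = ⊤ := by
    rw [Submodule.topologicalClosure_eq_top_iff, Submodule.eq_bot_iff]
    intro u hu
    have h2 : ∀ f : TestFunction Ω ℝ ⊤, ∫ x, f x * u x ∂(densityMeasure Ω ϱ) = 0 := fun f => by
      rw [← Lp_two_inner_eq (h.coeFn_toLp f) (ae_eq_refl _)]
      exact (Submodule.mem_orthogonal _ _).1 hu _ ⟨f, rfl⟩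
    have hloc : LocallyIntegrableOn (fun x => ϱ x * u x) Ω volume := by
      rw [locallyIntegrableOn_iff Ω.isOpen.isLocallyClosed]
      intro K hK hKc
      have := h.isFiniteMeasure_restrict hKc hK
      exact h.integrableOn_mul hKc hK
        (memLp_one_iff_integrable.1 (((Lp.memLp u).restrict K).mono_exponent (by norm_num)))
    have h5 : ∀ᵐ x, x ∈ (Ω : Set (EuclideanSpace ℝ (Fin d))) → ϱ x * u x = 0 := by
      refine Ω.isOpen.ae_eq_zero_of_integral_contDiff_smul_eq_zero hloc fun g hg hgc hgs => ?_
      have h6 := h2 ⟨g, hg, hgc, hgs⟩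
      rw [h.integral_eq] at h6
      rw [← h6, ← setIntegral_eq_integral_of_forall_compl_eq_zero
        (s := (Ω : Set (EuclideanSpace ℝ (Fin d)))) fun x hx => by
          rw [image_eq_zero_of_notMem_tsupport fun h => hx (hgs h), zero_smul]]
      refine integral_congr_ae (Eventually.of_forall fun x => ?_)
      change g x * (ϱ x * u x) = ϱ x * (g x * u x)
      ring
    refine Lp.eq_zero_iff_ae_eq_zero.2 (ae_densityMeasure_of_ae ?_)
    filter_upwards [(ae_restrict_iff' Ω.isOpen.measurableSet).2 h5, h.pos] with x h7 h8
    exact (mul_eq_zero.1 h7).resolve_left h8.ne'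
  have h2 := congrArg (SetLike.coe) h1
  rw [Submodule.topologicalClosure_coe] at h2
  exact dense_iff_closure_eq.2 h2

namespace EllipticConditions

/-- The form `∫ (A ∇f, ∇g) dμ` on test functions. -/
noncomputable def gradientForm (h : EllipticConditions Ω A ϱ p) :
    TestFunction Ω ℝ ⊤ →ₗ[ℝ] TestFunction Ω ℝ ⊤ →ₗ[ℝ] ℝ :=
  LinearMap.mk₂ ℝ (fun f g => ∫ x, gradientDensity A f g x ∂(densityMeasure Ω ϱ))
    (fun f f' g => by
      simp_rw [gradientDensity_add_left]
      exact integral_add (h.integrable_gradientDensity f g) (h.integrable_gradientDensity f' g))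
    (fun c f g => by simp_rw [gradientDensity_smul_left, integral_const_mul]; rfl)
    (fun f g g' => by
      simp_rw [gradientDensity_add_right]
      exact integral_add (h.integrable_gradientDensity f g) (h.integrable_gradientDensity f g'))
    (fun c f g => by simp_rw [gradientDensity_smul_right, integral_const_mul]; rfl)

variable (h : EllipticConditions Ω A ϱ p)

theorem gradientForm_apply (f g : TestFunction Ω ℝ ⊤) :
    h.gradientForm f g = ∫ x, gradientDensity A f g x ∂(densityMeasure Ω ϱ) := rfl

theorem gradientForm_symm (f g : TestFunction Ω ℝ ⊤) :
    h.gradientForm f g = h.gradientForm g f :=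
  integral_congr_ae (h.gradientDensity_comm f g)

theorem gradientForm_self_nonneg (f : TestFunction Ω ℝ ⊤) : 0 ≤ h.gradientForm f f :=
  integral_nonneg_of_ae (h.gradientDensity_self_nonneg f)

/-- The generator on test functions, as a class in `L²(μ)`. -/
noncomputable def generatorLp (hp : 2 ≤ p) (f : TestFunction Ω ℝ ⊤) :
    Lp ℝ 2 (densityMeasure Ω ϱ) :=
  (h.memLp_divergenceGenerator f hp).toLp _

theorem coeFn_generatorLp (hp : 2 ≤ p) (f : TestFunction Ω ℝ ⊤) :
    h.generatorLp hp f =ᵐ[densityMeasure Ω ϱ] divergenceGenerator Ω A ϱ f :=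
  MemLp.coeFn_toLp _

theorem gradientForm_eq_generator (hp : 2 ≤ p) (f g : TestFunction Ω ℝ ⊤) :
    h.gradientForm f g = -inner ℝ (h.generatorLp hp f) (h.isDensity.toLp g) := by
  rw [Lp_two_inner_eq (h.coeFn_generatorLp hp f) (h.isDensity.coeFn_toLp g)]
  exact h.integral_gradientDensity (le_trans (by norm_num) hp) f g

theorem gradientForm_closable (hp : 2 ≤ p) (u : ℕ → TestFunction Ω ℝ ⊤)
    (hu : Tendsto (fun k : ℕ × ℕ => h.gradientForm (u k.1 - u k.2) (u k.1 - u k.2)) atTop (𝓝 0))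
    (hj : Tendsto (fun n => ‖h.isDensity.toLp (u n)‖) atTop (𝓝 0)) :
    Tendsto (fun n => h.gradientForm (u n) (u n)) atTop (𝓝 0) :=
  closable_of_generator h.gradientForm_symm h.gradientForm_self_nonneg (h.generatorLp hp)
    (h.gradientForm_eq_generator hp) u hu hj

theorem isGradientPreForm :
    IsGradientPreForm Ω A (preForm h.isDensity.toLp h.isDensity.toLp_injective h.gradientForm) where
  domain_mem f := ⟨⟨h.isDensity.toLp f, f, rfl⟩, h.isDensity.coeFn_toLp f⟩
  mem_domain u := by
    obtain ⟨f, hf⟩ := u.2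
    exact ⟨f, by rw [← hf]; exact h.isDensity.coeFn_toLp f⟩
  form_eq f g u v hu hv :=
    ⟨h.integrable_gradientDensity f g, preForm_form _ _
      (Lp.ext (hu.trans (h.isDensity.coeFn_toLp f).symm))
      (Lp.ext (hv.trans (h.isDensity.coeFn_toLp g).symm))⟩

end EllipticConditions

end Gradient

/-! ### Vanishing off the essential support. -/

section EssentialSupport

variable {X : Type*} [TopologicalSpace X] [SecondCountableTopology X] [MeasurableSpace X]
  {m : Measure X}

/-- The exceptional set is null near each of its points, hence null by second countability. -/
theorem ae_eq_zero_of_notMem_essSupport (Ω : Opens X) (u : X → ℝ) :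
    ∀ᵐ x ∂m, x ∈ Ω → x ∉ L2Form.essSupport m Ω u → u x = 0 := by
  have h : m {x | x ∈ Ω ∧ x ∉ L2Form.essSupport m Ω u ∧ u x ≠ 0} = 0 := by
    refine measure_null_of_locally_null _ fun x hx => ?_
    have h1 := hx.2.1
    simp only [L2Form.essSupport, mem_ofPred_eq, not_and, not_forall, not_not] at h1
    obtain ⟨U, hU, hxU, hu⟩ := h1 hx.1
    refine ⟨{x | x ∈ Ω ∧ x ∉ L2Form.essSupport m Ω u ∧ u x ≠ 0} ∩ U,
      inter_mem self_mem_nhdsWithin (mem_nhdsWithin_of_mem_nhds (hU.mem_nhds hxU)), ?_⟩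
    have h2 : m.restrict U {x | ¬ u x = 0} = 0 := hu
    have h3 : m ({x | ¬ u x = 0} ∩ U) = 0 :=
      le_antisymm ((Measure.le_restrict_apply _ _).trans_eq h2) bot_le
    refine measure_mono_null ?_ h3
    exact fun y hy => And.intro (And.left hy).2.2 (And.right hy)
  filter_upwards [measure_eq_zero_iff_ae_notMem.1 h] with x hx h1 h2
  by_contra h3
  exact hx ⟨h1, h2, h3⟩

end EssentialSupport

/-! ### The energy completion: Markov property, generator and regularity. -/

section Completion

variable {d : ℕ} {Ω : Opens (EuclideanSpace ℝ (Fin d))}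
  {A : EuclideanSpace ℝ (Fin d) → Matrix (Fin d) (Fin d) ℝ}
  {ϱ : EuclideanSpace ℝ (Fin d) → ℝ} {p : ℝ≥0∞}

/-- `V` is the completion of the test functions for the norm `E_1^{1/2}`, embedded in `L²(μ)`. -/
structure IsGradientCompletion (h : EllipticConditions Ω A ϱ p) {V : Type*}
    [NormedAddCommGroup V] [InnerProductSpace ℝ V] (ι : V →L[ℝ] Lp ℝ 2 (densityMeasure Ω ϱ))
    (k : TestFunction Ω ℝ ⊤ →ₗ[ℝ] V) : Prop where
  injective : Function.Injective ι
  denseRange : DenseRange k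
  map_eq : ∀ f, ι (k f) = h.isDensity.toLp f
  norm_le : ∀ v, ‖ι v‖ ≤ ‖v‖
  inner_eq : ∀ f g, inner ℝ (k f) (k g) =
    h.gradientForm f g + inner ℝ (h.isDensity.toLp f) (h.isDensity.toLp g)

theorem EllipticConditions.exists_completion (h : EllipticConditions Ω A ϱ p) (hp : 2 ≤ p) :
    ∃ (V : Type) (_ : NormedAddCommGroup V) (_ : InnerProductSpace ℝ V) (_ : CompleteSpace V)
      (ι : V →L[ℝ] Lp ℝ 2 (densityMeasure Ω ϱ)) (k : TestFunction Ω ℝ ⊤ →ₗ[ℝ] V),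
      IsGradientCompletion h ι k := by
  obtain ⟨V, i1, i2, i3, ι, k, h1, h2, h3, h4, h5⟩ := exists_form_completion h.isDensity.toLp
    h.isDensity.toLp_injective h.gradientForm h.gradientForm_symm h.gradientForm_self_nonneg
    (h.gradientForm_closable hp)
  exact ⟨V, i1, i2, i3, ι, k, h1, h2, h3, h4, h5⟩

namespace IsGradientCompletion

variable {h : EllipticConditions Ω A ϱ p} {V : Type*} [NormedAddCommGroup V]
  [InnerProductSpace ℝ V] {ι : V →L[ℝ] Lp ℝ 2 (densityMeasure Ω ϱ)}
  {k : TestFunction Ω ℝ ⊤ →ₗ[ℝ] V}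

theorem coeFn_map (hc : IsGradientCompletion h ι k) (f : TestFunction Ω ℝ ⊤) :
    ι (k f) =ᵐ[densityMeasure Ω ϱ] f := by
  rw [hc.map_eq]; exact h.isDensity.coeFn_toLp f

theorem norm_sq_eq (hc : IsGradientCompletion h ι k) (f : TestFunction Ω ℝ ⊤) :
    ‖k f‖ ^ 2 = h.gradientForm f f + ‖h.isDensity.toLp f‖ ^ 2 := by
  rw [← real_inner_self_eq_norm_sq, hc.inner_eq, real_inner_self_eq_norm_sq]

theorem norm_sq_eq_integral (hc : IsGradientCompletion h ι k) (f : TestFunction Ω ℝ ⊤) :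
    ‖k f‖ ^ 2 = (∫ x, gradientDensity A f f x ∂(densityMeasure Ω ϱ)) +
      ∫ x, f x * f x ∂(densityMeasure Ω ϱ) := by
  rw [hc.norm_sq_eq, ← real_inner_self_eq_norm_sq,
    Lp_two_inner_eq (h.isDensity.coeFn_toLp f) (h.isDensity.coeFn_toLp f)]
  rfl

theorem exists_seq (hc : IsGradientCompletion h ι k) (x : V) :
    ∃ f : ℕ → TestFunction Ω ℝ ⊤, Tendsto (fun n => k (f n)) atTop (𝓝 x) := by
  obtain ⟨u, hu, hux⟩ := mem_closure_iff_seq_limit.1 (hc.denseRange x)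
  choose f hf using hu
  exact ⟨f, by simpa only [hf] using hux⟩

theorem denseRange_embedding (hc : IsGradientCompletion h ι k) : DenseRange ι := by
  have h1 := h.isDensity.denseRange_toLp
  refine Dense.mono ?_ h1
  rintro _ ⟨f, rfl⟩
  exact ⟨k f, hc.map_eq f⟩

/-- Composing `f` with `smoothUnit` multiplies the gradient density by a squared derivative at most
one, so the energies stay below that of `f`. The compositions converge uniformly on the support of
`f`, and `exists_norm_le_of_tendsto` puts the limit in `V` with the same bound. -/
theorem exists_unitContraction_testFunction [CompleteSpace V] (hc : IsGradientCompletion h ι k)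
    (f : TestFunction Ω ℝ ⊤) :
    ∃ y, ι y = unitContraction (ι (k f)) ∧ ‖y‖ ^ 2 - ‖ι y‖ ^ 2 ≤ h.gradientForm f f := by
  let ε : ℕ → ℝ := fun n => 1 / ((n : ℝ) + 1)
  have hε : ∀ n, 0 < ε n := fun n => by positivity
  have hε0 : Tendsto ε atTop (𝓝 0) := tendsto_one_div_add_atTop_nhds_zero_nat
  let g : ℕ → TestFunction Ω ℝ ⊤ := fun n =>
    f.postcomp (smoothUnit (ε n)) (contDiff_smoothUnit (hε n)) (smoothUnit_zero (hε n))
  have hgx : ∀ n x, g n x = smoothUnit (ε n) (f x) := fun n x => rfl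
  have h1 : Tendsto (fun n => ι (k (g n))) atTop (𝓝 (unitContraction (ι (k f)))) := by
    refine tendsto_Lp_two_of_uniform (ε := fun n => 2 * ε n) f.hasCompactSupport.measurableSet
      (h.isDensity.measure_lt_top f.hasCompactSupport f.tsupport_subset).ne
      (by simpa using hε0.const_mul 2) fun n => ?_
    filter_upwards [hc.coeFn_map (g n), coeFn_unitContraction (ι (k f)), hc.coeFn_map f]
      with x h1 h2 h3
    rw [h1, h2, h3, hgx]
    by_cases hx : x ∈ tsupport f
    · rw [indicator_of_mem hx]
      exact abs_smoothUnit_sub_le (hε n) _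
    · rw [indicator_of_notMem hx, image_eq_zero_of_notMem_tsupport hx, smoothUnit_zero (hε n)]
      simp
  have h2 : ∀ n, h.gradientForm (g n) (g n) ≤ h.gradientForm f f := fun n => by
    refine integral_mono_ae (h.integrable_gradientDensity _ _) (h.integrable_gradientDensity _ _) ?_
    filter_upwards [h.gradientDensity_self_nonneg f] with x hx
    rw [gradientDensity_postcomp]
    refine mul_le_of_le_one_left hx ?_
    rw [sq_le_one_iff_abs_le_one]
    exact abs_deriv_smoothUnit_le (hε n) _
  have h3 : ∀ n, ‖k (g n)‖ ≤ √(h.gradientForm f f + ‖ι (k (g n))‖ ^ 2) := fun n => by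
    refine Real.le_sqrt_of_sq_le ?_
    rw [hc.norm_sq_eq, hc.map_eq]
    linarith [h2 n]
  obtain ⟨y, hy, hyn⟩ := exists_norm_le_of_tendsto hc.injective h3
    ((tendsto_const_nhds.add (h1.norm.pow 2)).sqrt) h1
  refine ⟨y, hy, ?_⟩
  rw [hy]
  have := (Real.le_sqrt (norm_nonneg _) (add_nonneg (h.gradientForm_self_nonneg f) (sq_nonneg _))).1 hyn
  linarith

/-- The unit contraction is continuous on `L²`, so the bound for test functions passes to all of `V`
by the same lower semicontinuity. -/
theorem exists_unitContraction [CompleteSpace V] (hc : IsGradientCompletion h ι k) (x : V) :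
    ∃ y, ι y = unitContraction (ι x) ∧ ‖y‖ ^ 2 - ‖ι y‖ ^ 2 ≤ ‖x‖ ^ 2 - ‖ι x‖ ^ 2 := by
  obtain ⟨f, hf⟩ := hc.exists_seq x
  choose y hy hyn using fun n => hc.exists_unitContraction_testFunction (f n)
  have hιf := (ι.continuous.tendsto x).comp hf
  have h1 : Tendsto (fun n => ι (y n)) atTop (𝓝 (unitContraction (ι x))) := by
    rw [tendsto_iff_norm_sub_tendsto_zero] at hιf ⊢
    refine squeeze_zero (fun _ => norm_nonneg _) (fun n => ?_) hιf
    rw [hy]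
    exact norm_unitContraction_sub_le _ _
  have h2 : ∀ n, ‖y n‖ ≤ √(‖k (f n)‖ ^ 2 - ‖ι (k (f n))‖ ^ 2 + ‖ι (y n)‖ ^ 2) := fun n => by
    refine Real.le_sqrt_of_sq_le ?_
    rw [hc.norm_sq_eq, hc.map_eq]
    linarith [hyn n]
  obtain ⟨z, hz, hzn⟩ := exists_norm_le_of_tendsto hc.injective h2
    ((((hf.norm.pow 2).sub (hιf.norm.pow 2)).add (h1.norm.pow 2)).sqrt) h1
  refine ⟨z, hz, ?_⟩
  rw [hz]
  have h3 : ‖ι x‖ ^ 2 ≤ ‖x‖ ^ 2 := by gcongr; exact hc.norm_le x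
  have := (Real.le_sqrt (norm_nonneg _) (add_nonneg (sub_nonneg.2 h3) (sq_nonneg _))).1 hzn
  linarith

/-- Both sides are continuous in `y`, so Green's formula on test functions extends by density. -/
theorem inner_sub_eq_generator (hc : IsGradientCompletion h ι k) (hp : 2 ≤ p)
    (f : TestFunction Ω ℝ ⊤) (y : V) :
    inner ℝ (k f) y - inner ℝ (ι (k f)) (ι y) = -inner ℝ (h.generatorLp hp f) (ι y) := by
  obtain ⟨g, hg⟩ := hc.exists_seq y
  have hιg := (ι.continuous.tendsto y).comp hg
  refine tendsto_nhds_unique (((tendsto_const_nhds (x := k f)).inner hg).sub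
    ((tendsto_const_nhds (x := ι (k f))).inner hιg))
    (((tendsto_const_nhds (x := h.generatorLp hp f)).inner hιg).neg.congr fun n => ?_)
  simp only [Function.comp_apply]
  rw [hc.inner_eq, hc.map_eq, hc.map_eq, h.gradientForm_eq_generator hp]
  ring

theorem hasGeneratorValue (hc : IsGradientCompletion h ι k) (hp : 2 ≤ p)
    {T : ℝ≥0 → Lp ℝ 2 (densityMeasure Ω ϱ) →L[ℝ] Lp ℝ 2 (densityMeasure Ω ϱ)}
    (hT : IsL2Semigroup (embeddedForm ι hc.injective) T) (f : TestFunction Ω ℝ ⊤) :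
    HasGeneratorValue T f (divergenceGenerator Ω A ϱ f) := by
  refine ⟨ι (k f), h.generatorLp hp f, hc.coeFn_map f, h.coeFn_generatorLp hp f,
    (hT.2 _ _).2 ⟨⟨ι (k f), mem_embeddedForm_domain _⟩, rfl, fun v => ?_⟩⟩
  obtain ⟨y, hy⟩ := exists_eq_of_embeddedForm_domain v
  rw [embeddedForm_form rfl hy, hc.inner_sub_eq_generator hp, hy]

theorem isRegular (hc : IsGradientCompletion h ι k) :
    (embeddedForm ι hc.injective).IsRegular Ω where
  finite_on_compacts _ hK hKΩ := h.isDensity.measure_lt_top hK hKΩ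
  full_support _ hU hUΩ hne := h.isDensity.measure_pos hU hUΩ hne
  dense_form u ε hε := by
    obtain ⟨x, hx⟩ := exists_eq_of_embeddedForm_domain u
    obtain ⟨_, hw, f, rfl⟩ := Metric.dense_iff.1 hc.denseRange x (√ε) (Real.sqrt_pos.2 hε)
    refine ⟨f, ⟨ι (k f), mem_embeddedForm_domain _⟩,
      ⟨f.continuous, f.hasCompactSupport, f.tsupport_subset⟩, hc.coeFn_map f, ?_⟩
    rw [embeddedForm_energyOne (x := x - k f) (by rw [map_sub, ← hx]; rfl)]
    rw [Metric.mem_ball, dist_comm, dist_eq_norm] at hw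
    exact (Real.lt_sqrt (norm_nonneg _)).1 hw
  dense_uniform g ε hg hε := by
    obtain ⟨hgc, hgs, hgΩ⟩ := hg
    obtain ⟨r, hr, hrΩ⟩ := IsCompact.exists_cthickening_subset_open hgs Ω.isOpen hgΩ
    obtain ⟨δ, hδ, hgδ⟩ := Metric.uniformContinuous_iff.1
      (hgs.uniformContinuous_of_continuous hgc) (ε / 2) (half_pos hε)
    -- The mollification radius is below `r`, to keep the support in `Ω`, and below `δ`, for a
    -- uniform error of at most `ε / 2`.
    obtain ⟨ψ, -, -, hψ⟩ := exists_bump_seq (d := d) (lt_min hr hδ)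
    have hts : tsupport (mollify (ψ 0) g) ⊆ Metric.cthickening r (tsupport g) :=
      closure_minimal (fun x hx => by
        by_contra h
        exact hx (mollify_eq_zero (fun x hx => image_eq_zero_of_notMem_tsupport hx) fun h' =>
          h (Metric.cthickening_mono ((hψ 0).trans (min_le_left _ _)) _ h')))
        Metric.isClosed_cthickening
    let f : TestFunction Ω ℝ ⊤ := ⟨mollify (ψ 0) g, contDiff_mollify hgc.locallyIntegrable,
      (IsCompact.cthickening hgs).of_isClosed_subset (isClosed_tsupport _) hts, hts.trans hrΩ⟩
    refine ⟨f, ⟨ι (k f), mem_embeddedForm_domain _⟩,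
      ⟨f.continuous, f.hasCompactSupport, f.tsupport_subset⟩, hc.coeFn_map f, fun x => ?_⟩
    have h1 := ContDiffBump.dist_normed_convolution_le (φ := ψ 0) (μ := volume) (x₀ := x)
      (ε := ε / 2) hgc.aestronglyMeasurable fun y hy =>
        (hgδ (hy.trans_le ((hψ 0).trans (min_le_right _ _)))).le
    rw [Real.dist_eq] at h1
    exact h1.trans_lt (half_lt_self hε)

end IsGradientCompletion

end Completion

/-! ### Cutoffs in the energy norm and strong locality. -/

section StrongLocality

variable {d : ℕ} {Ω : Opens (EuclideanSpace ℝ (Fin d))}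
  {A : EuclideanSpace ℝ (Fin d) → Matrix (Fin d) (Fin d) ℝ}
  {ϱ : EuclideanSpace ℝ (Fin d) → ℝ} {p : ℝ≥0∞}

/-- Parallelogram identity, with the nonnegative value at `ξ - η` discarded. -/
theorem quadratic_add_le {B : Matrix (Fin d) (Fin d) ℝ}
    (hB : ∀ ξ : Fin d → ℝ, 0 ≤ ∑ i, ∑ j, B i j * ξ i * ξ j) (ξ η : Fin d → ℝ) :
    ∑ i, ∑ j, B i j * (ξ i + η i) * (ξ j + η j) ≤
      2 * (∑ i, ∑ j, B i j * ξ i * ξ j) + 2 * ∑ i, ∑ j, B i j * η i * η j := by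
  have h1 := hB fun i => ξ i - η i
  have h2 : (∑ i, ∑ j, B i j * (ξ i + η i) * (ξ j + η j)) +
      ∑ i, ∑ j, B i j * (ξ i - η i) * (ξ j - η j) =
      2 * (∑ i, ∑ j, B i j * ξ i * ξ j) + 2 * ∑ i, ∑ j, B i j * η i * η j := by
    simp_rw [Finset.mul_sum, ← Finset.sum_add_distrib]
    exact Finset.sum_congr rfl fun i _ => Finset.sum_congr rfl fun j _ => by ring
  linarith

theorem gradientDensity_mul_le_of_nonneg {f g : EuclideanSpace ℝ (Fin d) → ℝ}
    {x : EuclideanSpace ℝ (Fin d)} (hA : ∀ ξ : Fin d → ℝ, 0 ≤ ∑ i, ∑ j, A x i j * ξ i * ξ j)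
    (hf : DifferentiableAt ℝ f x) (hg : DifferentiableAt ℝ g x) :
    gradientDensity A (fun y => f y * g y) (fun y => f y * g y) x ≤
      2 * g x ^ 2 * gradientDensity A f f x + 2 * f x ^ 2 * gradientDensity A g g x := by
  have h2 := quadratic_add_le hA (fun i => partialDeriv i f x * g x)
    (fun i => f x * partialDeriv i g x)
  simp_rw [gradientDensity, partialDeriv_mul hf hg]
  refine h2.trans_eq ?_
  simp_rw [Finset.mul_sum, ← Finset.sum_add_distrib]
  exact Finset.sum_congr rfl fun i _ => Finset.sum_congr rfl fun j _ => by ring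

theorem gradientDensity_eq_zero_of_notMem (f g : EuclideanSpace ℝ (Fin d) → ℝ)
    {x : EuclideanSpace ℝ (Fin d)} (hx : x ∉ tsupport f) : gradientDensity A f g x = 0 := by
  simp [gradientDensity, partialDeriv_eq_zero_of_notMem f hx]

namespace EllipticConditions

theorem gradientDensity_mul_le (h : EllipticConditions Ω A ϱ p) (f χ : TestFunction Ω ℝ ⊤) :
    ∀ᵐ x ∂(densityMeasure Ω ϱ),
      gradientDensity A (f.mulSmooth χ χ.contDiff) (f.mulSmooth χ χ.contDiff) x ≤
        2 * χ x ^ 2 * gradientDensity A f f x + 2 * f x ^ 2 * gradientDensity A χ χ x := by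
  filter_upwards [h.ae_nonneg χ.hasCompactSupport χ.tsupport_subset] with x hx
  by_cases hxK : x ∈ tsupport χ
  · exact gradientDensity_mul_le_of_nonneg (hx hxK) (differentiable_testFunction f x)
      (differentiable_testFunction χ x)
  · have h1 : x ∉ tsupport (f.mulSmooth χ χ.contDiff) := fun h => hxK (tsupport_mul_subset_right h)
    rw [gradientDensity_eq_zero_of_notMem _ _ h1, gradientDensity_eq_zero_of_notMem _ _ hxK,
      image_eq_zero_of_notMem_tsupport hxK]
    simp

theorem exists_gradientDensity_bound (h : EllipticConditions Ω A ϱ p) (χ : TestFunction Ω ℝ ⊤) :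
    ∃ D : ℝ, 0 ≤ D ∧ ∀ᵐ x ∂(densityMeasure Ω ϱ), gradientDensity A χ χ x ≤ D := by
  obtain ⟨D, hD⟩ : AEBddOn (tsupport χ) (gradientDensity A χ χ) :=
    .sum _ fun i => .sum _ fun j => ((h.aebddOn_coeff i j χ.hasCompactSupport
      χ.tsupport_subset).mul (.partialDeriv χ i)).mul (.partialDeriv χ j)
  refine ⟨max D 0, le_max_right _ _, ?_⟩
  filter_upwards [ae_densityMeasure_of_ae_volume hD] with x hx
  by_cases hxK : x ∈ tsupport χ
  · exact (le_abs_self _).trans ((hx hxK).trans (le_max_left _ _))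
  · rw [gradientDensity_eq_zero_of_notMem _ _ hxK]; exact le_max_right _ _

end EllipticConditions

namespace IsGradientCompletion

variable {h : EllipticConditions Ω A ϱ p} {V : Type*} [NormedAddCommGroup V]
  [InnerProductSpace ℝ V] {ι : V →L[ℝ] Lp ℝ 2 (densityMeasure Ω ϱ)}
  {k : TestFunction Ω ℝ ⊤ →ₗ[ℝ] V}

/-- Multiplication by a cutoff function is bounded for the norm `E_1^{1/2}`. -/
theorem exists_norm_mul_le (hc : IsGradientCompletion h ι k) (χ : TestFunction Ω ℝ ⊤)
    (hχ : ∀ x, 0 ≤ χ x ∧ χ x ≤ 1) :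
    ∃ C : ℝ, 0 ≤ C ∧ ∀ f, ‖k (f.mulSmooth χ χ.contDiff)‖ ≤ C * ‖k f‖ := by
  obtain ⟨D, hD0, hD⟩ := h.exists_gradientDensity_bound χ
  -- The gradient of `f χ` contributes twice the energy of `f` and `2 * D` times its squared `L²`
  -- norm; the function itself adds one more squared norm.
  refine ⟨√(3 + 2 * D), by positivity, fun f => ?_⟩
  refine abs_le_of_sq_le_sq' ?_ (by positivity) |>.2
  rw [mul_pow, Real.sq_sqrt (by positivity), hc.norm_sq_eq_integral, hc.norm_sq_eq_integral]
  have hχ2 : ∀ x, χ x ^ 2 ≤ 1 := fun x => pow_le_one₀ (hχ x).1 (hχ x).2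
  have i1 := h.integrable_gradientDensity f f
  have i2 : ∀ g : TestFunction Ω ℝ ⊤, Integrable (fun x => g x * g x) (densityMeasure Ω ϱ) :=
    fun g => by simpa only [sq] using (h.isDensity.memLp_testFunction g 2).integrable_sq
  have h1 : ∫ x, gradientDensity A (f.mulSmooth χ χ.contDiff) (f.mulSmooth χ χ.contDiff) x
      ∂(densityMeasure Ω ϱ) ≤ 2 * (∫ x, gradientDensity A f f x ∂(densityMeasure Ω ϱ)) +
        2 * D * ∫ x, f x * f x ∂(densityMeasure Ω ϱ) := by
    rw [← integral_const_mul, ← integral_const_mul,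
      ← integral_add (i1.const_mul 2) ((i2 f).const_mul (2 * D))]
    refine integral_mono_ae (h.integrable_gradientDensity _ _)
      ((i1.const_mul 2).add ((i2 f).const_mul (2 * D))) ?_
    filter_upwards [hD, h.gradientDensity_mul_le f χ, h.gradientDensity_self_nonneg f] with x h1 h2 h3
    refine h2.trans ?_
    have := mul_le_mul_of_nonneg_right (hχ2 x) h3
    have := mul_le_mul_of_nonneg_left h1 (sq_nonneg (f x))
    nlinarith
  have h2 : ∫ x, f.mulSmooth χ χ.contDiff x * f.mulSmooth χ χ.contDiff x ∂(densityMeasure Ω ϱ) ≤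
      ∫ x, f x * f x ∂(densityMeasure Ω ϱ) := by
    refine integral_mono (i2 _) (i2 f) fun x => ?_
    change f x * χ x * (f x * χ x) ≤ f x * f x
    have := mul_le_mul_of_nonneg_left (hχ2 x) (sq_nonneg (f x))
    nlinarith
  have h3 : 0 ≤ ∫ x, gradientDensity A f f x ∂(densityMeasure Ω ϱ) := h.gradientForm_self_nonneg f
  have h4 : 0 ≤ ∫ x, f x * f x ∂(densityMeasure Ω ϱ) := integral_nonneg fun x => mul_self_nonneg _
  nlinarith [mul_nonneg hD0 h3, mul_nonneg hD0 h4]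

/-- An element of `V` supported where the cutoff `χ` equals one is a limit of test functions
supported in the support of `χ`. -/
theorem exists_seq_mul [CompleteSpace V] (hc : IsGradientCompletion h ι k) (x : V)
    (χ : TestFunction Ω ℝ ⊤) (hχ : ∀ x, 0 ≤ χ x ∧ χ x ≤ 1)
    (hx : ∀ᵐ y ∂(densityMeasure Ω ϱ), χ y * ι x y = ι x y) :
    ∃ f : ℕ → TestFunction Ω ℝ ⊤,
      Tendsto (fun n => k ((f n).mulSmooth χ χ.contDiff)) atTop (𝓝 x) := by
  obtain ⟨f, hf⟩ := hc.exists_seq x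
  obtain ⟨C, hC0, hC⟩ := hc.exists_norm_mul_le χ hχ
  have hsub : ∀ n m, k ((f n).mulSmooth χ χ.contDiff) - k ((f m).mulSmooth χ χ.contDiff) =
      k ((f n - f m).mulSmooth χ χ.contDiff) := fun n m => by
    rw [← map_sub]
    congr 1
    ext y
    exact (sub_mul (f n y) (f m y) (χ y)).symm
  have hcau : CauchySeq fun n => k ((f n).mulSmooth χ χ.contDiff) := by
    have h1 := cauchySeq_iff_tendsto_dist_atTop_0.1 hf.cauchySeq
    rw [cauchySeq_iff_tendsto_dist_atTop_0]
    refine squeeze_zero (fun _ => dist_nonneg) (fun n => ?_) (by simpa using h1.const_mul C)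
    rw [dist_eq_norm, hsub, dist_eq_norm, ← map_sub]
    exact hC _
  obtain ⟨z, hz⟩ := cauchySeq_tendsto_of_complete hcau
  -- The energy limit is identified in `L²`: multiplication by `χ` contracts `L²` and fixes `ι x`.
  have h1 : ι z = ι x := by
    refine tendsto_nhds_unique ((ι.continuous.tendsto z).comp hz) ?_
    have h2 := (ι.continuous.tendsto x).comp hf
    rw [tendsto_iff_norm_sub_tendsto_zero] at h2 ⊢
    refine squeeze_zero (fun _ => norm_nonneg _) (fun n => ?_) h2
    simp only [Function.comp_apply]
    refine Lp.norm_le_norm_of_ae_le ?_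
    filter_upwards [Lp.coeFn_sub (ι (k ((f n).mulSmooth χ χ.contDiff))) (ι x),
      Lp.coeFn_sub (ι (k (f n))) (ι x), hc.coeFn_map (f n),
      hc.coeFn_map ((f n).mulSmooth χ χ.contDiff), hx] with y e1 e2 e3 e4 e5
    have e6 : ‖f n y * χ y - χ y * ι x y‖ ≤ ‖f n y - ι x y‖ := by
      rw [mul_comm (f n y), ← mul_sub, norm_mul, Real.norm_of_nonneg (hχ y).1]
      exact mul_le_of_le_one_left (norm_nonneg _) (hχ y).2
    rw [e5] at e6
    rw [e1, e2, Pi.sub_apply, Pi.sub_apply, e3, e4]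
    exact e6
  exact ⟨f, hc.injective h1 ▸ hz⟩

/-- On the support of `g` the function `v` equals `c θ`, with `θ` a cutoff equal to one near that
support. Hence `(Lg, v) = c (Lg, θ) = -c E(g, θ)`, which vanishes because `∇θ = 0` wherever `∇g ≠
0`. -/
theorem inner_generatorLp_eq_zero (h : EllipticConditions Ω A ϱ p) (hp : 2 ≤ p)
    {g : TestFunction Ω ℝ ⊤} {U : Set (EuclideanSpace ℝ (Fin d))}
    (hgU : tsupport g ⊆ U) {v : Lp ℝ 2 (densityMeasure Ω ϱ)} {c : ℝ}
    (hv : ∀ᵐ x ∂(densityMeasure Ω ϱ), x ∈ U → v x = c) :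
    inner ℝ (h.generatorLp hp g) v = 0 := by
  obtain ⟨θ, -, ⟨W, hW, hgW, hθ⟩, -⟩ := exists_cutoff (Ω := Ω) g.hasCompactSupport Ω.isOpen
    g.tsupport_subset subset_rfl
  have h1 : h.gradientForm g θ = 0 := by
    rw [h.gradientForm_apply]
    refine integral_eq_zero_of_ae (Eventually.of_forall fun x => ?_)
    refine Finset.sum_eq_zero fun i _ => Finset.sum_eq_zero fun j _ => ?_
    by_cases hx : x ∈ tsupport g
    · have h2 : (θ : _ → ℝ) =ᶠ[𝓝 x] fun _ => 1 :=
        Filter.eventually_of_mem (hW.mem_nhds (hgW hx)) hθ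
      have h3 : partialDeriv j θ x = 0 := by rw [partialDeriv, h2.fderiv_eq]; simp
      rw [h3, mul_zero]
    · rw [partialDeriv_eq_zero_of_notMem (g : _ → ℝ) hx, mul_zero, zero_mul]
  have h2 : inner ℝ (h.generatorLp hp g) v =
      c * inner ℝ (h.generatorLp hp g) (h.isDensity.toLp θ) := by
    rw [Lp_two_inner_eq (h.coeFn_generatorLp hp g) (ae_eq_refl _),
      Lp_two_inner_eq (h.coeFn_generatorLp hp g) (h.isDensity.coeFn_toLp θ), ← integral_const_mul]
    refine integral_congr_ae ?_
    filter_upwards [hv, h.divergenceGenerator_ae_eq g] with x h3 h4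
    by_cases hx : x ∈ tsupport g
    · rw [h3 (hgU hx), hθ x (hgW hx)]; ring
    · rw [h4, Finset.sum_eq_zero fun i _ => Finset.sum_eq_zero fun j _ =>
        generatorTerm_eq_zero_of_notMem (g : _ → ℝ) hx]; ring
  rw [h2, ← neg_eq_zero, ← mul_neg, ← h.gradientForm_eq_generator hp, h1, mul_zero]

/-- A cutoff equal to one near the support of `u` and supported in `U` makes `u` an energy limit of
test functions supported in `U`. For these, `E(g, v) = -(Lg, v) = 0`. -/
theorem isStronglyLocal [CompleteSpace V] (hc : IsGradientCompletion h ι k) (hp : 2 ≤ p) :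
    (embeddedForm ι hc.injective).IsStronglyLocal Ω := by
  rintro u v hu - ⟨U, c, hU, huU, hv⟩
  obtain ⟨x, hx⟩ := exists_eq_of_embeddedForm_domain u
  obtain ⟨y, hy⟩ := exists_eq_of_embeddedForm_domain v
  rw [embeddedForm_form hx hy]
  obtain ⟨χ, hχU, ⟨W, -, hKW, hW⟩, hχ⟩ := exists_cutoff (Ω := Ω) hu (hU.inter Ω.isOpen)
    (fun z hz => ⟨huU hz, hz.1⟩) inter_subset_right
  obtain ⟨f, hf⟩ := hc.exists_seq_mul x χ hχ (by
    filter_upwards [ae_eq_zero_of_notMem_essSupport (m := densityMeasure Ω ϱ) Ω (u : Lp ℝ 2 (densityMeasure Ω ϱ)),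
      ae_mem_densityMeasure] with z h1 h2
    rw [hx] at h1
    by_cases hz : z ∈ L2Form.essSupport (densityMeasure Ω ϱ) Ω (u : Lp ℝ 2 (densityMeasure Ω ϱ))
    · rw [hW z (hKW hz), one_mul]
    · rw [hx] at hz
      rw [h1 h2 hz, mul_zero])
  have hιf := (ι.continuous.tendsto x).comp hf
  refine tendsto_nhds_unique ((hf.inner (tendsto_const_nhds (x := y))).sub
    (hιf.inner (tendsto_const_nhds (x := ι y)))) (tendsto_const_nhds.congr fun n => ?_)
  simp only [Function.comp_apply]
  rw [hc.inner_sub_eq_generator hp, inner_generatorLp_eq_zero h hp (c := c), neg_zero]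
  · exact tsupport_mul_subset_right.trans (hχU.trans inter_subset_left)
  · rw [← hy]
    exact (ae_restrict_iff' hU.measurableSet).1 hv

end IsGradientCompletion

end StrongLocality

/-! ### Morrey's inequality for smooth functions on balls. -/

section Morrey

variable {E : Type*} [NormedAddCommGroup E] [NormedSpace ℝ E]

theorem enorm_sub_le_lintegral_fderiv {w : E → ℝ} (hw : ContDiff ℝ 1 w) (x y : E) :
    ‖w y - w x‖ₑ ≤ (∫⁻ t in Ioc (0 : ℝ) 1, ‖fderiv ℝ w (x + t • (y - x))‖ₑ) * ‖y - x‖ₑ := by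
  have hcont : Continuous fun t : ℝ => fderiv ℝ w (x + t • (y - x)) :=
    (hw.continuous_fderiv (by simp)).comp (by fun_prop)
  have hd : ∀ t : ℝ, HasDerivAt (fun t : ℝ => w (x + t • (y - x)))
      (fderiv ℝ w (x + t • (y - x)) (y - x)) t := fun t => by
    have h1 : HasDerivAt (fun t : ℝ => x + t • (y - x)) (y - x) t := by
      simpa using ((hasDerivAt_id t).smul_const (y - x)).const_add x
    exact ((hw.differentiable (by simp)) _).hasFDerivAt.comp_hasDerivAt t h1
  have h2 := intervalIntegral.integral_eq_sub_of_hasDerivAt (a := 0) (b := 1)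
    (fun t _ => hd t) ((hcont.clm_apply continuous_const).intervalIntegrable _ _)
  simp only [one_smul, add_sub_cancel, zero_smul, add_zero] at h2
  rw [← h2, intervalIntegral.integral_of_le zero_le_one,
    ← lintegral_mul_const _ hcont.enorm.measurable]
  exact (enorm_integral_le_lintegral_enorm _).trans
    (lintegral_mono fun t => ContinuousLinearMap.le_opENorm _ _)

variable [MeasurableSpace E] [BorelSpace E] [FiniteDimensional ℝ E] (μ : Measure E)
  [μ.IsAddHaarMeasure]

/-- The homothety about `x` with ratio `t` maps the convex set `B` into itself and scales the
measure by `t` to the dimension. -/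
theorem setLIntegral_comp_homothety_le {Φ : E → ℝ≥0∞} (hΦ : Measurable Φ) {B : Set E}
    (hB : Convex ℝ B) (hBm : MeasurableSet B) {x : E} (hx : x ∈ B) {t : ℝ} (ht : t ∈ Ioc (0 : ℝ) 1) :
    ∫⁻ y in B, Φ (x + t • (y - x)) ∂μ ≤
      ENNReal.ofReal (t ^ (-(Module.finrank ℝ E : ℝ))) * ∫⁻ y in B, Φ y ∂μ := by
  have h1 : ∫⁻ y in B, Φ (x + t • (y - x)) ∂μ ≤ ∫⁻ y, B.indicator Φ (t • y + (x - t • x)) ∂μ := by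
    rw [← lintegral_indicator hBm]
    refine lintegral_mono fun y => ?_
    have e : x + t • (y - x) = t • y + (x - t • x) := by rw [smul_sub]; abel
    by_cases hy : y ∈ B
    · rw [indicator_of_mem hy, ← e, indicator_of_mem]
      exact hB.add_smul_sub_mem hx hy ⟨ht.1.le, ht.2⟩
    · rw [indicator_of_notMem hy]; exact bot_le
  refine h1.trans (le_of_eq ?_)
  have hm : Measurable fun z => B.indicator Φ (z + (x - t • x)) :=
    (hΦ.indicator hBm).comp (measurable_add_const _)
  rw [← lintegral_map (f := fun z => B.indicator Φ (z + (x - t • x))) hm (measurable_const_smul t),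
    Measure.map_addHaar_smul μ ht.1.ne', lintegral_smul_measure, lintegral_add_right_eq_self,
    lintegral_indicator hBm, abs_of_nonneg (by have := ht.1; positivity), Real.rpow_neg ht.1.le,
    Real.rpow_natCast]
  rfl

/-- Averaged form of Morrey's inequality. -/
theorem lintegral_ball_enorm_sub_le {p q : ℝ} (hpq : p.HolderConjugate q) {w : E → ℝ}
    (hw : ContDiff ℝ 1 w) {z x : E} {r : ℝ} (hx : x ∈ Metric.ball z r) :
    ∫⁻ y in Metric.ball z r, ‖w y - w x‖ₑ ∂μ ≤
      ENNReal.ofReal (2 * r) * (μ (Metric.ball z r) ^ (1 / q) *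
        (∫⁻ y in Metric.ball z r, ‖fderiv ℝ w y‖ₑ ^ p ∂μ) ^ (1 / p) *
        ∫⁻ t in Ioc (0 : ℝ) 1, ENNReal.ofReal (t ^ (-(Module.finrank ℝ E : ℝ) / p))) := by
  set B := Metric.ball z r
  have hcont : Continuous fun a : E × ℝ => ‖fderiv ℝ w (x + a.2 • (a.1 - x))‖ₑ :=
    ((hw.continuous_fderiv (by simp)).comp (by fun_prop)).enorm
  have h1 : ∫⁻ y in B, ‖w y - w x‖ₑ ∂μ ≤ ∫⁻ y in B,
      (ENNReal.ofReal (2 * r) * ∫⁻ t in Ioc (0 : ℝ) 1, ‖fderiv ℝ w (x + t • (y - x))‖ₑ) ∂μ := by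
    refine setLIntegral_mono' Metric.isOpen_ball.measurableSet fun y hy => ?_
    refine (enorm_sub_le_lintegral_fderiv hw x y).trans ?_
    rw [mul_comm]
    refine mul_le_mul_left ?_ _
    rw [← ofReal_norm]
    refine ENNReal.ofReal_le_ofReal ?_
    have h2 := dist_triangle_right y x z
    rw [dist_eq_norm] at h2
    have := Metric.mem_ball.1 hx
    have := Metric.mem_ball.1 hy
    linarith
  refine h1.trans ?_
  rw [lintegral_const_mul' _ _ ENNReal.ofReal_ne_top]
  refine mul_le_mul_right ?_ _
  rw [lintegral_lintegral_swap hcont.measurable.aemeasurable, ← lintegral_const_mul _ (by fun_prop)]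
  refine setLIntegral_mono' measurableSet_Ioc fun t ht => ?_
  have hF : Measurable fun y => ‖fderiv ℝ w y‖ₑ := (hw.continuous_fderiv (by simp)).enorm.measurable
  have hFt : Measurable fun y => ‖fderiv ℝ w (x + t • (y - x))‖ₑ :=
    hF.comp (by fun_prop)
  have h3 := ENNReal.lintegral_mul_le_Lp_mul_Lq (μ.restrict B) hpq hFt.aemeasurable
    (g := fun _ => 1) aemeasurable_const
  simp only [Pi.mul_apply, mul_one, ENNReal.one_rpow, lintegral_one,
    Measure.restrict_apply_univ] at h3
  refine h3.trans ?_
  have h4 := setLIntegral_comp_homothety_le μ (hF.pow_const p) (convex_ball z r)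
    Metric.isOpen_ball.measurableSet hx ht
  have hp0 : 0 < p := hpq.pos
  refine (mul_le_mul_left (ENNReal.rpow_le_rpow h4 (by positivity)) _).trans (le_of_eq ?_)
  rw [ENNReal.mul_rpow_of_nonneg _ _ (by positivity), ENNReal.ofReal_rpow_of_nonneg
    (Real.rpow_nonneg ht.1.le _) (by positivity), ← Real.rpow_mul ht.1.le, mul_one_div]
  ring

/-- Morrey's inequality on balls. -/
theorem exists_morrey_const {p : ℝ} (hp : (Module.finrank ℝ E : ℝ) < p) (hp1 : 1 < p) :
    ∃ C : ℝ, 0 ≤ C ∧ ∀ w : E → ℝ, ContDiff ℝ 1 w → ∀ (z : E) (r M : ℝ), 0 < r → 0 ≤ M →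
      ∫⁻ y in Metric.ball z r, ‖fderiv ℝ w y‖ₑ ^ p ∂μ ≤ ENNReal.ofReal M →
      ∀ x ∈ Metric.ball z r, ∀ y ∈ Metric.ball z r,
        |w x - w y| ≤ C * r ^ (1 - (Module.finrank ℝ E : ℝ) / p) * M ^ (1 / p) := by
  have hp0 : 0 < p := by linarith
  set n : ℝ := ((Module.finrank ℝ E : ℕ) : ℝ) with hn
  have hpq : p.HolderConjugate (p / (p - 1)) := Real.HolderConjugate.conjExponent hp1
  set q := p / (p - 1)
  have hq : 1 / q = 1 - 1 / p := by simp only [q]; field_simp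
  set c : ℝ≥0∞ := ∫⁻ t in Ioc (0 : ℝ) 1, ENNReal.ofReal (t ^ (-n / p))
  -- Integrability of `t ^ (-n / p)` at zero needs `n < p`: the only use of `p` exceeding the
  -- dimension in the inequality.
  have hc : c ≠ ∞ := by
    have h1 : IntegrableOn (fun t : ℝ => t ^ (-n / p)) (Ioc 0 1) :=
      (intervalIntegrable_iff_integrableOn_Ioc_of_le zero_le_one).1
        (intervalIntegral.intervalIntegrable_rpow' (by
          rw [neg_div, neg_lt_neg_iff, div_lt_one hp0]; exact hp))
    exact h1.lintegral_lt_top.ne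
  set v : ℝ := μ.real (Metric.ball (0 : E) 1)
  have hv : 0 < v := ENNReal.toReal_pos (Metric.measure_ball_pos μ _ one_pos).ne'
    measure_ball_lt_top.ne
  refine ⟨4 * c.toReal * v ^ (-(1 / p)), by positivity, fun w hw z r M hr hM hN x hx y hy => ?_⟩
  have hV : μ (Metric.ball z r) = ENNReal.ofReal (r ^ n * v) := by
    rw [Measure.addHaar_ball_of_pos μ z hr, ENNReal.ofReal_mul (by positivity), Real.rpow_natCast,
      ofReal_measureReal measure_ball_lt_top.ne]
  set V := r ^ n * v
  have hV0 : 0 < V := by positivity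
  have hone : ∀ x ∈ Metric.ball z r, ∫⁻ y in Metric.ball z r, ‖w y - w x‖ₑ ∂μ ≤
      ENNReal.ofReal (2 * r * (V ^ (1 / q) * M ^ (1 / p) * c.toReal)) := fun x hx => by
    refine (lintegral_ball_enorm_sub_le μ hpq hw hx).trans ?_
    have hq0 : 0 < 1 / q := one_div_pos.2 hpq.symm.pos
    rw [ENNReal.ofReal_mul (p := 2 * r) (by positivity),
      ENNReal.ofReal_mul (q := c.toReal) (by positivity),
      ENNReal.ofReal_mul (q := M ^ (1 / p)) (by positivity), ENNReal.ofReal_toReal hc, hV,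
      ENNReal.ofReal_rpow_of_pos hV0, ← ENNReal.ofReal_rpow_of_nonneg hM (by positivity)]
    gcongr
  -- Average `|w x - w y| ≤ |w a - w x| + |w a - w y|` over `a` in the ball.
  have h1 : ENNReal.ofReal (|w x - w y| * V) ≤
      ENNReal.ofReal (2 * (2 * r * (V ^ (1 / q) * M ^ (1 / p) * c.toReal))) := by
    rw [two_mul, ENNReal.ofReal_add (by positivity) (by positivity)]
    refine le_trans ?_ (add_le_add (hone x hx) (hone y hy))
    rw [← lintegral_add_left (by have := hw.continuous; fun_prop), ENNReal.ofReal_mul (abs_nonneg _),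
      ← hV, ← setLIntegral_const]
    refine lintegral_mono fun a => ?_
    rw [← Real.norm_eq_abs, ofReal_norm, ← enorm_neg (w a - w x)]
    refine le_trans (le_of_eq ?_) (enorm_add_le _ _)
    congr 1; ring
  rw [ENNReal.ofReal_le_ofReal_iff (by positivity)] at h1
  have h2 : |w x - w y| ≤ 2 * (2 * r * (V ^ (1 / q) * M ^ (1 / p) * c.toReal)) / V :=
    (le_div_iff₀ hV0).2 h1
  refine h2.trans (le_of_eq ?_)
  have e1 : V ^ (1 / q) / V = r ^ (-n / p) * v ^ (-(1 / p)) := by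
    rw [hq, Real.rpow_sub hV0, Real.rpow_one, div_right_comm, div_self hV0.ne', one_div,
      ← Real.rpow_neg hV0.le, Real.mul_rpow (by positivity) hv.le, ← Real.rpow_mul hr.le]
    congr 2; ring
  have e2 : r ^ (1 - n / p) = r * r ^ (-n / p) := by
    rw [sub_eq_add_neg, Real.rpow_add hr, Real.rpow_one, neg_div]
  rw [e2]
  calc _ = 4 * r * (V ^ (1 / q) / V) * M ^ (1 / p) * c.toReal := by ring
    _ = _ := by rw [e1]; ring

end Morrey

/-! ### The continuous version of the density. -/

section ContinuousVersion

/-- A function that is locally uniformly continuous up to null sets has a continuous version. -/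
theorem exists_continuousOn_ae_eq {X Y : Type*} [UniformSpace X] [SecondCountableTopology X]
    [MeasurableSpace X] {m : Measure X} [m.IsOpenPosMeasure] [UniformSpace Y]
    [CompleteSpace Y] [T2Space Y] {Ω : Set X} {f : X → Y}
    (h : ∀ x ∈ Ω, ∃ U S, IsOpen U ∧ x ∈ U ∧ (∀ᵐ y ∂m, y ∈ U → y ∈ S) ∧
      UniformContinuousOn f (S ∩ U)) :
    ∃ f' : X → Y, ContinuousOn f' Ω ∧ ∀ᵐ x ∂m, x ∈ Ω → f' x = f x := by
  choose! U S hU hxU hS hf using h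
  obtain ⟨t, ht, htc, htU⟩ := countable_cover_nhdsWithin (s := Ω) (f := U) fun x hx =>
    mem_nhdsWithin_of_mem_nhds ((hU x hx).mem_nhds (hxU x hx))
  -- A countable subcover yields one set of full measure for all points. It is dense, and `f` has
  -- limits along it by local uniform continuity.
  set A : Set X := {y | ∀ x ∈ t, y ∈ U x → y ∈ S x} with hA
  have hAae : ∀ᵐ y ∂m, y ∈ A := (ae_ball_iff htc).2 fun x hx => hS x (ht hx)
  have hAd : Dense A := Measure.dense_of_ae hAae
  have hlim : ∀ x ∈ Ω, ∃ y, Tendsto f (𝓝[A] x) (𝓝 y) := fun x hx => by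
    obtain ⟨z, hz, hxz⟩ := mem_iUnion₂.1 (htU hx)
    have h1 : 𝓝[A] x = 𝓝[A ∩ U z] x := by
      rw [nhdsWithin_inter_of_mem']
      exact mem_nhdsWithin_of_mem_nhds ((hU z (ht hz)).mem_nhds hxz)
    have : (𝓝[A] x).NeBot := mem_closure_iff_nhdsWithin_neBot.1 (hAd x)
    have h2 : Cauchy (𝓝[A] x) := cauchy_nhds.mono nhdsWithin_le_nhds
    refine cauchy_map_iff_exists_tendsto.1 (h2.map_of_le (hf z (ht hz)) ?_)
    rw [h1, le_principal_iff]
    filter_upwards [self_mem_nhdsWithin] with y hy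
    exact ⟨hy.1 z hz hy.2, hy.2⟩
  refine ⟨extendFrom A f, continuousOn_extendFrom (fun x _ => hAd x) hlim, ?_⟩
  filter_upwards [hAae] with x hxA hx
  obtain ⟨y, hy⟩ := hlim x hx
  have h1 : y = f x := tendsto_nhds_unique
    (hy.mono_left (pure_le_nhdsWithin hxA)) (tendsto_pure_nhds f x)
  rw [extendFrom_eq (hAd x) hy, h1]

variable {d : ℕ} {Ω : Opens (EuclideanSpace ℝ (Fin d))}
  {A : EuclideanSpace ℝ (Fin d) → Matrix (Fin d) (Fin d) ℝ}
  {ϱ : EuclideanSpace ℝ (Fin d) → ℝ} {p : ℝ≥0∞}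

theorem norm_fderiv_le_sum (w : EuclideanSpace ℝ (Fin d) → ℝ) (x : EuclideanSpace ℝ (Fin d)) :
    ‖fderiv ℝ w x‖ ≤ ∑ i, |partialDeriv i w x| := by
  refine ContinuousLinearMap.opNorm_le_bound _ (Finset.sum_nonneg fun i _ => abs_nonneg _)
    fun v => ?_
  have h1 : fderiv ℝ w x v = ∑ i, v i * partialDeriv i w x := by
    have h2 := (EuclideanSpace.basisFun (Fin d) ℝ).sum_repr v
    conv_lhs => rw [← h2]
    simp [partialDeriv]
  rw [h1, Finset.sum_mul]
  refine (norm_sum_le _ _).trans (Finset.sum_le_sum fun i _ => ?_)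
  rw [norm_mul, mul_comm]
  exact mul_le_mul_of_nonneg_left (PiLp.norm_apply_le v i) (norm_nonneg _)

theorem integrable_mollify {ψ : ContDiffBump (0 : EuclideanSpace ℝ (Fin d))}
    {u : EuclideanSpace ℝ (Fin d) → ℝ} (hu : Integrable u) : Integrable (mollify ψ u) :=
  (ψ.integrable_normed).integrable_convolution _ hu

theorem integral_mollify (ψ : ContDiffBump (0 : EuclideanSpace ℝ (Fin d)))
    {u : EuclideanSpace ℝ (Fin d) → ℝ} (hu : Integrable u) :
    ∫ x, mollify ψ u x = ∫ x, u x := by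
  rw [mollify, integral_convolution _ ψ.integrable_normed hu, ψ.integral_normed]
  simp

/-- The left side is the `p`-th power of a derivative of `(a + ε)^{1/p}`. The factor `(a +
ε)^{-(p-1)}` cancels the weight in the Hölder bound, leaving an estimate independent of `ε`. -/
theorem abs_rpow_mul_le {p a b G ε : ℝ} (hp : 1 < p) (ha : 0 ≤ a) (hε : 0 < ε) (hG : 0 ≤ G)
    (h : |b| ^ p ≤ G * a ^ (p - 1)) : |1 / p * (a + ε) ^ (1 / p - 1) * b| ^ p ≤ G := by
  have hp0 : 0 < p := by linarith
  have haε : 0 < a + ε := by linarith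
  rw [abs_mul, abs_mul, abs_of_nonneg (by positivity), abs_of_nonneg (Real.rpow_nonneg haε.le (1 / p - 1)),
    Real.mul_rpow (by positivity) (abs_nonneg _), Real.mul_rpow (by positivity) (by positivity),
    ← Real.rpow_mul haε.le]
  have e : (1 / p - 1) * p = -(p - 1) := by field_simp; ring
  rw [e, Real.rpow_neg haε.le]
  have h1 : (1 / p) ^ p ≤ 1 := Real.rpow_le_one (by positivity) ((div_le_one hp0).2 hp.le) hp0.le
  have h2 : a ^ (p - 1) ≤ (a + ε) ^ (p - 1) := Real.rpow_le_rpow ha (by linarith) (by linarith)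
  have h3 : 0 < (a + ε) ^ (p - 1) := by positivity
  have h4 : |b| ^ p ≤ G * (a + ε) ^ (p - 1) := h.trans (by gcongr)
  calc (1 / p) ^ p * ((a + ε) ^ (p - 1))⁻¹ * |b| ^ p
      ≤ 1 * ((a + ε) ^ (p - 1))⁻¹ * (G * (a + ε) ^ (p - 1)) := by gcongr
    _ = G := by field_simp

namespace EllipticConditions

/-- The density of the `q`-th power of a logarithmic derivative, restricted to a compact set. -/
theorem integrable_indicator_logPartial_rpow (h : EllipticConditions Ω A ϱ p) (i : Fin d)
    {q : ℝ} (hq0 : 0 < q) (hq : ENNReal.ofReal q ≤ p) {K : Set (EuclideanSpace ℝ (Fin d))}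
    (hK : IsCompact K) (hKΩ : K ⊆ Ω) :
    Integrable (K.indicator fun x => ϱ x * |logPartial Ω ϱ i x| ^ q) := by
  rw [integrable_indicator_iff hK.measurableSet]
  have := h.isDensity.isFiniteMeasure_restrict hK hKΩ
  have h1 := ((h.memLpLoc_logPartial i K hK hKΩ).mono_exponent hq).integrable_norm_rpow
    (ENNReal.ofReal_pos.2 hq0).ne' ENNReal.ofReal_ne_top
  rw [ENNReal.toReal_ofReal hq0.le] at h1
  exact h.isDensity.integrableOn_mul hK hKΩ h1

theorem integrable_indicator_density (h : EllipticConditions Ω A ϱ p)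
    {K : Set (EuclideanSpace ℝ (Fin d))} (hK : IsCompact K) (hKΩ : K ⊆ Ω) :
    Integrable (K.indicator ϱ) :=
  (integrable_indicator_iff hK.measurableSet).2
    (h.isDensity.locallyIntegrableOn.integrableOn_compact_subset hKΩ hK)

theorem ae_density_pos (h : EllipticConditions Ω A ϱ p) : ∀ᵐ x, x ∈ Ω → 0 < ϱ x :=
  (ae_restrict_iff' Ω.isOpen.measurableSet).1 h.density_pos

theorem ae_indicator_density_nonneg (h : EllipticConditions Ω A ϱ p)
    {K : Set (EuclideanSpace ℝ (Fin d))} (hKΩ : K ⊆ Ω) : ∀ᵐ x, 0 ≤ K.indicator ϱ x := by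
  filter_upwards [h.ae_density_pos] with x hx
  exact indicator_apply_nonneg fun hxK => (hx (hKΩ hxK)).le

theorem ae_indicator_logPartial_nonneg (h : EllipticConditions Ω A ϱ p) (i : Fin d) (q : ℝ)
    {K : Set (EuclideanSpace ℝ (Fin d))} (hKΩ : K ⊆ Ω) :
    ∀ᵐ x, 0 ≤ K.indicator (fun x => ϱ x * |logPartial Ω ϱ i x| ^ q) x := by
  filter_upwards [h.ae_density_pos] with x hx
  exact indicator_apply_nonneg fun hxK =>
    mul_nonneg (hx (hKΩ hxK)).le (Real.rpow_nonneg (abs_nonneg _) _)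

/-- The derivatives of a mollified density are controlled by the logarithmic derivatives. -/
theorem abs_partialDeriv_mollify_rpow_le (h : EllipticConditions Ω A ϱ p) (i : Fin d)
    {q : ℝ} (hq1 : 1 < q) (hq : ENNReal.ofReal q ≤ p) {K : Set (EuclideanSpace ℝ (Fin d))}
    (hK : IsCompact K) (hKΩ : K ⊆ Ω) {ψ : ContDiffBump (0 : EuclideanSpace ℝ (Fin d))}
    {x : EuclideanSpace ℝ (Fin d)} (hx : Metric.closedBall x ψ.rOut ⊆ K) :
    |partialDeriv i (mollify ψ (K.indicator ϱ)) x| ^ q ≤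
      mollify ψ (K.indicator fun x => ϱ x * |logPartial Ω ϱ i x| ^ q) x *
        mollify ψ (K.indicator ϱ) x ^ (q - 1) := by
  have hq0 : 0 < q := by linarith
  rw [(h.isWeakPartial_density i).partialDeriv_mollify hK hKΩ hx]
  refine abs_mollify_rpow_le hq1 (h.integrable_indicator_logPartial_rpow i hq0 hq hK hKΩ)
    (h.integrable_indicator_density hK hKΩ) (h.ae_indicator_logPartial_nonneg i q hKΩ)
    (h.ae_indicator_density_nonneg hKΩ) ?_ x
  filter_upwards [h.ae_density_pos] with y hy
  by_cases hyK : y ∈ K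
  · have hpos := hy (hKΩ hyK)
    simp only [indicator_of_mem hyK]
    rw [Real.mul_rpow hpos.le (by positivity), ← Real.rpow_mul (abs_nonneg _),
      mul_one_div_cancel hq0.ne', Real.rpow_one, mul_right_comm, ← Real.rpow_add hpos,
      add_sub_cancel, Real.rpow_one, logPartial, abs_div, abs_of_pos hpos,
      mul_div_cancel₀ _ hpos.ne']
  · simp only [indicator_of_notMem hyK, abs_zero]
    rw [Real.zero_rpow (by positivity), zero_mul]

/-- The `p`-th power of the gradient of `ϱ^{1/p}` is controlled by `ϱ |∇ϱ/ϱ|^p`, which is locally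
integrable. The roots of mollified densities therefore satisfy Morrey's inequality with one
constant, and its Hölder bound survives at points where the mollifications converge. -/
theorem exists_uniformContinuousOn_rpow (h : EllipticConditions Ω A ϱ p) (hdp : (d : ℝ≥0∞) < p)
    (hp_top : p ≠ ∞) (hp1 : 1 < p) {x₀ : EuclideanSpace ℝ (Fin d)} (hx₀ : x₀ ∈ Ω) :
    ∃ U S, IsOpen U ∧ x₀ ∈ U ∧ (∀ᵐ y, y ∈ U → y ∈ S) ∧
      UniformContinuousOn (fun x => ϱ x ^ (1 / p.toReal)) (S ∩ U) := by
  obtain ⟨r₀, hr₀, hr₀Ω⟩ := Metric.nhds_basis_closedBall.mem_iff.1 (Ω.isOpen.mem_nhds hx₀)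
  obtain ⟨R, hR, rfl⟩ : ∃ R : ℝ, 0 < R ∧ r₀ = 3 * R := ⟨r₀ / 3, by positivity, by ring⟩
  set K := Metric.closedBall x₀ (3 * R) with hK_def
  have hK : IsCompact K := isCompact_closedBall _ _
  set q := p.toReal with hq
  have hqp : ENNReal.ofReal q = p := ENNReal.ofReal_toReal hp_top
  have hq1 : 1 < q := by
    rw [hq, ← ENNReal.toReal_one]; exact (ENNReal.toReal_lt_toReal (by simp) hp_top).2 hp1
  have hdq : (d : ℝ) < q := by
    rw [hq, ← ENNReal.toReal_natCast]; exact (ENNReal.toReal_lt_toReal (by simp) hp_top).2 hdp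
  have hq0 : 0 < q := by linarith
  set ρ := K.indicator ϱ
  set γ : Fin d → EuclideanSpace ℝ (Fin d) → ℝ := fun i =>
    K.indicator fun x => ϱ x * |logPartial Ω ϱ i x| ^ q
  have hρ : Integrable ρ := h.integrable_indicator_density hK hr₀Ω
  have hρ0 : ∀ᵐ x, 0 ≤ ρ x := h.ae_indicator_density_nonneg hr₀Ω
  have hγ : ∀ i, Integrable (γ i) := fun i =>
    h.integrable_indicator_logPartial_rpow i hq0 hqp.le hK hr₀Ω
  have hγ0 : ∀ i, ∀ᵐ x, 0 ≤ γ i x := fun i => h.ae_indicator_logPartial_nonneg i q hr₀Ω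
  obtain ⟨ψ, hψ0, hψ2, hψR⟩ := exists_bump_seq (d := d) hR
  set ε : ℕ → ℝ := fun n => 1 / ((n : ℝ) + 1)
  have hε : ∀ n, 0 < ε n := fun n => by positivity
  have hε0 : Tendsto ε atTop (𝓝 0) := tendsto_one_div_add_atTop_nhds_zero_nat
  have hρn : ∀ n x, 0 ≤ mollify (ψ n) ρ x := fun n x => mollify_nonneg hρ0 x
  have hsmooth : ∀ n, ContDiff ℝ (⊤ : ℕ∞) (mollify (ψ n) ρ) := fun n =>
    contDiff_mollify hρ.locallyIntegrable
  -- Adding `ε n > 0` keeps the root differentiable where the mollified density vanishes.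
  set w : ℕ → EuclideanSpace ℝ (Fin d) → ℝ := fun n x => (mollify (ψ n) ρ x + ε n) ^ (1 / q)
  have hw : ∀ n, ContDiff ℝ 1 (w n) := fun n =>
    (((hsmooth n).of_le (by exact_mod_cast le_top)).add contDiff_const).rpow_const_of_ne fun x =>
      (add_pos_of_nonneg_of_pos (hρn n x) (hε n)).ne'
  -- The factor `d ^ (q - 1)` comes from the power mean inequality over the `d` coordinates.
  -- Mollification preserves integrals, so `M` does not depend on `n`.
  set M : ℝ := (d : ℝ) ^ (q - 1) * ∑ i, ∫ x, γ i x with hM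
  have hM0 : 0 ≤ M := mul_nonneg (by positivity)
    (Finset.sum_nonneg fun i _ => integral_nonneg_of_ae (hγ0 i))
  have hgrad : ∀ n, ∀ x ∈ Metric.ball x₀ (2 * R), ‖fderiv ℝ (w n) x‖ ^ q ≤
      (d : ℝ) ^ (q - 1) * ∑ i, mollify (ψ n) (γ i) x := by
    intro n x hx
    have hball : Metric.closedBall x (ψ n).rOut ⊆ K := by
      refine Metric.closedBall_subset_closedBall' ?_
      have := Metric.mem_ball.1 hx
      linarith [hψR n]
    refine (Real.rpow_le_rpow (norm_nonneg _) (norm_fderiv_le_sum (w n) x) hq0.le).trans ?_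
    refine (Real.rpow_sum_le_const_mul_sum_rpow _ _ hq1.le).trans ?_
    rw [Finset.card_univ, Fintype.card_fin]
    refine mul_le_mul_of_nonneg_left (Finset.sum_le_sum fun i _ => ?_) (by positivity)
    have hpos : mollify (ψ n) ρ x + ε n ≠ 0 := (add_pos_of_nonneg_of_pos (hρn n x) (hε n)).ne'
    have hd1 : HasDerivAt (fun s : ℝ => (s + ε n) ^ (1 / q))
        (1 / q * (mollify (ψ n) ρ x + ε n) ^ (1 / q - 1)) (mollify (ψ n) ρ x) := by
      simpa using ((hasDerivAt_id (mollify (ψ n) ρ x)).add_const (ε n)).rpow_const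
        (p := 1 / q) (Or.inl hpos)
    have h1 : partialDeriv i (w n) x = 1 / q * (mollify (ψ n) ρ x + ε n) ^ (1 / q - 1) *
        partialDeriv i (mollify (ψ n) ρ) x := by
      rw [← hd1.deriv]
      exact partialDeriv_comp hd1.differentiableAt ((hsmooth n).differentiable (by simp) x)
    rw [h1]
    exact abs_rpow_mul_le hq1 (hρn n x) (hε n) (mollify_nonneg (hγ0 i) x)
      (h.abs_partialDeriv_mollify_rpow_le i hq1 hqp.le hK hr₀Ω hball)
  have hlint : ∀ n, ∀ z r, Metric.ball z r ⊆ Metric.ball x₀ (2 * R) →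
      ∫⁻ y in Metric.ball z r, ‖fderiv ℝ (w n) y‖ₑ ^ q ≤ ENNReal.ofReal M := by
    intro n z r hzr
    have hi : Integrable fun x => (d : ℝ) ^ (q - 1) * ∑ i, mollify (ψ n) (γ i) x :=
      (integrable_finsetSum _ fun i _ => integrable_mollify (hγ i)).const_mul _
    have hnn : ∀ x, 0 ≤ (d : ℝ) ^ (q - 1) * ∑ i, mollify (ψ n) (γ i) x := fun x =>
      mul_nonneg (by positivity) (Finset.sum_nonneg fun i _ => mollify_nonneg (hγ0 i) x)
    have e : M = ∫ x, (d : ℝ) ^ (q - 1) * ∑ i, mollify (ψ n) (γ i) x := by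
      rw [integral_const_mul, integral_finsetSum _ fun i _ => integrable_mollify (hγ i)]
      simp_rw [integral_mollify _ (hγ _)]
      rfl
    rw [e, ofReal_integral_eq_lintegral_ofReal hi (Eventually.of_forall hnn)]
    refine (setLIntegral_mono' Metric.isOpen_ball.measurableSet fun x hx => ?_).trans
      (setLIntegral_le_lintegral _ _)
    rw [← ofReal_norm, ENNReal.ofReal_rpow_of_nonneg (norm_nonneg _) hq0.le]
    exact ENNReal.ofReal_le_ofReal (hgrad n x (hzr hx))
  obtain ⟨C, hC0, hC⟩ := exists_morrey_const (E := EuclideanSpace ℝ (Fin d)) volume (p := q)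
    (by rw [finrank_euclideanSpace_fin]; exact hdq) hq1
  rw [finrank_euclideanSpace_fin] at hC
  set a : ℝ := 1 - d / q
  have ha : 0 < a := sub_pos.2 ((div_lt_one hq0).2 hdq)
  refine ⟨Metric.ball x₀ R, {x | Tendsto (fun n => mollify (ψ n) ρ x) atTop (𝓝 (ρ x))},
    Metric.isOpen_ball, Metric.mem_ball_self hR,
    (tendsto_mollify_ae hψ0 hψ2 hρ.locallyIntegrable).mono fun x hx _ => hx, ?_⟩
  rw [Metric.uniformContinuousOn_iff]
  intro η hη
  have hlim : Tendsto (fun r : ℝ => C * r ^ a * M ^ (1 / q)) (𝓝[>] 0) (𝓝 0) := by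
    have h1 : Tendsto (fun r : ℝ => r ^ a) (𝓝[>] 0) (𝓝 0) := by
      have := (Real.continuous_rpow_const ha.le).tendsto 0
      rw [Real.zero_rpow ha.ne'] at this
      exact this.mono_left nhdsWithin_le_nhds
    simpa using (h1.const_mul C).mul_const (M ^ (1 / q))
  obtain ⟨r, hr, hr0, hrR⟩ := ((hlim.eventually_lt_const hη).and
    (Ioo_mem_nhdsGT hR)).exists
  refine ⟨r, hr0, fun x hx y hy hxy => ?_⟩
  have hsub : Metric.ball x r ⊆ Metric.ball x₀ (2 * R) := by
    refine Metric.ball_subset_ball' ?_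
    have := Metric.mem_ball.1 hx.2
    linarith
  have hlimw : ∀ x ∈ {x | Tendsto (fun n => mollify (ψ n) ρ x) atTop (𝓝 (ρ x))} ∩
      Metric.ball x₀ R, Tendsto (fun n => w n x) atTop (𝓝 (ϱ x ^ (1 / q))) := by
    intro x hx
    have h1 := hx.1
    have h2 : ρ x = ϱ x := indicator_of_mem (by
      have := Metric.mem_ball.1 hx.2
      exact Metric.mem_closedBall.2 (by linarith)) _
    rw [mem_ofPred_eq, h2] at h1
    have h3 := h1.add hε0
    rw [add_zero] at h3
    exact ((Real.continuous_rpow_const (one_div_pos.2 hq0).le).tendsto _).comp h3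
  refine lt_of_le_of_lt ?_ hr
  rw [Real.dist_eq]
  refine le_of_tendsto ((hlimw x hx).sub (hlimw y hy)).abs (Eventually.of_forall fun n => ?_)
  exact hC (w n) (hw n) x r M hr0 hM0 (hlint n x r hsub) x (Metric.mem_ball_self hr0) y
    (Metric.mem_ball'.2 hxy)

/-- The density has a continuous version. -/
theorem exists_continuous_version (h : EllipticConditions Ω A ϱ p) (hdp : (d : ℝ≥0∞) < p)
    (hp_top : p ≠ ∞) (hp1 : 1 < p) : ∃ ϱ' : EuclideanSpace ℝ (Fin d) → ℝ,
      ContinuousOn ϱ' Ω ∧ ϱ' =ᵐ[densityMeasure Ω ϱ] ϱ := by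
  obtain ⟨f, hf, hfϱ⟩ := exists_continuousOn_ae_eq (m := volume) fun x (hx : x ∈ Ω) =>
    h.exists_uniformContinuousOn_rpow hdp hp_top hp1 hx
  have hq0 : 0 < p.toReal := ENNReal.toReal_pos (zero_lt_one.trans hp1).ne' hp_top
  refine ⟨fun x => f x ^ p.toReal, hf.rpow_const fun x _ => Or.inr hq0.le, ?_⟩
  filter_upwards [ae_densityMeasure_of_ae_volume (Ω := Ω) hfϱ, ae_mem_densityMeasure,
    ae_densityMeasure_of_ae h.density_pos] with x h1 h2 h3
  rw [h1 h2, ← Real.rpow_mul h3.le, one_div_mul_cancel hq0.ne', Real.rpow_one]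

end EllipticConditions

end ContinuousVersion

/-! ### Logarithms of the density with bounded energy. -/

section Capacity

/-- Apply `log a ≤ a` to `a = t^{-1/2}`. -/
theorem mul_log_sq_le {t : ℝ} (ht0 : 0 < t) (ht1 : t ≤ 1) : t * Real.log t ^ 2 ≤ 4 := by
  have h1 : Real.log (√t)⁻¹ ≤ (√t)⁻¹ := by
    have := Real.log_le_sub_one_of_pos (inv_pos.2 (Real.sqrt_pos.2 ht0))
    linarith
  have h2 : Real.log (√t)⁻¹ = -(Real.log t / 2) := by rw [Real.log_inv, Real.log_sqrt ht0.le]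
  have h3 : Real.log t ≤ 0 := Real.log_nonpos ht0.le ht1
  rw [h2] at h1
  have h4 : |Real.log t| ≤ 2 * (√t)⁻¹ := by rw [abs_of_nonpos h3]; linarith
  have h5 : Real.log t ^ 2 ≤ (2 * (√t)⁻¹) ^ 2 := by rw [← sq_abs]; gcongr
  calc t * Real.log t ^ 2 ≤ t * (2 * (√t)⁻¹) ^ 2 := by gcongr
    _ = 4 := by
      rw [mul_pow, inv_pow, Real.sq_sqrt ht0.le]
      field_simp
      norm_num

variable {d : ℕ} {Ω : Opens (EuclideanSpace ℝ (Fin d))}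
  {A : EuclideanSpace ℝ (Fin d) → Matrix (Fin d) (Fin d) ℝ}
  {ϱ : EuclideanSpace ℝ (Fin d) → ℝ} {p : ℝ≥0∞}

theorem mollify_congr {ψ : ContDiffBump (0 : EuclideanSpace ℝ (Fin d))}
    {u v : EuclideanSpace ℝ (Fin d) → ℝ} (h : u =ᵐ[volume] v) : mollify ψ u = mollify ψ v := by
  funext x
  rw [mollify_apply, mollify_apply]
  exact integral_congr_ae (h.mono fun t ht => by simp only [ht])

theorem quadratic_le {B : Matrix (Fin d) (Fin d) ℝ} {C : ℝ} (hC : ∑ i, ∑ j, |B i j| ≤ C)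
    (ξ : Fin d → ℝ) : ∑ i, ∑ j, B i j * ξ i * ξ j ≤ C * ∑ i, ξ i ^ 2 := by
  have h1 : ∀ i j, B i j * ξ i * ξ j ≤ |B i j| * ∑ l, ξ l ^ 2 := fun i j => by
    have hi : ξ i ^ 2 ≤ ∑ l, ξ l ^ 2 :=
      Finset.single_le_sum (fun l _ => sq_nonneg (ξ l)) (Finset.mem_univ i)
    have hj : ξ j ^ 2 ≤ ∑ l, ξ l ^ 2 :=
      Finset.single_le_sum (fun l _ => sq_nonneg (ξ l)) (Finset.mem_univ j)
    have h2 : |ξ i * ξ j| ≤ ∑ l, ξ l ^ 2 := by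
      rw [abs_mul]
      nlinarith [sq_nonneg (|ξ i| - |ξ j|), sq_abs (ξ i), sq_abs (ξ j)]
    rw [mul_assoc]
    refine (le_abs_self _).trans ?_
    rw [abs_mul]
    exact mul_le_mul_of_nonneg_left h2 (abs_nonneg _)
  calc ∑ i, ∑ j, B i j * ξ i * ξ j ≤ ∑ i, ∑ j, |B i j| * ∑ l, ξ l ^ 2 :=
        Finset.sum_le_sum fun i _ => Finset.sum_le_sum fun j _ => h1 i j
    _ = (∑ i, ∑ j, |B i j|) * ∑ l, ξ l ^ 2 := by simp_rw [Finset.sum_mul]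
    _ ≤ C * ∑ l, ξ l ^ 2 :=
        mul_le_mul_of_nonneg_right hC (Finset.sum_nonneg fun l _ => sq_nonneg _)

theorem EllipticConditions.exists_quadratic_bound (h : EllipticConditions Ω A ϱ p)
    {K : Set (EuclideanSpace ℝ (Fin d))} (hK : IsCompact K) (hKΩ : K ⊆ Ω) :
    ∃ C : ℝ, 0 ≤ C ∧ ∀ᵐ x, x ∈ K → ∀ ξ : Fin d → ℝ,
      ∑ i, ∑ j, A x i j * ξ i * ξ j ≤ C * ∑ i, ξ i ^ 2 := by
  obtain ⟨C, hC⟩ : AEBddOn K fun x => ∑ i, ∑ j, |A x i j| :=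
    .sum _ fun i => .sum _ fun j => (h.aebddOn_coeff i j hK hKΩ).imp fun C hC => by
      simpa only [abs_abs] using hC
  refine ⟨max C 0, le_max_right _ _, ?_⟩
  filter_upwards [hC] with x hx hxK ξ
  exact quadratic_le ((le_abs_self _).trans ((hx hxK).trans (le_max_left _ _))) ξ

namespace IsGradientCompletion

variable {h : EllipticConditions Ω A ϱ p} {V : Type*} [NormedAddCommGroup V]
  [InnerProductSpace ℝ V] {ι : V →L[ℝ] Lp ℝ 2 (densityMeasure Ω ϱ)}
  {k : TestFunction Ω ℝ ⊤ →ₗ[ℝ] V}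

theorem norm_sq_le_integral (hc : IsGradientCompletion h ι k) (f : TestFunction Ω ℝ ⊤)
    {H : EuclideanSpace ℝ (Fin d) → ℝ} (hH : Integrable H) (hH0 : ∀ x, 0 ≤ H x)
    (hfH : ∀ᵐ x, x ∈ Ω → ϱ x * (gradientDensity A f f x + f x * f x) ≤ H x) :
    ‖k f‖ ^ 2 ≤ ∫ x, H x := by
  have i2 : Integrable (fun x => f x * f x) (densityMeasure Ω ϱ) := by
    simpa only [sq] using (h.isDensity.memLp_testFunction f 2).integrable_sq
  have i3 := (h.integrable_gradientDensity f f).add i2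
  rw [hc.norm_sq_eq_integral, ← integral_add (h.integrable_gradientDensity f f) i2,
    h.isDensity.integral_eq]
  refine (setIntegral_mono_ae_restrict (h.isDensity.integrable_iff.1 i3) hH.integrableOn
    ((ae_restrict_iff' Ω.isOpen.measurableSet).2 hfH)).trans ?_
  exact setIntegral_le_integral hH (Eventually.of_forall hH0)

/-- Truncated logarithms of the density have bounded energy. -/
theorem exists_log_testFunction (hc : IsGradientCompletion h ι k) (hp : 2 ≤ p)
    {ϱ' : EuclideanSpace ℝ (Fin d) → ℝ} (hϱ' : ContinuousOn ϱ' Ω)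
    (hϱ : ϱ' =ᵐ[densityMeasure Ω ϱ] ϱ) {x₀ : EuclideanSpace ℝ (Fin d)} (hx₀ : x₀ ∈ Ω) :
    ∃ R M C : ℝ, 0 < R ∧ 0 ≤ M ∧ 0 ≤ C ∧ Metric.ball x₀ R ⊆ Ω ∧ ∀ ε, 0 < ε → ε ≤ 1 →
      ∃ f : TestFunction Ω ℝ ⊤, (∀ x, 0 ≤ f x) ∧ ‖k f‖ ^ 2 ≤ C ∧
        ∀ x ∈ Metric.ball x₀ R, ϱ' x < ε → Real.log ((M + 1) / (3 * ε)) ≤ f x := by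
  obtain ⟨r₀, hr₀, hKΩ⟩ := Metric.nhds_basis_closedBall.mem_iff.1 (Ω.isOpen.mem_nhds hx₀)
  obtain ⟨R, hR, rfl⟩ : ∃ R : ℝ, 0 < R ∧ r₀ = 3 * R := ⟨r₀ / 3, by positivity, by ring⟩
  set K := Metric.closedBall x₀ (3 * R)
  have hK : IsCompact K := isCompact_closedBall _ _
  have hϱϱ' : ∀ᵐ x, x ∈ Ω → ϱ' x = ϱ x :=
    (ae_restrict_iff' Ω.isOpen.measurableSet).1 (h.isDensity.ae_of_ae hϱ)
  obtain ⟨M, hM⟩ := hK.exists_bound_of_continuousOn (hϱ'.mono hKΩ)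
  have hM0 : 0 ≤ M := (norm_nonneg _).trans (hM x₀ (Metric.mem_closedBall_self (by positivity)))
  have hK2 : Metric.ball x₀ (2 * R) ⊆ K :=
    Metric.ball_subset_closedBall.trans (Metric.closedBall_subset_closedBall (by linarith))
  obtain ⟨χ, hχK, ⟨W, -, hBW, hχ1⟩, hχ⟩ := exists_cutoff (Ω := Ω) (isCompact_closedBall x₀ R)
    (Metric.isOpen_ball (x := x₀) (ε := 2 * R))
    (Metric.closedBall_subset_ball (by linarith)) (hK2.trans hKΩ)
  set T := tsupport χ
  have hT : IsCompact T := χ.hasCompactSupport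
  obtain ⟨D, hD0, hD⟩ := h.exists_gradientDensity_bound χ
  obtain ⟨B, hB0, hB⟩ := h.exists_quadratic_bound hT χ.tsupport_subset
  set ρ := K.indicator ϱ
  set γ : Fin d → EuclideanSpace ℝ (Fin d) → ℝ := fun i =>
    K.indicator fun x => ϱ x * |logPartial Ω ϱ i x| ^ (2 : ℝ)
  have h2p : ENNReal.ofReal 2 ≤ p := by simpa using hp
  have hρ : Integrable ρ := h.integrable_indicator_density hK hKΩ
  have hρ0 : ∀ᵐ x, 0 ≤ ρ x := h.ae_indicator_density_nonneg hKΩ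
  have hγ : ∀ i, Integrable (γ i) := fun i =>
    h.integrable_indicator_logPartial_rpow i two_pos h2p hK hKΩ
  have hγ0 : ∀ i, ∀ᵐ x, 0 ≤ γ i x := fun i => h.ae_indicator_logPartial_nonneg i 2 hKΩ
  have hρϱ' : ρ =ᵐ[volume] K.indicator ϱ' := by
    filter_upwards [hϱϱ'] with x hx
    by_cases hxK : x ∈ K
    · simp only [ρ, indicator_of_mem hxK, hx (hKΩ hxK)]
    · simp only [ρ, indicator_of_notMem hxK]
  have hρM : ∀ᵐ x, |ρ x| ≤ M := by
    filter_upwards [hρϱ'] with x hx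
    rw [hx]
    by_cases hxK : x ∈ K
    · rw [indicator_of_mem hxK]; exact hM x hxK
    · rw [indicator_of_notMem hxK, abs_zero]; exact hM0
  -- The bound `ϱ η² ≤ 4 (M + 1)` is used with weight `2 * D` for the gradient of the cutoff and
  -- with weight one for the square of the function. The remaining term of `C` bounds the energy of
  -- the logarithm; nothing depends on `ε`.
  set c₁ : ℝ := (2 * D + 1) * (4 * (M + 1))
  have hc₁ : 0 ≤ c₁ := by positivity
  set C : ℝ := c₁ * volume.real T + 2 * B * ∑ i, ∫ x, γ i x with hC
  refine ⟨R, M, C, hR, hM0, add_nonneg (by positivity) (mul_nonneg (by positivity)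
    (Finset.sum_nonneg fun i _ => integral_nonneg_of_ae (hγ0 i))),
    (Metric.ball_subset_ball (by linarith)).trans (hK2.trans hKΩ), fun ε hε hε1 => ?_⟩
  -- Uniform continuity of `ϱ'` lets the mollification radius be chosen so that `s` is within `ε` of
  -- `ϱ'`. Hence `ϱ ≤ s + ε` almost everywhere on the support of the cutoff.
  obtain ⟨δ, hδ, hδϱ⟩ := Metric.uniformContinuousOn_iff.1
    (hK.uniformContinuousOn_of_continuous (hϱ'.mono hKΩ)) ε hε
  obtain ⟨ψs, -, -, hψs⟩ := exists_bump_seq (d := d) (lt_min hδ hR)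
  set ψ := ψs 0
  have hψδ : ψ.rOut ≤ δ := (hψs 0).trans (min_le_left _ _)
  have hψR : ψ.rOut ≤ R := (hψs 0).trans (min_le_right _ _)
  set s := mollify ψ ρ
  have hs0 : ∀ x, 0 ≤ s x := mollify_nonneg hρ0
  have hsM : ∀ x, s x ≤ M := fun x => (le_abs_self _).trans (abs_mollify_le hρM x)
  have hsmooth : ContDiff ℝ (⊤ : ℕ∞) s := contDiff_mollify hρ.locallyIntegrable
  have hball : ∀ x ∈ Metric.ball x₀ (2 * R), Metric.closedBall x ψ.rOut ⊆ K := by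
    intro x hx
    refine Metric.closedBall_subset_closedBall' ?_
    have := Metric.mem_ball.1 hx
    linarith
  have hsϱ : ∀ x ∈ Metric.ball x₀ (2 * R), |s x - ϱ' x| ≤ ε := by
    intro x hx
    have hxK : x ∈ K := hK2 hx
    have h1 := ContDiffBump.dist_normed_convolution_le (φ := ψ) (μ := volume) (x₀ := x)
      (g := K.indicator ϱ') (ε := ε) (hρ.aestronglyMeasurable.congr hρϱ') fun y hy => by
        have hyK : y ∈ K := hball x hx (Metric.ball_subset_closedBall hy)
        rw [indicator_of_mem hxK, indicator_of_mem hyK]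
        exact (hδϱ y hyK x hxK (lt_of_lt_of_le hy hψδ)).le
    rw [indicator_of_mem hxK, Real.dist_eq] at h1
    have h2 : s = mollify ψ (K.indicator ϱ') := mollify_congr hρϱ'
    rw [h2]
    exact h1
  have hsε : ∀ x, 0 < s x + ε := fun x => add_pos_of_nonneg_of_pos (hs0 x) hε
  -- This is nonnegative because `s ≤ M` and `ε ≤ 1`.
  set η : EuclideanSpace ℝ (Fin d) → ℝ := fun x => Real.log (M + 1) - Real.log (s x + ε)
  have hη : ContDiff ℝ (⊤ : ℕ∞) η :=
    contDiff_const.sub ((hsmooth.add contDiff_const).log fun x => (hsε x).ne')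
  have hη0 : ∀ x, 0 ≤ η x := fun x =>
    sub_nonneg.2 (Real.log_le_log (hsε x) (by linarith [hsM x]))
  refine ⟨χ.mulSmooth η hη, fun x => mul_nonneg (hχ x).1 (hη0 x), ?_, fun x hx hxε => ?_⟩
  · have hHi : Integrable fun x => T.indicator (fun _ => c₁) x + 2 * B * ∑ i, mollify ψ (γ i) x :=
      ((integrable_indicator_iff hT.measurableSet).2
        (integrableOn_const hT.measure_lt_top.ne)).add
        ((integrable_finsetSum _ fun i _ => integrable_mollify (hγ i)).const_mul _)
    have hγn : ∀ i x, 0 ≤ mollify ψ (γ i) x := fun i x => mollify_nonneg (hγ0 i) x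
    have hHn : ∀ x, 0 ≤ 2 * B * ∑ i, mollify ψ (γ i) x := fun x =>
      mul_nonneg (by positivity) (Finset.sum_nonneg fun i _ => hγn i x)
    have hHI : ∫ x, (T.indicator (fun _ => c₁) x + 2 * B * ∑ i, mollify ψ (γ i) x) = C := by
      rw [integral_add ((integrable_indicator_iff hT.measurableSet).2
        (integrableOn_const hT.measure_lt_top.ne))
        ((integrable_finsetSum _ fun i _ => integrable_mollify (hγ i)).const_mul _),
        integral_indicator_const _ hT.measurableSet, integral_const_mul,
        integral_finsetSum _ fun i _ => integrable_mollify (hγ i)]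
      simp_rw [integral_mollify _ (hγ _)]
      rw [smul_eq_mul, mul_comm]
    rw [← hHI]
    refine hc.norm_sq_le_integral _ hHi (fun x => add_nonneg
      (indicator_apply_nonneg fun _ => hc₁) (hHn x)) ?_
    have hps := (ae_restrict_iff' Ω.isOpen.measurableSet).1
      (h.isDensity.ae_of_ae (h.ae_nonneg hT χ.tsupport_subset))
    have hD' := (ae_restrict_iff' Ω.isOpen.measurableSet).1 (h.isDensity.ae_of_ae hD)
    filter_upwards [hps, hD', hB, hϱϱ', h.ae_density_pos] with x h1 h2 h3 h4 h5 hxΩ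
    by_cases hxT : x ∈ T
    swap
    · have h6 : x ∉ tsupport (χ.mulSmooth η hη) := fun h => hxT (tsupport_mul_subset_left h)
      rw [gradientDensity_eq_zero_of_notMem _ _ h6, image_eq_zero_of_notMem_tsupport h6,
        indicator_of_notMem hxT]
      simpa using hHn x
    have hxB : x ∈ Metric.ball x₀ (2 * R) := hχK hxT
    have hpos := h5 hxΩ
    have hle : ϱ x ≤ s x + ε := by
      have := (abs_le.1 (hsϱ x hxB)).1
      rw [h4 hxΩ] at this
      linarith
    have hlog : ϱ x * η x ^ 2 ≤ 4 * (M + 1) := by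
      have e1 : η x = -Real.log ((s x + ε) / (M + 1)) := by
        rw [Real.log_div (hsε x).ne' (by positivity), neg_sub]
      have e2 := mul_log_sq_le (t := (s x + ε) / (M + 1)) (div_pos (hsε x) (by positivity))
        ((div_le_one (by positivity)).2 (by linarith [hsM x]))
      rw [e1, neg_sq]
      rw [div_mul_eq_mul_div, div_le_iff₀ (by positivity)] at e2
      exact (mul_le_mul_of_nonneg_right hle (sq_nonneg _)).trans e2
    -- The two factors `(s + ε)⁻¹` from the logarithm absorb `ϱ ≤ s + ε` and the weight `s` from
    -- Hölder's inequality with exponent two, leaving the mollified `ϱ |∂ log ϱ|²`.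
    have hgrad : ϱ x * gradientDensity A η η x ≤ B * ∑ i, mollify ψ (γ i) x := by
      have hd : ∀ i, partialDeriv i η x = -(s x + ε)⁻¹ * partialDeriv i s x := fun i => by
        have hd1 : HasDerivAt (fun t : ℝ => Real.log (M + 1) - Real.log (t + ε))
            (-(s x + ε)⁻¹) (s x) := by
          simpa using (((hasDerivAt_id (s x)).add_const ε).log (hsε x).ne').const_sub
            (Real.log (M + 1))
        rw [← hd1.deriv]
        exact partialDeriv_comp hd1.differentiableAt (hsmooth.differentiable (by simp) x)
      have hi : ∀ i, ϱ x * partialDeriv i η x ^ 2 ≤ mollify ψ (γ i) x := fun i => by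
        have e1 := h.abs_partialDeriv_mollify_rpow_le i one_lt_two h2p hK hKΩ (hball x hxB)
        rw [show (2 : ℝ) - 1 = 1 by norm_num, Real.rpow_one, Real.rpow_two, sq_abs] at e1
        have e2 : partialDeriv i s x ^ 2 ≤ mollify ψ (γ i) x * (s x + ε) :=
          e1.trans (mul_le_mul_of_nonneg_left (le_add_of_nonneg_right hε.le) (hγn i x))
        rw [hd, mul_pow, neg_sq]
        have := hsε x
        calc ϱ x * ((s x + ε)⁻¹ ^ 2 * partialDeriv i s x ^ 2)
            ≤ (s x + ε) * ((s x + ε)⁻¹ ^ 2 * (mollify ψ (γ i) x * (s x + ε))) := by gcongr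
          _ = mollify ψ (γ i) x := by field_simp
      calc ϱ x * gradientDensity A η η x ≤ ϱ x * (B * ∑ i, partialDeriv i η x ^ 2) :=
            mul_le_mul_of_nonneg_left (h3 hxT _) hpos.le
        _ = B * ∑ i, ϱ x * partialDeriv i η x ^ 2 := by rw [← Finset.mul_sum]; ring
        _ ≤ _ := mul_le_mul_of_nonneg_left (Finset.sum_le_sum fun i _ => hi i) hB0
    have hprod := gradientDensity_mul_le_of_nonneg (h1 hxΩ hxT) (differentiable_testFunction χ x)
      (hη.differentiable (by simp) x)
    have hχ2 : χ x ^ 2 ≤ 1 := pow_le_one₀ (hχ x).1 (hχ x).2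
    have hS : 0 ≤ B * ∑ i, mollify ψ (γ i) x := by have := hHn x; linarith
    rw [indicator_of_mem hxT]
    change ϱ x * (gradientDensity A (fun y => χ y * η y) (fun y => χ y * η y) x +
      χ x * η x * (χ x * η x)) ≤ _
    have hL0 : 0 ≤ ϱ x * η x ^ 2 := by positivity
    have t1 : ϱ x * η x ^ 2 * gradientDensity A χ χ x ≤ 4 * (M + 1) * D :=
      (mul_le_mul_of_nonneg_left (h2 hxΩ) hL0).trans (mul_le_mul_of_nonneg_right hlog hD0)
    have t2 : χ x ^ 2 * (ϱ x * gradientDensity A η η x) ≤ B * ∑ i, mollify ψ (γ i) x :=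
      (mul_le_mul_of_nonneg_left hgrad (sq_nonneg _)).trans (mul_le_of_le_one_left hS hχ2)
    have t3 : χ x ^ 2 * (ϱ x * η x ^ 2) ≤ 4 * (M + 1) :=
      (mul_le_of_le_one_left hL0 hχ2).trans hlog
    have t4 := mul_le_mul_of_nonneg_left hprod hpos.le
    simp only [c₁]
    nlinarith
  · have hx2 : x ∈ Metric.ball x₀ (2 * R) := Metric.ball_subset_ball (by linarith) hx
    have h1 : χ x = 1 := hχ1 x (hBW (Metric.ball_subset_closedBall hx))
    have h2 := (abs_le.1 (hsϱ x hx2)).2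
    change _ ≤ χ x * η x
    rw [h1, one_mul, Real.log_div (by positivity) (by positivity)]
    -- Where `ϱ' < ε`, `s + ε ≤ ϱ' + 2 * ε < 3 * ε`.
    exact sub_le_sub_left (Real.log_le_log (hsε x) (by linarith)) _

end IsGradientCompletion

end Capacity

/-! ### The zero set of the density has capacity zero. -/

section CapacityZero

variable {d : ℕ} {Ω : Opens (EuclideanSpace ℝ (Fin d))}
  {A : EuclideanSpace ℝ (Fin d) → Matrix (Fin d) (Fin d) ℝ}
  {ϱ : EuclideanSpace ℝ (Fin d) → ℝ} {p : ℝ≥0∞}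
  {h : EllipticConditions Ω A ϱ p} {V : Type*} [NormedAddCommGroup V]
  [InnerProductSpace ℝ V] {ι : V →L[ℝ] Lp ℝ 2 (densityMeasure Ω ϱ)}
  {k : TestFunction Ω ℝ ⊤ →ₗ[ℝ] V}

theorem exists_small_log {M a : ℝ} (hM : 0 ≤ M) :
    ∃ ε : ℝ, 0 < ε ∧ ε ≤ 1 ∧ a ≤ Real.log ((M + 1) / (3 * ε)) := by
  set L := max a (Real.log ((M + 1) / 3))
  refine ⟨(M + 1) / 3 * Real.exp (-L), by positivity, ?_, ?_⟩
  · rw [Real.exp_neg, mul_inv_le_iff₀ (Real.exp_pos _), one_mul,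
      ← Real.log_le_iff_le_exp (by positivity)]
    exact le_max_right _ _
  · have e : (M + 1) / (3 * ((M + 1) / 3 * Real.exp (-L))) = Real.exp L := by
      rw [Real.exp_neg]; field_simp
    rw [e, Real.log_exp]
    exact le_max_left _ _

namespace IsGradientCompletion

/-- Near every point the zero set is contained in open sets of arbitrarily small capacity. -/
theorem exists_local_small (hc : IsGradientCompletion h ι k) (hp : 2 ≤ p)
    {ϱ' : EuclideanSpace ℝ (Fin d) → ℝ} (hϱ' : ContinuousOn ϱ' Ω)
    (hϱ : ϱ' =ᵐ[densityMeasure Ω ϱ] ϱ) {x₀ : EuclideanSpace ℝ (Fin d)} (hx₀ : x₀ ∈ Ω) :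
    ∃ U, IsOpen U ∧ x₀ ∈ U ∧ ∀ η : ℝ, 0 < η → ∃ (W : Set (EuclideanSpace ℝ (Fin d)))
      (f : TestFunction Ω ℝ ⊤), IsOpen W ∧ W ⊆ Ω ∧ (∀ x ∈ U, ϱ' x = 0 → x ∈ W) ∧
      (∀ x, 0 ≤ f x) ∧ (∀ x ∈ W, 1 ≤ f x) ∧ ‖k f‖ ≤ η := by
  obtain ⟨R, M, C, hR, hM, hC, hRΩ, H⟩ := hc.exists_log_testFunction hp hϱ' hϱ hx₀
  refine ⟨Metric.ball x₀ R, Metric.isOpen_ball, Metric.mem_ball_self hR, fun η hη => ?_⟩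
  -- With this choice `√C ≤ L * η`, so dividing by `L` brings the norm below `η`; the added one
  -- makes `L` positive.
  obtain ⟨ε, hε, hε1, hlog⟩ := exists_small_log (M := M) (a := (√C + 1) / η) hM
  obtain ⟨f, hf0, hfC, hf⟩ := H ε hε hε1
  set L := Real.log ((M + 1) / (3 * ε))
  have hL : 0 < L := lt_of_lt_of_le (by positivity) hlog
  refine ⟨Metric.ball x₀ R ∩ ϱ' ⁻¹' Iio ε, L⁻¹ • f,
    (hϱ'.mono hRΩ).isOpen_inter_preimage Metric.isOpen_ball isOpen_Iio,
    inter_subset_left.trans hRΩ, fun x hx hx0 => ⟨hx, by rw [mem_preimage, hx0]; exact hε⟩,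
    fun x => mul_nonneg (inv_nonneg.2 hL.le) (hf0 x), fun x hx => ?_, ?_⟩
  · change 1 ≤ L⁻¹ * f x
    rw [← div_eq_inv_mul, le_div_iff₀ hL, one_mul]
    exact hf x hx.1 hx.2
  · have h1 : ‖k f‖ ≤ √C := Real.le_sqrt_of_sq_le hfC
    rw [map_smul, norm_smul, norm_inv, Real.norm_of_nonneg hL.le, inv_mul_le_iff₀ hL]
    rw [div_le_iff₀ hη] at hlog
    linarith

/-- The zero set of the continuous version of the density has capacity zero. -/
theorem capacity_zero_set [CompleteSpace V] (hc : IsGradientCompletion h ι k) (hp : 2 ≤ p)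
    {ϱ' : EuclideanSpace ℝ (Fin d) → ℝ} (hϱ' : ContinuousOn ϱ' Ω)
    (hϱ : ϱ' =ᵐ[densityMeasure Ω ϱ] ϱ) :
    (embeddedForm ι hc.injective).capacity Ω {x | x ∈ Ω ∧ ϱ' x = 0} = 0 := by
  choose! U hU hxU H using fun x (hx : x ∈ Ω) => hc.exists_local_small hp hϱ' hϱ hx
  obtain ⟨t, ht, htc, htU⟩ := countable_cover_nhdsWithin
    (s := (Ω : Set (EuclideanSpace ℝ (Fin d)))) (f := U) fun x hx =>
      mem_nhdsWithin_of_mem_nhds ((hU x hx).mem_nhds (hxU x hx))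
  have : Countable t := htc.to_subtype
  refine le_antisymm (ENNReal.le_of_forall_pos_le_add fun δ hδ _ => ?_) bot_le
  rw [zero_add]
  -- The norms sum to less than `√δ`, so the squared norm of the sum is at most `δ`.
  obtain ⟨η, hη0, c, hη, hcδ⟩ := NNReal.exists_pos_sum_of_countable
    (NNReal.sqrt_pos.2 hδ).ne' t
  choose W f hW hWΩ hUW hf0 hf1 hfη using fun x : t => H x (ht x.2) (η x) (hη0 x)
  have hηs : HasSum (fun x => (η x : ℝ)) c := NNReal.hasSum_coe.2 hη
  have hsum : Summable fun x => k (f x) := Summable.of_norm_bounded hηs.summable hfη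
  set y := ∑' x, k (f x)
  have hy : ‖y‖ ≤ c := tsum_of_norm_bounded hηs hfη
  -- All summands are nonnegative, so the sum dominates each of them and is at least one on the
  -- whole union.
  have hle : ∀ x, ι (k (f x)) ≤ ι y := fun x => by
    refine le_hasSum (hsum.hasSum.mapL ι) x fun z _ => ?_
    rw [← Lp.coeFn_nonneg]
    filter_upwards [hc.coeFn_map (f z)] with a ha
    rw [ha]
    exact hf0 z a
  have hcover : {x | x ∈ Ω ∧ ϱ' x = 0} ⊆ ⋃ x, W x := fun x hx => by
    obtain ⟨z, hz, hxz⟩ := mem_iUnion₂.1 (htU hx.1)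
    exact mem_iUnion.2 ⟨⟨z, hz⟩, hUW ⟨z, hz⟩ x hxz hx.2⟩
  have hge : ∀ᵐ x ∂((densityMeasure Ω ϱ).restrict (⋃ x, W x)), 1 ≤ ι y x := by
    rw [ae_restrict_iff' (isOpen_iUnion hW).measurableSet]
    filter_upwards [ae_all_iff.2 fun x => hc.coeFn_map (f x),
      ae_all_iff.2 fun x => (Lp.coeFn_le _ _).2 (hle x)] with a h1 h2 ha
    obtain ⟨z, hz⟩ := mem_iUnion.1 ha
    have h3 := h2 z
    rw [h1 z] at h3
    exact (hf1 z a hz).trans h3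
  refine (iInf₂_le (⋃ x, W x) ⟨isOpen_iUnion hW, hcover, iUnion_subset hWΩ⟩).trans
    ((iInf₂_le ⟨ι y, mem_embeddedForm_domain y⟩ hge).trans ?_)
  · rw [embeddedForm_energyOne (x := y) rfl]
    refine ENNReal.ofReal_le_of_le_toReal ?_
    have h1 : (c : ℝ) ≤ √δ := by
      have := NNReal.coe_le_coe.2 hcδ.le
      rwa [Real.coe_sqrt] at this
    calc ‖y‖ ^ 2 ≤ √(δ : ℝ) ^ 2 := by gcongr; exact hy.trans h1
        _ = (δ : ℝ) := Real.sq_sqrt δ.2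

end IsGradientCompletion

end CapacityZero

/-! ### The main theorem. -/

theorem mainTheorem7 {d : ℕ} (hd : 2 ≤ d) (Ω : Opens (EuclideanSpace ℝ (Fin d)))
    (A : EuclideanSpace ℝ (Fin d) → Matrix (Fin d) (Fin d) ℝ)
    (ϱ : EuclideanSpace ℝ (Fin d) → ℝ)
    (p : ℝ≥0∞) [Fact (1 ≤ p)] (hp : (d : ℝ≥0∞) < p) (hp_top : p ≠ ∞)
    (hcond : EllipticConditions Ω A ϱ p) :
    ∃ ϱ' : EuclideanSpace ℝ (Fin d) → ℝ,
      -- `ϱ'` is the unique continuous version of `ϱ` on `Ω`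
      (ContinuousOn ϱ' Ω ∧ ϱ' =ᵐ[densityMeasure Ω ϱ] ϱ ∧
        ∀ σ : EuclideanSpace ℝ (Fin d) → ℝ, ContinuousOn σ Ω →
          σ =ᵐ[densityMeasure Ω ϱ] ϱ → EqOn σ ϱ' Ω) ∧
      ∃ E₀ E : L2Form (densityMeasure Ω ϱ),
        -- the pre-Dirichlet form is closable, with closure `E`
        IsGradientPreForm Ω A E₀ ∧ E₀.IsClosable ∧ E.IsClosureOf E₀ ∧
        -- the closure is a symmetric, strongly local, regular Dirichlet form
        E.IsSymmDirichletForm ∧ E.IsStronglyLocal Ω ∧ E.IsRegular Ω ∧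
        -- the associated semigroups exist, and their generators are given by `L` on test functions
        (∃ (T : ℝ≥0 → Lp ℝ 2 (densityMeasure Ω ϱ) →L[ℝ] Lp ℝ 2 (densityMeasure Ω ϱ))
          (S : ℝ≥0 → Lp ℝ p (densityMeasure Ω ϱ) →L[ℝ] Lp ℝ p (densityMeasure Ω ϱ)),
          IsL2Semigroup E T ∧ IsLpSemigroup T S) ∧
        (∀ (T : ℝ≥0 → Lp ℝ 2 (densityMeasure Ω ϱ) →L[ℝ] Lp ℝ 2 (densityMeasure Ω ϱ))
          (S : ℝ≥0 → Lp ℝ p (densityMeasure Ω ϱ) →L[ℝ] Lp ℝ p (densityMeasure Ω ϱ)),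
          IsL2Semigroup E T → IsLpSemigroup T S →
          ∀ f : TestFunction Ω ℝ ⊤,
            HasGeneratorValue T f (divergenceGenerator Ω A ϱ f) ∧
            HasGeneratorValue S f (divergenceGenerator Ω A ϱ f)) ∧
        (∀ f : TestFunction Ω ℝ ⊤,
          divergenceGenerator Ω A ϱ f =ᵐ[densityMeasure Ω ϱ] driftGenerator Ω A ϱ f) ∧
        -- the zero set of the continuous version has capacity zero
        E.capacity Ω {x | x ∈ Ω ∧ ϱ' x = 0} = 0 := by
  have hd2 : (2 : ℝ≥0∞) ≤ d := by exact_mod_cast hd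
  have h2p : (2 : ℝ≥0∞) < p := hd2.trans_lt hp
  have h1p : (1 : ℝ≥0∞) < p := lt_trans (by norm_num) h2p
  obtain ⟨ϱ', hϱ', hϱ⟩ := hcond.exists_continuous_version hp hp_top h1p
  obtain ⟨V, _, _, _, ι, k, hc⟩ := hcond.exists_completion h2p.le
  have hden := hc.denseRange_embedding
  refine ⟨ϱ', ⟨hϱ', hϱ, fun σ hσ hσϱ =>
    hcond.isDensity.eqOn_of_ae_eq hσ hϱ' (hσϱ.trans hϱ.symm)⟩,
    preForm hcond.isDensity.toLp hcond.isDensity.toLp_injective hcond.gradientForm,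
    embeddedForm ι hc.injective, hcond.isGradientPreForm,
    preForm_isClosable _ (hcond.gradientForm_closable h2p.le),
    embeddedForm_isClosureOf _ hc.denseRange hc.map_eq hc.inner_eq,
    embeddedForm_isSymmDirichletForm hden hc.norm_le hc.exists_unitContraction,
    hc.isStronglyLocal h2p.le, hc.isRegular, ?_, ?_,
    hcond.divergenceGenerator_ae_eq_driftGenerator, hc.capacity_zero_set h2p.le hϱ' hϱ⟩
  · obtain ⟨T, hT, hs, hM⟩ := exists_semigroup_of_embeddedForm (hι := hc.injective) hden
      hc.norm_le hc.exists_unitContraction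
    obtain ⟨S, hS⟩ := exists_isLpSemigroup h2p hp_top hT.1 hs hM
    exact ⟨T, S, hT, hS⟩
  · intro T S hT hS f
    have h1 := hc.hasGeneratorValue h2p.le hT f
    exact ⟨h1, hS.hasGeneratorValue hT.1 hp_top (hcond.isDensity.memLp_testFunction f 1)
      (hcond.isDensity.memLp_testFunction f p) (hcond.memLp_divergenceGenerator f h1p.le)
      (hcond.memLp_divergenceGenerator f le_rfl) h1⟩
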